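/- \textbf{Setting.} Let $d\ge1$, let $S_t=S_0+\sum_{j=1}^t\xi_j$ be a random walk on $\mathbb Z^d$, and let $x[1]$ denote the first coordinate (height) of $x$. Let $H(x)\in\{0,1,2,\dots\}\cup\{\infty\}$, $x\in\mathbb Z^d$, be random bounds, $L_t(x)=\sum_{j=0}^t\mathbf 1\{S_j=x\}$, $T_*=\inf\{t\ge0:L_t(S_t)>H(S_t)\}$, and for a path $y=(y_0,y_1,\dots)$ let $\alpha(n|y)=\inf\{t\ge0:y_t[1]\ge n\}$ ($\inf\emptyset=\infty$). Put $\alpha(n)=\alpha(n|S)$. Write $\mathbf P_*$ for the probability in this model and $\mathbf P_0$ for the probability in the model with the same $\xi_j$ and the same $H(x)$ for $x[1]\ge0$, but with $S_0=0$ and $H(x)=0$ for all $x$ with $x[1]<0$. Assume: (A1) $\xi_1,\xi_2,\dots$ are i.i.d., $\mathbf P(\xi_1[1]\le1)=1$ and $\mathbf P(\xi_1[1]=1)>0$. (A2) The families $\{S_0;\,H(x),x[1]<0\}$, $\{\xi_i,i\ge1\}$, $\{H(x),x[1]\ge0\}$ are mutually independent, $S_0[1]\le0$ a.s., and $\mathbf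 P_*(\alpha(0)<T_*)>0$. (A3) $\{H(x):x[1]\ge0\}$ are i.i.d. with $\mathbf P(1\le H(0)\le\infty)=1$. (A4) Let $\beta_0=\inf\{t>0:\xi_1[1]+\dots+\xi_t[1]=0\}$ and $\beta_{0,0}=\inf\{t>0:\xi_1+\dots+\xi_t=0\}$. If $\mathbf P(\beta_0<\infty)=1$, then $\mathbf P(\beta_{0,0}<\infty)>0$ and $\mathbf P(H(0)<\infty)>0$. If $\mathbf P(\beta_0=\beta_{0,0}<\infty)=1$, then $\mathbf E H(0)<\infty$. A level $k\in\{0,\dots,n\}$ is $n$-separating for $y$ if $\alpha(n|y)<\infty$ and $\sup_{0\le t<\alpha(k|y)}y_t[1]<k=y_{\alpha(k|y)}[1]\le\inf_{\alpha(k|y)<t<\alpha(n|y)}y_t[1]$. If $\alpha(n)<T_*$, let $\eta_*(n)+1$ be the number of $n$-separating levels of $S$; otherwise $\eta_*(n)=-1$. If $\eta_*(n)\ge1$, let $\varkappa_*(n)$ be the largest $n$-separating level $k<n$ of $S$; otherwise $\varkappa_*(n)=-\infty$. \textbf{Theorem.} Under (A1)--(A4) there is $q\in(0,1]$ with $$\sum_{k\ge1}\frac{\mathbf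 P_0(\varkappa_*(k)=0)}{q^k}=1,\qquad 1\le\sum_{k\ge1}\frac{k\,\mathbf P_0(\varkappa_*(k)=0)}{q^k}<\infty,\qquad 0<\psi_0:=\sum_{m\ge0}\frac{\mathbf P_*(\eta_*(m)=0)}{q^m}<\infty,$$ so that the following core process $\overline S$ exists. Take mutually independent random blocks $(\overline\nu_0,\overline T_0,(\overline S_0,\dots,\overline S_{\overline T_0}))$ and $(\overline\lambda_i,\overline\tau_i,(\overline Y_{i,1},\dots,\overline Y_{i,\overline\tau_i}))$, $i\ge1$, with $\mathbf P(\overline\nu_0=k)=\mathbf P_*(\eta_*(k)=0)/(\psi_0q^k)$ for $k\ge0$, $\mathbf P(\overline\lambda_i=l)=\mathbf P_0(\varkappa_*(l)=0)/q^l$ for $l\ge1$, and, for all $K,L$ and all vectors $\vec y\in\mathbb Z^{(K+1)\times d}$, $\vec x\in\mathbb Z^{L\times d}$, $$\mathbf P(\overline T_0=K,(\overline S_0,\dots,\overline S_K)=\vec y\mid\overline\nu_0=k)=\mathbf P_*(\alpha(k)=K<T_*,(S_0,\dots,S_K)=\vec y\mid\eta_*(k)=0),$$ $$\mathbf P(\overline\tau_i=L,(\overline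 Y_{i,1},\dots,\overline Y_{i,L})=\vec x\mid\overline\lambda_i=l)=\mathbf P_0(\alpha(l)=L<T_*,(S_1-S_0,\dots,S_L-S_0)=\vec x\mid\varkappa_*(l)=0)$$ whenever the conditions have positive probability. Put $\overline\nu_m=\overline\nu_0+\sum_{i=1}^m\overline\lambda_i$, $\overline T_m=\overline T_0+\sum_{i=1}^m\overline\tau_i$, $\overline S_{\overline T_{i-1}+j}=\overline S_{\overline T_{i-1}}+\overline Y_{i,j}$ for $i\ge1$, $1\le j\le\overline\tau_i$, and $\overline\alpha(n)=\alpha(n|\overline S)$. Then for every set $\mathcal A$ of finite paths in $\mathbb Z^d$ and all $n\ge m\ge0$, $$\mathbf P_*\big(\alpha(n)<T_*,\ \eta_*(n)=m,\ (S_0,\dots,S_{\alpha(n)})\in\mathcal A\big)=\psi_0\,q^n\,\mathbf P\big(\overline\nu_m=n,\ (\overline S_0,\dots,\overline S_{\overline\alpha(n)})\in\mathcal A\big).$$ -/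

import Mathlib

open MeasureTheory ProbabilityTheory
open scoped ENNReal

namespace BoundedWalk

/-- Points of the lattice `ℤ^d`; the height of `x` is its first coordinate `x 0`. -/
abbrev Site (d : ℕ) : Type := Fin d → ℤ

section Paths

variable {d : ℕ}

/-- The path `x₀, x₀ + ξ₁, x₀ + ξ₁ + ξ₂, …`; the increment `ξ_{j+1}` is `inc j`. -/
def walk (x₀ : Site d) (inc : ℕ → Site d) (t : ℕ) : Site d :=
  x₀ + ∑ j ∈ Finset.range t, inc j

/-- The number of visits of the path `y` to `x` at the times `0, …, t`. -/
def localTime (y : ℕ → Site d) (t : ℕ) (x : Site d) : ℕ :=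
  ((Finset.range (t + 1)).filter fun j => y j = x).card

/-- The first time at which the number of visits to the current site exceeds the bound `h` at
that site (`⊤` if there is no such time). -/
noncomputable def deathTime (h : Site d → ℕ∞) (y : ℕ → Site d) : ℕ∞ :=
  ⨅ (t : ℕ) (_ : h (y t) < (localTime y t (y t) : ℕ∞)), (t : ℕ∞)

/-- The finite path `(y_0, …, y_N)`. -/
def pathTo (y : ℕ → Site d) (N : ℕ) : List (Site d) :=
  (List.range (N + 1)).map y

/-- The finite path `(y_1 - y_0, …, y_L - y_0)`. -/
def shiftedPathTo (y : ℕ → Site d) (L : ℕ) : List (Site d) :=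
  (List.range L).map fun j => y (j + 1) - y 0

variable [NeZero d]

/-- The hitting time `α(n | y) = inf {t ≥ 0 : y_t[1] ≥ n}`. -/
noncomputable def hitTime (n : ℕ) (y : ℕ → Site d) : ℕ∞ :=
  ⨅ (t : ℕ) (_ : (n : ℤ) ≤ y t 0), (t : ℕ∞)

/-- `k ∈ {0, …, n}` is an `n`-separating level of the path `y`. -/
def IsSeparating (n : ℕ) (y : ℕ → Site d) (k : ℕ) : Prop :=
  k ≤ n ∧ hitTime n y < ⊤ ∧ ∃ K : ℕ, hitTime k y = (K : ℕ∞) ∧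
    (∀ t < K, y t 0 < (k : ℤ)) ∧ y K 0 = (k : ℤ) ∧
    ∀ t : ℕ, K < t → (t : ℕ∞) < hitTime n y → (k : ℤ) ≤ y t 0

open Classical in
/-- `η(n | y)`: the number of `n`-separating levels, minus one. -/
noncomputable def eta (n : ℕ) (y : ℕ → Site d) : ℤ :=
  (((Finset.range (n + 1)).filter (IsSeparating n y)).card : ℤ) - 1

open Classical in
/-- `ϰ(n | y)`: the largest `n`-separating level below `n`; `⊥` stands for `-∞`. -/
noncomputable def kappa (n : ℕ) (y : ℕ → Site d) : WithBot ℕ :=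
  ((Finset.range n).filter (IsSeparating n y)).max

open Classical in
/-- `η_*(n)`, for the path `y` under the bounds `h`. -/
noncomputable def etaStar (n : ℕ) (h : Site d → ℕ∞) (y : ℕ → Site d) : ℤ :=
  if hitTime n y < deathTime h y then eta n y else -1

open Classical in
/-- `ϰ_*(n)`, for the path `y` under the bounds `h`. -/
noncomputable def kappaStar (n : ℕ) (h : Site d → ℕ∞) (y : ℕ → Site d) : WithBot ℕ :=
  if 1 ≤ etaStar n h y then kappa n y else ⊥

/-- `α(n | y)` is finite and the path up to that time, `(y_0, …, y_{α(n | y)})`, is in `A`. -/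
def StoppedPathMem (n : ℕ) (y : ℕ → Site d) (A : Set (List (Site d))) : Prop :=
  ∃ N : ℕ, hitTime n y = (N : ℕ∞) ∧ pathTo y N ∈ A

/-- The first return time of the path `y` to height `0`. -/
noncomputable def returnTimeLevel (y : ℕ → Site d) : ℕ∞ :=
  ⨅ (t : ℕ) (_ : 0 < t ∧ y t 0 = 0), (t : ℕ∞)

/-- The first return time of the path `y` to the origin. -/
noncomputable def returnTimeOrigin (y : ℕ → Site d) : ℕ∞ :=
  ⨅ (t : ℕ) (_ : 0 < t ∧ y t = 0), (t : ℕ∞)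

end Paths

/-- The random data: the starting point `S_0`, the increments `ξ_1, ξ_2, …` (`inc j` is
`ξ_{j+1}`) and the bounds `H(x)` on the local times. -/
structure Model (d : ℕ) (Ω : Type*) where
  start : Ω → Site d
  inc : ℕ → Ω → Site d
  env : Site d → Ω → ℕ∞

namespace Model

variable {d : ℕ} {Ω : Type*}

/-- The path `(S_0, S_1, …)` of the random walk. -/
def path (M : Model d Ω) (ω : Ω) : ℕ → Site d :=
  walk (M.start ω) fun j => M.inc j ω

/-- The bounds `H(·)` for the outcome `ω`. -/
def bound (M : Model d Ω) (ω : Ω) : Site d → ℕ∞ :=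
  fun x => M.env x ω

/-- The time `T_*` at which the walk is killed. -/
noncomputable def death (M : Model d Ω) (ω : Ω) : ℕ∞ :=
  deathTime (M.bound ω) (M.path ω)

/-- The walk with the same increments started at the origin, without bounds. -/
def freePath (M : Model d Ω) (ω : Ω) : ℕ → Site d :=
  walk 0 fun j => M.inc j ω

variable [NeZero d]

open Classical in
/-- The model behind `P_0`: the same increments and the same bounds on the half-space
`{x : x[1] ≥ 0}`, but the walk starts at the origin and no visit is allowed outside that
half-space. -/
noncomputable def zeroModel (M : Model d Ω) : Model d Ω where
  start := fun _ => 0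
  inc := M.inc
  env := fun x ω => if 0 ≤ x 0 then M.env x ω else 0

variable [MeasurableSpace Ω]

/-- The increments are i.i.d. random vectors with a skip-free first coordinate. -/
structure SkipFree (M : Model d Ω) (μ : Measure Ω) : Prop where
  measurable_inc : ∀ j, Measurable (M.inc j)
  indep : iIndepFun M.inc μ
  identDistrib : ∀ j, IdentDistrib (M.inc j) (M.inc 0) μ μ
  le_one : ∀ᵐ ω ∂μ, M.inc 0 ω 0 ≤ 1
  up_pos : 0 < μ {ω | M.inc 0 ω 0 = 1}

/-- The three σ-algebras generated by: the starting point and the bounds outside the half-space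
`{x : x[1] ≥ 0}`; the increments; the bounds in that half-space. -/
@[reducible] def families (M : Model d Ω) : Fin 3 → MeasurableSpace Ω :=
  ![MeasurableSpace.comap M.start inferInstance ⊔
      ⨆ (x : Site d) (_ : ¬ 0 ≤ x 0), MeasurableSpace.comap (M.env x) inferInstance,
    ⨆ j : ℕ, MeasurableSpace.comap (M.inc j) inferInstance,
    ⨆ (x : Site d) (_ : 0 ≤ x 0), MeasurableSpace.comap (M.env x) inferInstance]

/-- Independence of the three families, a start at height at most `0`, and a positive
probability to reach height `0` alive. -/
structure Environment (M : Model d Ω) (μ : Measure Ω) : Prop where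
  measurable_start : Measurable M.start
  measurable_env : ∀ x, Measurable (M.env x)
  indep : iIndep M.families μ
  start_le : ∀ᵐ ω ∂μ, M.start ω 0 ≤ 0
  hit_zero_pos : 0 < μ {ω | hitTime 0 (M.path ω) < M.death ω}

/-- The bounds in the half-space `{x : x[1] ≥ 0}` are i.i.d. and at least `1`. -/
structure Virgin (M : Model d Ω) (μ : Measure Ω) : Prop where
  indep : iIndepFun (fun x : {x : Site d // 0 ≤ x 0} => M.env x.1) μ
  identDistrib : ∀ x : Site d, 0 ≤ x 0 → IdentDistrib (M.env x) (M.env 0) μ μ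
  one_le : ∀ᵐ ω ∂μ, 1 ≤ M.env 0 ω

/-- The technical assumption on returns to height `0` and to the origin, together with the
requirement that the bounds are not all infinite when the height of the walk is recurrent. -/
structure Returns (M : Model d Ω) (μ : Measure Ω) : Prop where
  origin_pos : μ {ω | returnTimeLevel (M.freePath ω) < ⊤} = 1 →
    0 < μ {ω | returnTimeOrigin (M.freePath ω) < ⊤}
  mean_lt_top : μ {ω | returnTimeLevel (M.freePath ω) = returnTimeOrigin (M.freePath ω) ∧
      returnTimeOrigin (M.freePath ω) < ⊤} = 1 →
    ∫⁻ ω, (M.env 0 ω : ℝ≥0∞) ∂μ < ⊤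
  bound_finite_pos : μ {ω | returnTimeLevel (M.freePath ω) < ⊤} = 1 →
    0 < μ {ω | M.env 0 ω < ⊤}

/-- `P_*(η_*(k) = 0)`. -/
noncomputable def probEta (M : Model d Ω) (μ : Measure Ω) (k : ℕ) : ℝ :=
  μ.real {ω | etaStar k (M.bound ω) (M.path ω) = 0}

/-- `P_0(ϰ_*(l) = 0)`. -/
noncomputable def probKappa (M : Model d Ω) (μ : Measure Ω) (l : ℕ) : ℝ :=
  μ.real {ω | kappaStar l (M.zeroModel.bound ω) (M.zeroModel.path ω) = ((0 : ℕ) : WithBot ℕ)}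

/-- `ψ_0 = ∑_{m ≥ 0} P_*(η_*(m) = 0) / q^m`. -/
noncomputable def psi (M : Model d Ω) (μ : Measure Ω) (q : ℝ) : ℝ :=
  ∑' m : ℕ, M.probEta μ m / q ^ m

/-- The properties of the number `q` that make the laws of the core blocks well defined. -/
structure IsRate (M : Model d Ω) (μ : Measure Ω) (q : ℝ) : Prop where
  pos : 0 < q
  le_one : q ≤ 1
  hasSum_one : HasSum (fun k : ℕ => M.probKappa μ (k + 1) / q ^ (k + 1)) 1
  summable_mean : Summable fun k : ℕ => ((k + 1 : ℕ) : ℝ) * (M.probKappa μ (k + 1) / q ^ (k + 1))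
  one_le_mean : 1 ≤ ∑' k : ℕ, ((k + 1 : ℕ) : ℝ) * (M.probKappa μ (k + 1) / q ^ (k + 1))
  summable_psi : Summable fun m : ℕ => M.probEta μ m / q ^ m
  psi_pos : 0 < M.psi μ q

end Model

/-- A block: a height, a duration and a finite path. The initial block carries
`(ν̄_0, T̄_0, (S̄_0, …, S̄_{T̄_0}))`, the `i`-th one, `i ≥ 1`, `(λ̄_i, τ̄_i, (Ȳ_{i,1}, …, Ȳ_{i,τ̄_i}))`. -/
structure Block (d : ℕ) where
  height : ℕ
  duration : ℕ
  points : List (Site d)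

instance (d : ℕ) : MeasurableSpace (Block d) := ⊤

section Core

variable {d : ℕ}

/-- The level `ν̄_m = ν̄_0 + λ̄_1 + … + λ̄_m`. -/
def coreLevel (b : ℕ → Block d) (m : ℕ) : ℕ :=
  ∑ i ∈ Finset.range (m + 1), (b i).height

/-- The finite path `(S̄_0, …, S̄_{T̄_m})`: the initial block, continued by the blocks
`1, …, m`, each of them translated by the end point of the path before it. -/
def corePrefix (b : ℕ → Block d) : ℕ → List (Site d)
  | 0 => (b 0).points
  | m + 1 => corePrefix b m ++ (b (m + 1)).points.map fun x => (corePrefix b m).getLastD 0 + x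

/-- The core path `(S̄_0, S̄_1, …)`. Since every block has at least one point (almost surely),
`S̄_j` is the entry number `j` of `(S̄_0, …, S̄_{T̄_j})`. -/
def corePath (b : ℕ → Block d) (j : ℕ) : Site d :=
  (corePrefix b j).getD j 0

variable [NeZero d]

/-- `b` is the sequence of random blocks of the core process of `M`, for the rate `q`: the
blocks are mutually independent, the law of the height of each block is an exponential transform
of a characteristic of the walk, and, given its height, a block is distributed as the
corresponding piece of the walk. -/
structure IsCore {Ω Ω' : Type*} [MeasurableSpace Ω] [MeasurableSpace Ω'] (M : Model d Ω)
    (μ : Measure Ω) (q : ℝ) (b : ℕ → Ω' → Block d) (P : Measure Ω') : Prop where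
  measurable_block : ∀ i, Measurable (b i)
  indep : iIndepFun b P
  height_zero : ∀ k : ℕ,
    P.real {w | (b 0 w).height = k} = M.probEta μ k / (M.psi μ q * q ^ k)
  height_succ : ∀ i l : ℕ, 1 ≤ i → 1 ≤ l →
    P.real {w | (b i w).height = l} = M.probKappa μ l / q ^ l
  path_zero : ∀ (k K : ℕ) (y : List (Site d)),
    P[|{w | (b 0 w).height = k}] {w | (b 0 w).duration = K ∧ (b 0 w).points = y} =
      μ[|{ω | etaStar k (M.bound ω) (M.path ω) = 0}]
        {ω | hitTime k (M.path ω) = (K : ℕ∞) ∧ (K : ℕ∞) < M.death ω ∧ pathTo (M.path ω) K = y}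
  path_succ : ∀ (i l L : ℕ) (x : List (Site d)), 1 ≤ i → 1 ≤ l →
    P[|{w | (b i w).height = l}] {w | (b i w).duration = L ∧ (b i w).points = x} =
      μ[|{ω | kappaStar l (M.zeroModel.bound ω) (M.zeroModel.path ω) = ((0 : ℕ) : WithBot ℕ)}]
        {ω | hitTime l (M.zeroModel.path ω) = (L : ℕ∞) ∧ (L : ℕ∞) < M.zeroModel.death ω ∧
          shiftedPathTo (M.zeroModel.path ω) L = x}

end Core

end BoundedWalk

namespace BoundedWalk

/-! ### First times of a property of natural numbers. -/

section FirstTime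

variable {p : ℕ → Prop}

theorem firstTime_eq_of {N : ℕ} (hN : p N) (h : ∀ t < N, ¬ p t) :
    (⨅ (t : ℕ) (_ : p t), (t : ℕ∞)) = N := by
  refine le_antisymm (iInf₂_le N hN) (le_iInf₂ fun t ht => ?_)
  by_contra! hlt
  exact h t (by exact_mod_cast hlt) ht

theorem firstTime_lt_top_iff : (⨅ (t : ℕ) (_ : p t), (t : ℕ∞)) < ⊤ ↔ ∃ t, p t := by
  simp [iInf_lt_iff]

theorem firstTime_eq_coe_iff {N : ℕ} :
    (⨅ (t : ℕ) (_ : p t), (t : ℕ∞)) = N ↔ p N ∧ ∀ t < N, ¬ p t := by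
  refine ⟨fun h => ?_, fun h => firstTime_eq_of h.1 h.2⟩
  have hex : ∃ t, p t := firstTime_lt_top_iff.1 (h ▸ ENat.natCast_lt_top N)
  classical
  have h' := firstTime_eq_of (Nat.find_spec hex) fun t ht => Nat.find_min hex ht
  obtain rfl : N = Nat.find hex := by exact_mod_cast h.symm.trans h'
  exact ⟨Nat.find_spec hex, fun t ht => Nat.find_min hex ht⟩

theorem coe_lt_firstTime_iff {N : ℕ} :
    (N : ℕ∞) < (⨅ (t : ℕ) (_ : p t), (t : ℕ∞)) ↔ ∀ t ≤ N, ¬ p t := by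
  constructor
  · intro h t ht hp
    exact absurd (iInf₂_le t hp) (not_le.2 (lt_of_le_of_lt (by exact_mod_cast ht) h))
  · intro h
    refine lt_of_lt_of_le (b := ((N + 1 : ℕ) : ℕ∞)) (by exact_mod_cast N.lt_succ_self)
      (le_iInf₂ fun t ht => ?_)
    by_contra! hlt
    have : t < N + 1 := by exact_mod_cast hlt
    exact h t (by omega) ht

end FirstTime

/-! ### Separating levels of deterministic paths. -/

section Paths

variable {d : ℕ}

theorem localTime_eq_count (y : ℕ → Site d) (t : ℕ) (x : Site d) :
    localTime y t x = (pathTo y t).count x := by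
  rw [localTime, ← Nat.count_eq_card_filter_range, pathTo, List.count, List.countP_map]
  rfl

theorem localTime_succ (y : ℕ → Site d) (t : ℕ) (x : Site d) :
    localTime y (t + 1) x = localTime y t x + if y (t + 1) = x then 1 else 0 := by
  rw [localTime, ← Nat.count_eq_card_filter_range, Nat.count_succ, Nat.count_eq_card_filter_range]
  rfl

theorem localTime_mono (y : ℕ → Site d) (x : Site d) : Monotone fun t => localTime y t x :=
  monotone_nat_of_le_succ fun t => by rw [localTime_succ]; omega

/-- Local times only grow, so a site need only be tested at its last visit. Survival thus depends on
the visit counts of the finite path alone, and independent bounds can evaluate it. -/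
theorem coe_lt_deathTime_iff {h : Site d → ℕ∞} {y : ℕ → Site d} {N : ℕ} :
    (N : ℕ∞) < deathTime h y ↔ ∀ x, ((pathTo y N).count x : ℕ∞) ≤ h x := by
  simp_rw [deathTime, coe_lt_firstTime_iff, not_lt, ← localTime_eq_count]
  constructor
  · intro H x
    induction N with
    | zero =>
      by_cases hx : y 0 = x
      · exact hx ▸ H 0 le_rfl
      · simp [localTime, Finset.filter_singleton, hx]
    | succ N ih =>
      by_cases hx : y (N + 1) = x
      · exact hx ▸ H (N + 1) le_rfl
      · rw [localTime_succ, if_neg hx]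
        exact ih fun t ht => H t (by omega)
  · intro H t ht
    exact le_trans (by exact_mod_cast localTime_mono y (y t) ht) (H (y t))

variable [NeZero d]

theorem hitTime_eq_coe_iff {n N : ℕ} {y : ℕ → Site d} :
    hitTime n y = N ↔ (n : ℤ) ≤ y N 0 ∧ ∀ t < N, y t 0 < (n : ℤ) := by
  simp_rw [hitTime, firstTime_eq_coe_iff, not_le]

theorem exists_hitTime_eq_of_lt_top {n : ℕ} {y : ℕ → Site d} {a : ℕ∞} (h : hitTime n y < a) :
    ∃ N : ℕ, hitTime n y = N :=
  ⟨_, (ENat.natCast_toNat (lt_of_lt_of_le h le_top).ne).symm⟩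

theorem isSeparating_iff {n N k : ℕ} {y : ℕ → Site d} (h : hitTime n y = N) :
    IsSeparating n y k ↔ k ≤ n ∧ ∃ K : ℕ, hitTime k y = K ∧ y K 0 = k ∧
      ∀ t, K < t → t < N → (k : ℤ) ≤ y t 0 := by
  simp only [IsSeparating, h, ENat.natCast_lt_top, true_and, Nat.cast_lt]
  refine and_congr_right fun _ => exists_congr fun K => ⟨fun H => ⟨H.1, H.2.2.1, H.2.2.2⟩,
    fun H => ⟨H.1, (hitTime_eq_coe_iff.1 H.1).2, H.2⟩⟩

theorem kappa_eq_bot_iff {n : ℕ} {y : ℕ → Site d} :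
    kappa n y = ⊥ ↔ ∀ j < n, ¬ IsSeparating n y j := by
  simp [kappa, Finset.max_eq_bot, Finset.filter_eq_empty_iff]

theorem kappa_eq_coe_iff {n k : ℕ} {y : ℕ → Site d} :
    kappa n y = (k : WithBot ℕ) ↔
      k < n ∧ IsSeparating n y k ∧ ∀ j, k < j → j < n → ¬ IsSeparating n y j := by
  classical
  constructor
  · intro h
    have h1 := Finset.mem_of_max (by exact h)
    rw [Finset.mem_filter, Finset.mem_range] at h1
    refine ⟨h1.1, h1.2, fun j hkj hjn hj => ?_⟩
    have h2 := Finset.le_max (Finset.mem_filter.2 ⟨Finset.mem_range.2 hjn, hj⟩)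
    rw [kappa] at h
    rw [h] at h2
    exact absurd (WithBot.coe_le_coe.1 h2) (not_le.2 hkj)
  · rintro ⟨hk, hs, H⟩
    refine le_antisymm (Finset.max_le fun j hj => ?_)
      (Finset.le_max (Finset.mem_filter.2 ⟨Finset.mem_range.2 hk, hs⟩))
    rw [Finset.mem_filter, Finset.mem_range] at hj
    exact WithBot.coe_le_coe.2 (not_lt.1 fun hlt => H j hlt hj.1 hj.2)

/-- The path starts at height at most `0` and its first `N` steps go up by at most `1`. -/
def SkipFreeTo (N : ℕ) (y : ℕ → Site d) : Prop :=
  y 0 0 ≤ 0 ∧ ∀ t < N, y (t + 1) 0 ≤ y t 0 + 1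

/-- Steps up of size at most one cannot jump over a level; the start at height at most `0` settles
the case of passage time `0`. -/
theorem SkipFreeTo.exists_hitTime {n N k : ℕ} {y : ℕ → Site d} (hy : SkipFreeTo N y)
    (h : hitTime n y = N) (hk : k ≤ n) : ∃ K ≤ N, hitTime k y = K ∧ y K 0 = k := by
  have hN := (hitTime_eq_coe_iff.1 h).1
  have hex : ∃ t, (k : ℤ) ≤ y t 0 := ⟨N, by omega⟩
  classical
  have h1 := Nat.find_spec hex
  have h2 := fun t (ht : t < Nat.find hex) => Nat.find_min hex ht
  have hle : Nat.find hex ≤ N := Nat.find_min' hex (by omega)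
  set K := Nat.find hex
  refine ⟨K, hle, hitTime_eq_coe_iff.2 ⟨h1, fun t ht => not_le.1 (h2 t ht)⟩, le_antisymm ?_ h1⟩
  rcases hK : K with _ | K'
  · have := hy.1
    omega
  · have h3 := hy.2 K' (by omega)
    have h4 := h2 K' (by omega)
    omega

theorem SkipFreeTo.isSeparating_self {n N : ℕ} {y : ℕ → Site d} (hy : SkipFreeTo N y)
    (h : hitTime n y = N) : IsSeparating n y n := by
  obtain ⟨K, hK, hn, hyK⟩ := hy.exists_hitTime h le_rfl
  exact (isSeparating_iff h).2 ⟨le_rfl, K, hn, hyK, fun t h1 h2 => by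
    have : N = K := by exact_mod_cast h.symm.trans hn
    omega⟩

section Shift

variable {k K : ℕ} {y : ℕ → Site d}

/-- Before time `K` the path is below height `k`, so nothing before the cut can reach `k + i`. -/
theorem hitTime_shift_iff (hk : hitTime k y = K) (hyK : y K 0 = k) (i J : ℕ) :
    hitTime (k + i) y = ((K + J : ℕ) : ℕ∞) ↔ hitTime i (fun t => y (K + t) - y K) = J := by
  rw [hitTime_eq_coe_iff, hitTime_eq_coe_iff]
  have hlt := (hitTime_eq_coe_iff.1 hk).2
  simp only [Pi.sub_apply, hyK, Nat.cast_add]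
  refine and_congr ⟨fun h => by omega, fun h => by omega⟩ ⟨fun h t ht => ?_, fun h t ht => ?_⟩
  · have := h (K + t) (by omega)
    omega
  · rcases lt_or_ge t K with htK | htK
    · have := hlt t htK
      omega
    · obtain ⟨s, rfl⟩ := Nat.exists_eq_add_of_le htK
      have := h s (by omega)
      omega

theorem isSeparating_shift_iff {m L : ℕ} (hk : hitTime k y = K) (hyK : y K 0 = k)
    (hm : hitTime (k + m) y = ((K + L : ℕ) : ℕ∞)) (i : ℕ) :
    IsSeparating (k + m) y (k + i) ↔ IsSeparating m (fun t => y (K + t) - y K) i := by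
  have hm' := (hitTime_shift_iff hk hyK m L).1 hm
  rw [isSeparating_iff hm, isSeparating_iff hm']
  refine and_congr (by omega) ⟨?_, ?_⟩
  · rintro ⟨J, hJ, hyJ, H⟩
    have hKJ : K ≤ J := by
      by_contra! hlt
      have h1 := (hitTime_eq_coe_iff.1 hk).2 J hlt
      have h2 := (hitTime_eq_coe_iff.1 hJ).1
      push_cast at h2
      omega
    obtain ⟨s, rfl⟩ := Nat.exists_eq_add_of_le hKJ
    refine ⟨s, (hitTime_shift_iff hk hyK i s).1 hJ, ?_, fun t h1 h2 => ?_⟩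
    · simp only [Pi.sub_apply, hyJ, hyK]
      push_cast
      omega
    · have := H (K + t) (by omega) (by omega)
      simp only [Pi.sub_apply, hyK]
      push_cast at this
      omega
  · rintro ⟨J, hJ, hyJ, H⟩
    refine ⟨K + J, (hitTime_shift_iff hk hyK i J).2 hJ, ?_, fun t h1 h2 => ?_⟩
    · simp only [Pi.sub_apply, hyK] at hyJ
      push_cast
      omega
    · obtain ⟨s, rfl⟩ := Nat.exists_eq_add_of_le (show K ≤ t by omega)
      have := H s (by omega) (by omega)
      simp only [Pi.sub_apply, hyK] at this
      push_cast
      omega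

/-- After the first visit to the separating level `k` the path stays at or above `k ≥ j`, so the
longer time horizon imposes nothing new on level `j`. -/
theorem isSeparating_low_iff {n N j : ℕ} (hn : hitTime n y = N) (hs : IsSeparating n y k)
    (hj : j ≤ k) : IsSeparating n y j ↔ IsSeparating k y j := by
  obtain ⟨hkn, K, hk, hyK, hs⟩ := (isSeparating_iff hn).1 hs
  rw [isSeparating_iff hn, isSeparating_iff hk]
  have hKN : K ≤ N := by
    by_contra! hlt
    have h1 := (hitTime_eq_coe_iff.1 hk).2 N hlt
    have h2 := (hitTime_eq_coe_iff.1 hn).1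
    omega
  refine and_congr (by omega) (exists_congr fun J => and_congr_right fun _ =>
    and_congr_right fun _ => ⟨fun H t h1 h2 => H t h1 (by omega), fun H t h1 h2 => ?_⟩)
  rcases lt_trichotomy t K with h | rfl | h
  · exact H t h1 h
  · omega
  · have := hs t h h2
    omega

end Shift

/-- Level `n` itself is always separating for a skip-free path; the subtraction of one in `eta`
accounts for it. -/
theorem eta_eq_zero_iff {n N : ℕ} {y : ℕ → Site d} (hy : SkipFreeTo N y)
    (h : hitTime n y = N) : eta n y = 0 ↔ kappa n y = ⊥ := by
  classical
  rw [eta, kappa_eq_bot_iff, Finset.range_add_one, Finset.filter_insert,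
    if_pos (hy.isSeparating_self h), Finset.card_insert_of_notMem (by simp)]
  simp [Finset.filter_eq_empty_iff]

/-- The separating levels for the horizon `n` are those for the horizon `k`, together with `n`. This
drives the induction over the number of blocks. -/
theorem eta_eq_add_one {n N k : ℕ} {y : ℕ → Site d} (hy : SkipFreeTo N y)
    (h : hitTime n y = N) (hk : kappa n y = (k : WithBot ℕ)) : eta n y = eta k y + 1 := by
  classical
  obtain ⟨hkn, hs, H⟩ := kappa_eq_coe_iff.1 hk
  have : (Finset.range (n + 1)).filter (IsSeparating n y) =
      insert n ((Finset.range (k + 1)).filter (IsSeparating k y)) := by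
    ext j
    simp only [Finset.mem_filter, Finset.mem_range, Finset.mem_insert]
    constructor
    · rintro ⟨hj, hsj⟩
      rcases Nat.lt_succ_iff_lt_or_eq.1 hj with hj' | rfl
      · have hjk : j ≤ k := by
          by_contra! hlt
          exact H j hlt hj' hsj
        exact Or.inr ⟨by omega, (isSeparating_low_iff h hs hjk).1 hsj⟩
      · exact Or.inl rfl
    · rintro (rfl | ⟨hj, hsj⟩)
      · exact ⟨by omega, hy.isSeparating_self h⟩
      · exact ⟨by omega, (isSeparating_low_iff h hs (by omega)).2 hsj⟩
  rw [eta, eta, this, Finset.card_insert_of_notMem (by simp; omega)]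
  push_cast
  ring

theorem eta_eq_succ_iff {n N m : ℕ} {y : ℕ → Site d} (hy : SkipFreeTo N y)
    (h : hitTime n y = N) :
    eta n y = ((m + 1 : ℕ) : ℤ) ↔ ∃ k < n, kappa n y = (k : WithBot ℕ) ∧ eta k y = (m : ℤ) := by
  constructor
  · intro hm
    rcases hk : kappa n y with _ | k
    · have := (eta_eq_zero_iff hy h).2 hk
      rw [this] at hm
      push_cast at hm
      omega
    · have h1 := eta_eq_add_one hy h hk
      exact ⟨k, (kappa_eq_coe_iff.1 hk).1, rfl, by push_cast at hm; omega⟩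
  · rintro ⟨k, -, hk, hm⟩
    rw [eta_eq_add_one hy h hk, hm]
    push_cast
    ring

section Congr

variable {n N : ℕ} {y y' : ℕ → Site d}

theorem hitTime_congr (hyy : ∀ t ≤ N, y t = y' t) : hitTime n y = N ↔ hitTime n y' = N := by
  rw [hitTime_eq_coe_iff, hitTime_eq_coe_iff, hyy N le_rfl]
  refine and_congr_right fun _ => forall₂_congr fun t ht => by rw [hyy t ht.le]

theorem isSeparating_congr (h : hitTime n y = N) (hyy : ∀ t ≤ N, y t = y' t) (k : ℕ) :
    IsSeparating n y k ↔ IsSeparating n y' k := by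
  have key : ∀ {z z' : ℕ → Site d}, hitTime n z = N → (∀ t ≤ N, z t = z' t) →
      IsSeparating n z k → IsSeparating n z' k := by
    intro z z' h hzz hs
    obtain ⟨hkn, K, hk, hyK, hs⟩ := (isSeparating_iff h).1 hs
    have hKN : K ≤ N := by
      by_contra! hlt
      have h1 := (hitTime_eq_coe_iff.1 hk).2 N hlt
      have h2 := (hitTime_eq_coe_iff.1 h).1
      omega
    exact (isSeparating_iff ((hitTime_congr hzz).1 h)).2 ⟨hkn, K,
      (hitTime_congr fun t ht => hzz t (by omega)).1 hk, hzz K hKN ▸ hyK,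
      fun t h1 h2 => hzz t h2.le ▸ hs t h1 h2⟩
  exact ⟨key h hyy, key ((hitTime_congr hyy).1 h) fun t ht => (hyy t ht).symm⟩

theorem kappa_congr (h : hitTime n y = N) (hyy : ∀ t ≤ N, y t = y' t) :
    kappa n y = kappa n y' := by
  classical
  rw [kappa, kappa]
  exact congrArg Finset.max (Finset.filter_congr fun k _ => isSeparating_congr h hyy k)

theorem eta_congr (h : hitTime n y = N) (hyy : ∀ t ≤ N, y t = y' t) :
    eta n y = eta n y' := by
  classical
  rw [eta, eta, Finset.filter_congr fun k _ => isSeparating_congr h hyy k]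

end Congr

end Paths

/-! ### Finite paths: cutting and pasting at a first passage. -/

section Lists

variable {d : ℕ}

/-- The finite path `y`, continued by zeros. -/
def ofList (y : List (Site d)) (t : ℕ) : Site d := y.getD t 0

/-- The finite path `y`, continued by the increments `x` relative to its end point. -/
def cat (y x : List (Site d)) : List (Site d) := y ++ x.map fun z => y.getLastD 0 + z

@[simp]
theorem length_pathTo (Y : ℕ → Site d) (N : ℕ) : (pathTo Y N).length = N + 1 := by simp [pathTo]

@[simp]
theorem length_shiftedPathTo (Y : ℕ → Site d) (L : ℕ) : (shiftedPathTo Y L).length = L := by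
  simp [shiftedPathTo]

@[simp]
theorem length_cat (y x : List (Site d)) : (cat y x).length = y.length + x.length := by simp [cat]

theorem ofList_pathTo (Y : ℕ → Site d) {N t : ℕ} (ht : t ≤ N) : ofList (pathTo Y N) t = Y t := by
  have : t < (pathTo Y N).length := by simp; omega
  rw [ofList, List.getD_eq_getElem _ _ this]
  simp [pathTo]

theorem pathTo_congr {Y Y' : ℕ → Site d} {N : ℕ} (h : ∀ t ≤ N, Y t = Y' t) :
    pathTo Y N = pathTo Y' N := by
  refine List.map_congr_left fun t ht => h t ?_
  rw [List.mem_range] at ht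
  omega

theorem pathTo_ofList {y : List (Site d)} {N : ℕ} (hy : y.length = N + 1) :
    pathTo (ofList y) N = y := by
  refine List.ext_getElem (by simp [hy]) fun i h1 h2 => ?_
  simp only [pathTo, List.getElem_map, List.getElem_range, ofList]
  exact List.getD_eq_getElem _ _ h2

theorem pathTo_eq_iff {Y : ℕ → Site d} {y : List (Site d)} {N : ℕ} (hy : y.length = N + 1) :
    pathTo Y N = y ↔ ∀ t ≤ N, Y t = ofList y t := by
  constructor
  · rintro rfl t ht
    exact (ofList_pathTo Y ht).symm
  · intro h
    rw [pathTo_congr h, pathTo_ofList hy]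

theorem getLastD_pathTo (Y : ℕ → Site d) (N : ℕ) : (pathTo Y N).getLastD 0 = Y N := by
  rw [List.getLastD_eq_getLast?]
  simp [pathTo, List.range_succ]

theorem cons_shiftedPathTo (Y : ℕ → Site d) (L : ℕ) :
    0 :: shiftedPathTo Y L = pathTo (fun t => Y t - Y 0) L := by
  rw [pathTo, List.range_succ_eq_map]
  simp [shiftedPathTo, Function.comp_def]

theorem pathTo_add (Y : ℕ → Site d) (K L : ℕ) :
    pathTo Y (K + L) = cat (pathTo Y K) (shiftedPathTo (fun t => Y (K + t)) L) := by
  rw [cat, getLastD_pathTo, pathTo, show K + L + 1 = (K + 1) + L by ring, List.range_add]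
  simp only [pathTo, List.map_append, List.map_map, shiftedPathTo, Function.comp_def, add_zero,
    add_sub_cancel]
  exact congrArg _ (List.map_congr_left fun j _ => congrArg Y (by omega))

theorem cat_inj {y y' x x' : List (Site d)} (hy : y.length = y'.length)
    (h : cat y x = cat y' x') : y = y' ∧ x = x' := by
  obtain ⟨rfl, h2⟩ := List.append_inj h hy
  exact ⟨rfl, List.map_injective_iff.2 (add_right_injective _) h2⟩

theorem exists_eq_cat {z : List (Site d)} {K : ℕ} (hK : K < z.length) :
    ∃ y x, y.length = K + 1 ∧ z = cat y x := by
  obtain ⟨L, hL⟩ : ∃ L, z.length = K + L + 1 := ⟨z.length - K - 1, by omega⟩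
  exact ⟨_, _, length_pathTo (ofList z) K, by rw [← pathTo_add, pathTo_ofList hL]⟩

theorem ofList_cat_left {y x : List (Site d)} {t : ℕ} (ht : t < y.length) :
    ofList (cat y x) t = ofList y t := by
  rw [ofList, cat, List.getD_append _ _ _ _ ht, ofList]

theorem getLastD_eq_ofList {y : List (Site d)} {K : ℕ} (hy : y.length = K + 1) :
    y.getLastD 0 = ofList y K := by
  conv_lhs => rw [← pathTo_ofList hy, getLastD_pathTo]

/-- The list `x` records positions relative to the cut but not the cut itself; `0 :: x` restores it,
so that index `0` corresponds to the end of `y`. -/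
theorem ofList_cat_right {y x : List (Site d)} {K t : ℕ} (hy : y.length = K + 1)
    (ht : t ≤ x.length) : ofList (cat y x) (K + t) = ofList y K + ofList (0 :: x) t := by
  rcases t with _ | t
  · rw [add_zero, ofList_cat_left (by omega)]
    simp [ofList]
  · rw [ofList, cat, List.getD_append_right _ _ _ _ (by omega),
      show K + (t + 1) - y.length = t by omega, List.getD_eq_getElem _ _ (by simp; omega),
      List.getElem_map]
    refine congrArg₂ (· + ·) (getLastD_eq_ofList hy) ?_
    simp only [ofList, List.getD_cons_succ]
    rw [List.getD_eq_getElem x 0 (by omega)]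

theorem sub_ofList_cat {K t : ℕ} {y x : List (Site d)} (hy : y.length = K + 1) (ht : t ≤ x.length) :
    ofList (cat y x) (K + t) - ofList (cat y x) K = ofList (0 :: x) t := by
  rw [ofList_cat_right hy ht, ofList_cat_left (by omega), add_sub_cancel_left]

variable [NeZero d]

/-- The finite path `y` ends at the time at which it first reaches height `n`. -/
def FirstPassage (n : ℕ) (y : List (Site d)) : Prop :=
  ∃ N : ℕ, y.length = N + 1 ∧ hitTime n (ofList y) = N

/-- The finite path `y` starts at height at most `0` and its steps go up by at most `1`. -/
def SkipFreeList (y : List (Site d)) : Prop := SkipFreeTo (y.length - 1) (ofList y)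

theorem firstPassage_pathTo_iff {n N : ℕ} {Y : ℕ → Site d} :
    FirstPassage n (pathTo Y N) ↔ hitTime n Y = N := by
  have := hitTime_congr (n := n) (y := ofList (pathTo Y N)) (y' := Y) (N := N)
    fun t ht => ofList_pathTo Y ht
  simp [FirstPassage, this]

theorem FirstPassage.hitTime_eq {n N : ℕ} {y : List (Site d)} (h : FirstPassage n y)
    (hN : y.length = N + 1) : hitTime n (ofList y) = N := by
  obtain ⟨N', h1, h2⟩ := h
  obtain rfl : N = N' := by omega
  exact h2

theorem FirstPassage.end_height {n N : ℕ} {y : List (Site d)} (h : FirstPassage n y)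
    (hs : SkipFreeList y) (hN : y.length = N + 1) : ofList y N 0 = n := by
  have h' := h.hitTime_eq hN
  rw [SkipFreeList, hN, Nat.add_sub_cancel] at hs
  obtain ⟨K, -, hK, hyK⟩ := hs.exists_hitTime h' le_rfl
  obtain rfl : N = K := by exact_mod_cast h'.symm.trans hK
  exact hyK

section Cat

variable {k K : ℕ} {y x : List (Site d)}

theorem hitTime_cat (hy : y.length = K + 1) (hk : FirstPassage k y) :
    hitTime k (ofList (cat y x)) = K :=
  (hitTime_congr fun t ht => (ofList_cat_left (by omega)).symm).1 (hk.hitTime_eq hy)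

theorem ofList_cat_end (hy : y.length = K + 1) (hyK : ofList y K 0 = k) :
    ofList (cat y x) K 0 = k := by
  rwa [ofList_cat_left (by omega)]

theorem firstPassage_cat_iff (hy : y.length = K + 1) (hk : FirstPassage k y)
    (hyK : ofList y K 0 = k) (m : ℕ) :
    FirstPassage (k + m) (cat y x) ↔ FirstPassage m (0 :: x) := by
  have h1 := hitTime_shift_iff (hitTime_cat (x := x) hy hk) (ofList_cat_end hy hyK) m x.length
  rw [hitTime_congr fun t ht => sub_ofList_cat hy ht] at h1
  constructor
  · intro h
    refine ⟨x.length, by simp, h1.1 (h.hitTime_eq ?_)⟩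
    rw [length_cat]
    omega
  · intro h
    exact ⟨K + x.length, by rw [length_cat]; omega, h1.2 (h.hitTime_eq (by simp))⟩

theorem isSeparating_cat_iff (hy : y.length = K + 1) (hk : FirstPassage k y)
    (hyK : ofList y K 0 = k) {m : ℕ} (hm : FirstPassage m (0 :: x)) (i : ℕ) :
    IsSeparating (k + m) (ofList (cat y x)) (k + i) ↔ IsSeparating m (ofList (0 :: x)) i := by
  have h1 := hitTime_cat (x := x) hy hk
  have h2 := ofList_cat_end (x := x) hy hyK
  have h3 : hitTime (k + m) (ofList (cat y x)) = ((K + x.length : ℕ) : ℕ∞) :=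
    ((firstPassage_cat_iff hy hk hyK m).2 hm).hitTime_eq (by rw [length_cat]; omega)
  rw [isSeparating_shift_iff h1 h2 h3]
  exact isSeparating_congr ((hitTime_shift_iff h1 h2 _ _).1 h3) (fun t ht => sub_ofList_cat hy ht) i

theorem kappa_cat_iff (hy : y.length = K + 1) (hk : FirstPassage k y)
    (hyK : ofList y K 0 = k) {m : ℕ} (hm : FirstPassage m (0 :: x)) :
    kappa (k + m) (ofList (cat y x)) = (k : WithBot ℕ) ↔
      kappa m (ofList (0 :: x)) = ((0 : ℕ) : WithBot ℕ) := by
  rw [kappa_eq_coe_iff, kappa_eq_coe_iff, ← isSeparating_cat_iff hy hk hyK hm, add_zero]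
  refine and_congr (by omega) (and_congr_right fun _ => ⟨fun h j h1 h2 => ?_, fun h j h1 h2 => ?_⟩)
  · rw [← isSeparating_cat_iff hy hk hyK hm]
    exact h _ (by omega) (by omega)
  · obtain ⟨i, rfl⟩ := Nat.exists_eq_add_of_le h1.le
    rw [isSeparating_cat_iff hy hk hyK hm]
    exact h _ (by omega) (by omega)

theorem eta_cat_left {n : ℕ} (hy : y.length = K + 1) (hk : FirstPassage k y) (hn : n = k) :
    eta n (ofList (cat y x)) = eta k (ofList y) :=
  hn ▸ (eta_congr (hk.hitTime_eq hy) fun t ht => (ofList_cat_left (by omega)).symm).symm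

end Cat

/-- A skip-free path splits at the time at which it first reaches the level `k`. -/
theorem FirstPassage.exists_cat {n k : ℕ} {z : List (Site d)} (h : FirstPassage n z)
    (hs : SkipFreeList z) (hk : k ≤ n) :
    ∃ y x K, z = cat y x ∧ y.length = K + 1 ∧ FirstPassage k y ∧ ofList y K 0 = k ∧
      FirstPassage (n - k) (0 :: x) := by
  obtain ⟨N, hN, hz⟩ := h
  rw [SkipFreeList, hN, Nat.add_sub_cancel] at hs
  obtain ⟨K, hKN, hK, hzK⟩ := hs.exists_hitTime hz hk
  obtain ⟨y, x, hy, rfl⟩ := exists_eq_cat (z := z) (K := K) (by omega)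
  have hk' : FirstPassage k y :=
    ⟨K, hy, (hitTime_congr fun t ht => ofList_cat_left (by omega)).1 hK⟩
  have hyK : ofList y K 0 = k := by rwa [ofList_cat_left (by omega)] at hzK
  refine ⟨y, x, K, rfl, hy, hk', hyK, (firstPassage_cat_iff hy hk' hyK _).1 ?_⟩
  rw [Nat.add_sub_of_le hk]
  exact ⟨N, hN, hz⟩

/-- The cut can be recovered from the whole path: the first piece ends at the first passage of `k`.
-/
theorem FirstPassage.cat_inj {k : ℕ} {y y' x x' : List (Site d)} (hy : FirstPassage k y)
    (hy' : FirstPassage k y') (h : cat y x = cat y' x') : y = y' ∧ x = x' := by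
  obtain ⟨K, hK, -⟩ := id hy
  obtain ⟨K', hK', -⟩ := id hy'
  have h1 := hitTime_cat (x := x) hK hy
  have h2 := hitTime_cat (x := x') hK' hy'
  rw [h, h2] at h1
  exact BoundedWalk.cat_inj (by rw [hK, hK']; congr 1; exact_mod_cast h1.symm) h

end Lists

/-! ### Weights of finite paths and the probabilities of cylinders. -/

section Weights

variable {d : ℕ}

/-- The probability that a walk with step law `p` follows the path `y` after the site `c`. -/
noncomputable def stepWeight (p : Site d → ℝ≥0∞) : Site d → List (Site d) → ℝ≥0∞
  | _, [] => 1
  | c, z :: l => p (z - c) * stepWeight p z l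

/-- The probability that a walk with step law `p`, started at the first site of `y`, follows the
path `y`. -/
noncomputable def pathWeight (p : Site d → ℝ≥0∞) : List (Site d) → ℝ≥0∞
  | [] => 0
  | z :: l => stepWeight p z l

open Classical in
/-- The probability that independent bounds with tail `G` admit the visits of the path `y` to the
sites in `φ`. -/
noncomputable def boundWeight (G : ℕ → ℝ≥0∞) (φ : Site d → Prop) (y : List (Site d)) : ℝ≥0∞ :=
  ∏ x ∈ y.toFinset with φ x, G (y.count x)

theorem stepWeight_eq_prod (p : Site d → ℝ≥0∞) (c : Site d) (l : List (Site d)) :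
    stepWeight p c l =
      ∏ j ∈ Finset.range l.length, p (ofList (c :: l) (j + 1) - ofList (c :: l) j) := by
  induction l generalizing c with
  | nil => simp [stepWeight]
  | cons z l ih =>
    rw [stepWeight, ih, List.length_cons, Finset.prod_range_succ', mul_comm]
    rfl

theorem pathWeight_eq_prod (p : Site d → ℝ≥0∞) {y : List (Site d)} {N : ℕ}
    (hy : y.length = N + 1) :
    pathWeight p y = ∏ j ∈ Finset.range N, p (ofList y (j + 1) - ofList y j) := by
  rcases y with _ | ⟨c, l⟩
  · simp at hy
  · obtain rfl : l.length = N := by simpa using hy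
    exact stepWeight_eq_prod p c l

theorem walk_eq_iff {x₀ : Site d} {inc y : ℕ → Site d} {N : ℕ} :
    (∀ t ≤ N, walk x₀ inc t = y t) ↔ x₀ = y 0 ∧ ∀ j < N, inc j = y (j + 1) - y j := by
  have hs : ∀ t, walk x₀ inc (t + 1) = walk x₀ inc t + inc t := fun t => by
    simp [walk, Finset.sum_range_succ, add_assoc]
  constructor
  · intro h
    refine ⟨by simpa [walk] using h 0 (by omega), fun j hj => ?_⟩
    rw [← h j hj.le, ← h (j + 1) hj, hs, add_sub_cancel_left]
  · rintro ⟨h0, h⟩ t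
    induction t with
    | zero => simpa [walk] using h0
    | succ t ih => 
      intro ht
      rw [hs, ih (by omega), h t (by omega), add_sub_cancel]

end Weights

namespace Model

variable {d : ℕ} {Ω : Type*} [MeasurableSpace Ω]

/-- The law of the increments. -/
noncomputable def stepLaw (M : Model d Ω) (μ : Measure Ω) (s : Site d) : ℝ≥0∞ :=
  μ {ω | M.inc 0 ω = s}

/-- The tail of the law of the bounds. -/
noncomputable def boundTail (M : Model d Ω) (μ : Measure Ω) (k : ℕ) : ℝ≥0∞ :=
  μ {ω | (k : ℕ∞) ≤ M.env 0 ω}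

variable [NeZero d]

/-- The starting point is that of `y`, and the bounds at negative heights admit `y`. -/
def belowSet (M : Model d Ω) (y : List (Site d)) : Set Ω :=
  {ω | y.head? = some (M.start ω) ∧ ∀ x : Site d, x 0 < 0 → (y.count x : ℕ∞) ≤ M.env x ω}

/-- The probability that the walk follows `y` and that the bounds admit this. -/
noncomputable def weight (M : Model d Ω) (μ : Measure Ω) (y : List (Site d)) : ℝ≥0∞ :=
  μ (M.belowSet y) * pathWeight (M.stepLaw μ) y *
    boundWeight (M.boundTail μ) (fun x => 0 ≤ x 0) y

/-- The assumptions on the model under which the laws of its finite paths factorize. -/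
structure Regular (M : Model d Ω) (μ : Measure Ω) : Prop where
  skipFree : M.SkipFree μ
  measurable_start : Measurable M.start
  measurable_env : ∀ x, Measurable (M.env x)
  indep : iIndep M.families μ
  start_le : ∀ᵐ ω ∂μ, M.start ω 0 ≤ 0
  virgin : M.Virgin μ

section

variable {M : Model d Ω} {μ : Measure Ω}

theorem Regular.stepWeight_inc (hM : M.Regular μ) (y : ℕ → Site d) (N : ℕ) :
    μ (⋂ j ∈ Finset.range N, M.inc j ⁻¹' {y j}) = ∏ j ∈ Finset.range N, M.stepLaw μ (y j) := by
  rw [hM.skipFree.indep.meas_biInter fun j _ => ⟨_, MeasurableSet.singleton _, rfl⟩]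
  exact Finset.prod_congr rfl fun j _ =>
    (hM.skipFree.identDistrib j).measure_mem_eq (MeasurableSet.singleton _)

theorem Regular.boundWeight_env (hM : M.Regular μ) (y : List (Site d)) :
    μ {ω | ∀ x : Site d, 0 ≤ x 0 → (y.count x : ℕ∞) ≤ M.env x ω} =
      boundWeight (M.boundTail μ) (fun x => 0 ≤ x 0) y := by
  classical
  -- Unvisited sites have count `0` and impose nothing, which leaves a finite intersection of
  -- independent events.
  have h1 : {ω | ∀ x : Site d, 0 ≤ x 0 → (y.count x : ℕ∞) ≤ M.env x ω} =
      ⋂ x ∈ y.toFinset.subtype (fun x : Site d => 0 ≤ x 0),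
        M.env x.1 ⁻¹' Set.Ici (y.count x.1 : ℕ∞) := by
    ext ω
    simp only [Set.mem_ofPred_eq, Set.mem_iInter, Finset.mem_subtype, List.mem_toFinset,
      Set.mem_preimage, Set.mem_Ici, Subtype.forall]
    refine ⟨fun h x hx _ => h x hx, fun h x hx => ?_⟩
    by_cases hxy : x ∈ y
    · exact h x hx hxy
    · simp [List.count_eq_zero_of_not_mem hxy]
  rw [h1, hM.virgin.indep.meas_biInter
    fun x _ => ⟨Set.Ici (y.count x.1 : ℕ∞), MeasurableSet.of_discrete, rfl⟩, boundWeight]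
  rw [Finset.prod_congr rfl fun x _ =>
    (hM.virgin.identDistrib x.1 x.2).measure_mem_eq MeasurableSet.of_discrete]
  refine (Finset.prod_subtype_eq_prod_filter
    (fun x => μ (M.env 0 ⁻¹' Set.Ici (y.count x : ℕ∞)))).trans ?_
  refine Finset.prod_congr ?_ fun _ _ => rfl
  ext x
  simp

omit [MeasurableSpace Ω] in
-- Independence of the three families is used through their σ-algebras, so plain measurability would
-- not be enough.
theorem measurableSet_belowSet (y : List (Site d)) :
    MeasurableSet[M.families 0] (M.belowSet y) := by
  have : M.belowSet y = M.start ⁻¹' {z | y.head? = some z} ∩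
      ⋂ (x : Site d) (_ : x 0 < 0), M.env x ⁻¹' Set.Ici (y.count x : ℕ∞) := by
    ext ω
    simp [belowSet]
  rw [this]
  refine MeasurableSet.inter (le_sup_left (a := MeasurableSpace.comap M.start inferInstance) _
    ⟨_, MeasurableSet.of_discrete, rfl⟩) ?_
  refine MeasurableSet.iInter fun x => MeasurableSet.iInter fun hx => ?_
  refine le_sup_right (a := MeasurableSpace.comap M.start inferInstance) _ ?_
  exact le_iSup₂ (f := fun (x : Site d) (_ : ¬ 0 ≤ x 0) =>
    MeasurableSpace.comap (M.env x) inferInstance) x (not_le.2 hx) _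
      ⟨_, MeasurableSet.of_discrete, rfl⟩

/-- The event that the walk follows the path `y` and that the bounds admit this. -/
def cylinder (M : Model d Ω) (y : List (Site d)) : Set Ω :=
  {ω | pathTo (M.path ω) (y.length - 1) = y ∧ ∀ x, (y.count x : ℕ∞) ≤ M.env x ω}

omit [MeasurableSpace Ω] in
-- The three sets belong to the three independent families: start and lower bounds, increments,
-- upper bounds.
theorem cylinder_eq {y : List (Site d)} {N : ℕ} (hy : y.length = N + 1) :
    M.cylinder y = M.belowSet y ∩
      (⋂ j ∈ Finset.range N, M.inc j ⁻¹' {ofList y (j + 1) - ofList y j}) ∩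
      {ω | ∀ x : Site d, 0 ≤ x 0 → (y.count x : ℕ∞) ≤ M.env x ω} := by
  ext ω
  have h0 : y.head? = some (M.start ω) ↔ M.start ω = ofList y 0 := by
    rcases y with _ | ⟨c, l⟩
    · simp at hy
    · simp [ofList, eq_comm]
  simp only [cylinder, hy, Nat.add_sub_cancel, Set.mem_ofPred_eq, pathTo_eq_iff hy, path,
    walk_eq_iff, belowSet, Set.mem_inter_iff, Set.mem_iInter, Finset.mem_range, Set.mem_preimage,
    Set.mem_singleton_iff, h0]
  constructor
  · exact fun h => ⟨⟨⟨h.1.1, fun x _ => h.2 x⟩, h.1.2⟩, fun x _ => h.2 x⟩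
  · exact fun h => ⟨⟨h.1.1.1, h.1.2⟩, fun x => (lt_or_ge (x 0) 0).elim (h.1.1.2 x) (h.2 x)⟩

theorem Regular.measurableSet_cylinder (hM : M.Regular μ) {y : List (Site d)} (hy : y ≠ []) :
    MeasurableSet (M.cylinder y) := by
  obtain ⟨N, hN⟩ := Nat.exists_eq_add_of_lt (List.length_pos_iff.2 hy)
  rw [zero_add] at hN
  have hset : ∀ φ : Site d → Prop,
      MeasurableSet {ω | ∀ x : Site d, φ x → (y.count x : ℕ∞) ≤ M.env x ω} := fun φ => by
    simp_rw [Set.ofPred_forall]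
    exact MeasurableSet.iInter fun x => MeasurableSet.iInter fun _ =>
      hM.measurable_env x (MeasurableSet.of_discrete (s := Set.Ici (y.count x : ℕ∞)))
  rw [cylinder_eq hN]
  refine MeasurableSet.inter (MeasurableSet.inter ?_ ?_) (hset _)
  · exact (hM.measurable_start (MeasurableSet.of_discrete (s := {z | y.head? = some z}))).inter
      (hset _)
  · exact Finset.measurableSet_biInter _ fun j _ =>
      hM.skipFree.measurable_inc j (MeasurableSet.singleton _)

theorem Regular.measure_cylinder (hM : M.Regular μ) {y : List (Site d)} (hy : y ≠ []) :
    μ (M.cylinder y) = M.weight μ y := by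
  obtain ⟨N, hN⟩ := Nat.exists_eq_add_of_lt (List.length_pos_iff.2 hy)
  rw [zero_add] at hN
  have h := hM.indep.meas_iInter (s := ![M.belowSet y,
      ⋂ j ∈ Finset.range N, M.inc j ⁻¹' {ofList y (j + 1) - ofList y j},
      {ω | ∀ x : Site d, 0 ≤ x 0 → (y.count x : ℕ∞) ≤ M.env x ω}]) ?_
  · have hi : ∀ A B C : Set Ω, ⋂ i, (![A, B, C] : Fin 3 → Set Ω) i = A ∩ B ∩ C := by
      intro A B C
      ext ω
      simp [Fin.forall_fin_succ, and_assoc]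
    rw [hi, ← cylinder_eq hN, Fin.prod_univ_three] at h
    rw [h, weight, pathWeight_eq_prod _ hN, ← hM.boundWeight_env, ← hM.stepWeight_inc]
    rfl
  · intro i
    fin_cases i
    · exact measurableSet_belowSet y
    · refine Finset.measurableSet_biInter _ fun j _ => ?_
      exact le_iSup (fun j => MeasurableSpace.comap (M.inc j) inferInstance) j _
        ⟨_, MeasurableSet.singleton _, rfl⟩
    · change MeasurableSet[M.families 2] {ω | ∀ x : Site d, 0 ≤ x 0 → (y.count x : ℕ∞) ≤ M.env x ω}
      simp_rw [Set.ofPred_forall]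
      refine MeasurableSet.iInter fun x => MeasurableSet.iInter fun hx => ?_
      exact le_iSup₂ (f := fun (x : Site d) (_ : 0 ≤ x 0) =>
        MeasurableSpace.comap (M.env x) inferInstance) x hx _
          ⟨Set.Ici (y.count x : ℕ∞), MeasurableSet.of_discrete, rfl⟩

end

end Model

/-! ### Events of the stopped path as sums of weights. -/

/-- The path `Y` up to the time at which it first reaches height `n`. -/
noncomputable def stopped {d : ℕ} [NeZero d] (n : ℕ) (Y : ℕ → Site d) : List (Site d) :=
  pathTo Y (hitTime n Y).toNat

section Stopped

variable {d : ℕ} [NeZero d] {n N : ℕ} {Y : ℕ → Site d}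

theorem stopped_eq (h : hitTime n Y = N) : stopped n Y = pathTo Y N := by
  rw [stopped, h, ENat.toNat_natCast]

theorem kappa_stopped (h : hitTime n Y = N) : kappa n (ofList (stopped n Y)) = kappa n Y := by
  rw [stopped_eq h]
  exact (kappa_congr h fun t ht => (ofList_pathTo Y ht).symm).symm

theorem eta_stopped (h : hitTime n Y = N) : eta n (ofList (stopped n Y)) = eta n Y := by
  rw [stopped_eq h]
  exact (eta_congr h fun t ht => (ofList_pathTo Y ht).symm).symm

theorem stoppedPathMem_iff (h : hitTime n Y = N) (A : Set (List (Site d))) :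
    StoppedPathMem n Y A ↔ stopped n Y ∈ A := by
  rw [stopped_eq h, StoppedPathMem]
  constructor
  · rintro ⟨N', hN', hA⟩
    obtain rfl : N = N' := by exact_mod_cast h.symm.trans hN'
    exact hA
  · exact fun hA => ⟨N, h, hA⟩

/-- The value `-1` given to killed walks is not a natural number, so equality with `m` already
contains survival. -/
theorem etaStar_eq_coe_iff {h : Site d → ℕ∞} {m : ℕ} :
    etaStar n h Y = (m : ℤ) ↔
      hitTime n Y < deathTime h Y ∧ eta n (ofList (stopped n Y)) = (m : ℤ) := by
  by_cases hlt : hitTime n Y < deathTime h Y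
  · obtain ⟨N, hN⟩ := exists_hitTime_eq_of_lt_top hlt
    rw [etaStar, if_pos hlt, eta_stopped hN]
    simp [hlt]
  · simp only [etaStar, hlt, if_false, false_and, iff_false]
    have := Int.natCast_nonneg m
    intro h'
    rw [← h'] at this
    exact absurd this (by decide)

theorem kappaStar_eq_coe_iff {h : Site d → ℕ∞} {k : ℕ} :
    kappaStar n h Y = (k : WithBot ℕ) ↔
      hitTime n Y < deathTime h Y ∧ 1 ≤ eta n (ofList (stopped n Y)) ∧
        kappa n (ofList (stopped n Y)) = (k : WithBot ℕ) := by
  by_cases hlt : hitTime n Y < deathTime h Y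
  · obtain ⟨N, hN⟩ := exists_hitTime_eq_of_lt_top hlt
    rw [kappaStar, etaStar, if_pos hlt, eta_stopped hN, kappa_stopped hN]
    by_cases h1 : 1 ≤ eta n Y <;> simp [h1, hlt]
  · simp [kappaStar, etaStar, hlt]

end Stopped

namespace Model

variable {d : ℕ} {Ω : Type*} [MeasurableSpace Ω] [NeZero d] {M : Model d Ω} {μ : Measure Ω}

open Classical in
omit [MeasurableSpace Ω] in
-- There are only countably many finite paths, and a surviving walk stopped at height `n` follows
-- exactly one first-passage path. Probabilities become sums of weights.
theorem stopped_event_eq (M : Model d Ω) (n : ℕ) (Q : List (Site d) → Prop) :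
    {ω | hitTime n (M.path ω) < M.death ω ∧ Q (stopped n (M.path ω))} =
      ⋃ y : List (Site d), if FirstPassage n y ∧ Q y then M.cylinder y else ∅ := by
  ext ω
  simp only [Set.mem_ofPred_eq, Set.mem_iUnion]
  constructor
  · rintro ⟨hlt, hQ⟩
    obtain ⟨N, hN⟩ := exists_hitTime_eq_of_lt_top hlt
    rw [stopped_eq hN] at hQ
    refine ⟨pathTo (M.path ω) N, ?_⟩
    rw [if_pos ⟨firstPassage_pathTo_iff.2 hN, hQ⟩]
    rw [hN, death, coe_lt_deathTime_iff] at hlt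
    exact ⟨by rw [length_pathTo, Nat.add_sub_cancel], hlt⟩
  · rintro ⟨y, hy⟩
    split_ifs at hy with h
    · obtain ⟨N, hN, -⟩ := id h.1
      obtain ⟨hy1, hy2⟩ := hy
      rw [hN, Nat.add_sub_cancel] at hy1
      have hhit : hitTime n (M.path ω) = N := firstPassage_pathTo_iff.1 (hy1 ▸ h.1)
      rw [stopped_eq hhit, hhit, hy1, death, coe_lt_deathTime_iff, hy1]
      exact ⟨hy2, h.2⟩
    · exact hy.elim

open Classical in
theorem Regular.measurableSet_firstPassage_cylinder (hM : M.Regular μ) (n : ℕ)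
    (Q : List (Site d) → Prop) (y : List (Site d)) :
    MeasurableSet (if FirstPassage n y ∧ Q y then M.cylinder y else ∅) := by
  split_ifs with h
  · obtain ⟨N, hN, -⟩ := id h.1
    exact hM.measurableSet_cylinder (List.ne_nil_of_length_eq_add_one hN)
  · exact MeasurableSet.empty

theorem Regular.measurableSet_stopped (hM : M.Regular μ) (n : ℕ) (Q : List (Site d) → Prop) :
    MeasurableSet {ω | hitTime n (M.path ω) < M.death ω ∧ Q (stopped n (M.path ω))} := by
  rw [stopped_event_eq]
  exact MeasurableSet.iUnion fun y => hM.measurableSet_firstPassage_cylinder n Q y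

open Classical in
theorem Regular.measure_stopped (hM : M.Regular μ) (n : ℕ) (Q : List (Site d) → Prop) :
    μ {ω | hitTime n (M.path ω) < M.death ω ∧ Q (stopped n (M.path ω))} =
      ∑' y : List (Site d), if FirstPassage n y ∧ Q y then M.weight μ y else 0 := by
  rw [stopped_event_eq, measure_iUnion]
  · refine tsum_congr fun y => ?_
    split_ifs with h
    · obtain ⟨N, hN, -⟩ := id h.1
      exact hM.measure_cylinder (List.ne_nil_of_length_eq_add_one hN)
    · exact measure_empty
  · intro y y' hne
    simp only [Function.onFun]
    split_ifs with h h'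
    -- Two first-passage paths followed by the same walk have the same length, dictated by the
    -- passage time, and hence coincide.
    · refine Set.disjoint_left.2 fun ω hω hω' => hne ?_
      obtain ⟨N, hN, -⟩ := id h.1
      obtain ⟨N', hN', -⟩ := id h'.1
      obtain ⟨h1, -⟩ := hω
      obtain ⟨h1', -⟩ := hω'
      rw [hN, Nat.add_sub_cancel] at h1
      rw [hN', Nat.add_sub_cancel] at h1'
      have e := firstPassage_pathTo_iff.1 (h1.symm ▸ h.1)
      have e' := firstPassage_pathTo_iff.1 (h1'.symm ▸ h'.1)
      obtain rfl : N = N' := by exact_mod_cast e.symm.trans e'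
      rw [← h1, h1']
    all_goals simp
  · exact hM.measurableSet_firstPassage_cylinder n Q

/-- Positive weight is a deterministic substitute for "almost surely": every step, and the start, of
such a path has positive probability, so it inherits the almost sure constraints. -/
theorem Regular.skipFreeList (hM : M.Regular μ) {y : List (Site d)} (hy : M.weight μ y ≠ 0) :
    SkipFreeList y := by
  rw [weight, mul_ne_zero_iff, mul_ne_zero_iff] at hy
  rcases hN : y.length with _ | N
  · rw [List.length_eq_zero_iff.1 hN] at hy
    simp [pathWeight] at hy
  · rw [pathWeight_eq_prod _ hN, Finset.prod_ne_zero_iff] at hy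
    rw [SkipFreeList, hN]
    refine ⟨?_, fun t ht => ?_⟩
    · by_contra! hlt
      refine hy.1.1 (measure_mono_null (fun ω hω => ?_) hM.start_le)
      have h0 := hω.1
      rcases y with _ | ⟨c, l⟩
      · simp at hN
      · simp only [List.head?_cons, Option.some.injEq] at h0
        simp only [ofList, List.getD_cons_zero] at hlt
        simp [← h0, hlt]
    · by_contra! hlt
      refine hy.1.2 t (Finset.mem_range.2 (by omega))
        (measure_mono_null (fun ω hω => ?_) hM.skipFree.le_one)
      simp only [Set.mem_ofPred_eq] at hω
      simp [hω]
      omega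

/-! ### The model behind `P_0` satisfies the same assumptions. -/

section ZeroModel

omit [MeasurableSpace Ω] in
theorem zeroModel_env {x : Site d} (hx : 0 ≤ x 0) : M.zeroModel.env x = M.env x := by
  ext ω
  simp [zeroModel, hx]

omit [MeasurableSpace Ω] in
theorem zeroModel_env_neg {x : Site d} (hx : ¬ 0 ≤ x 0) : M.zeroModel.env x = fun _ => 0 := by
  ext ω
  simp [zeroModel, hx]

omit [MeasurableSpace Ω] in
-- A fixed start and zero bounds below level `0` generate the trivial σ-algebra; the other two
-- families are unchanged. Independence is therefore inherited.
theorem families_zeroModel_le (i : Fin 3) : M.zeroModel.families i ≤ M.families i := by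
  have h0 : M.zeroModel.families 0 ≤ M.families 0 := by
    have : M.zeroModel.families 0 = ⊥ := by
      refine le_bot_iff.1 (sup_le ?_ (iSup₂_le fun x hx => ?_))
      · exact (MeasurableSpace.comap_const (m := inferInstance) (0 : Site d)).le
      · rw [zeroModel_env_neg hx]
        exact (MeasurableSpace.comap_const (m := inferInstance) (0 : ℕ∞)).le
    rw [this]
    exact bot_le
  have h2 : M.zeroModel.families 2 ≤ M.families 2 :=
    iSup₂_mono fun x hx => by rw [zeroModel_env hx]
  have h1 : M.zeroModel.families 1 ≤ M.families 1 :=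
    iSup_mono fun j => le_rfl
  fin_cases i
  exacts [h0, h1, h2]

theorem Regular.zeroModel_indep (hM : M.Regular μ) : iIndep M.zeroModel.families μ := by
  rw [iIndep_iff]
  exact fun s f hf => (iIndep_iff _ _).1 hM.indep s fun i hi => families_zeroModel_le i _ (hf i hi)

theorem Regular.zeroModel_virgin (hM : M.Regular μ) : M.zeroModel.Virgin μ := by
  have h0 : M.zeroModel.env 0 = M.env 0 := zeroModel_env le_rfl
  refine ⟨?_, fun x hx => ?_, ?_⟩
  · have : (fun x : {x : Site d // 0 ≤ x 0} => M.zeroModel.env x.1) =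
        fun x : {x : Site d // 0 ≤ x 0} => M.env x.1 := funext fun x => zeroModel_env x.2
    rw [this]
    exact hM.virgin.indep
  · rw [zeroModel_env hx, h0]
    exact hM.virgin.identDistrib x hx
  · rw [h0]
    exact hM.virgin.one_le

theorem Regular.zeroModel_regular (hM : M.Regular μ) : M.zeroModel.Regular μ where
  skipFree := ⟨hM.skipFree.1, hM.skipFree.2, hM.skipFree.3, hM.skipFree.4, hM.skipFree.5⟩
  measurable_start := measurable_const
  measurable_env x := by
    by_cases hx : 0 ≤ x 0
    · rw [zeroModel_env hx]
      exact hM.measurable_env x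
    · rw [zeroModel_env_neg hx]
      exact measurable_const
  indep := hM.zeroModel_indep
  start_le := Filter.Eventually.of_forall fun _ => le_rfl
  virgin := hM.zeroModel_virgin

theorem stepLaw_zeroModel : M.zeroModel.stepLaw μ = M.stepLaw μ := rfl

theorem boundTail_zeroModel : M.zeroModel.boundTail μ = M.boundTail μ := by
  ext k
  simp [boundTail, zeroModel]

open Classical in
theorem measure_belowSet_zeroModel [IsProbabilityMeasure μ] (y : List (Site d)) :
    μ (M.zeroModel.belowSet y) = if y.head? = some 0 ∧ ∀ x ∈ y, 0 ≤ x 0 then 1 else 0 := by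
  have : M.zeroModel.belowSet y = {ω | y.head? = some 0 ∧ ∀ x ∈ y, 0 ≤ x 0} := by
    ext ω
    simp only [belowSet, zeroModel, Set.mem_ofPred_eq]
    refine and_congr_right fun _ => ⟨fun h x hx => ?_, fun h x hx => ?_⟩
    · by_contra! hlt
      have := h x hlt
      rw [if_neg (not_le.2 hlt)] at this
      simp only [nonpos_iff_eq_zero, Nat.cast_eq_zero] at this
      exact List.count_eq_zero.1 this hx
    · have : x ∉ y := fun hxy => absurd (h x hxy) (not_le.2 hx)
      simp [List.count_eq_zero_of_not_mem this]
  rw [this]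
  split_ifs with h
  · rw [show {ω : Ω | y.head? = some 0 ∧ ∀ x ∈ y, 0 ≤ x 0} = Set.univ from
      Set.eq_univ_of_forall fun _ => h, measure_univ]
  · rw [show {ω : Ω | y.head? = some 0 ∧ ∀ x ∈ y, 0 ≤ x 0} = ∅ from
      Set.eq_empty_of_forall_notMem fun _ => h, measure_empty]

end ZeroModel

end Model

/-! ### Factorization of weights at a cut. -/

/-- `G` has the properties of the tail `k ↦ P(H ≥ k)` of a bound `H ≥ 1`. -/
structure IsTail (G : ℕ → ℝ≥0∞) : Prop where
  zero : G 0 = 1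
  one : G 1 = 1
  antitone : Antitone G

theorem IsTail.le_one {G : ℕ → ℝ≥0∞} (hG : IsTail G) (k : ℕ) : G k ≤ 1 :=
  hG.zero ▸ hG.antitone (Nat.zero_le k)

section BoundWeight

variable {d : ℕ} {G : ℕ → ℝ≥0∞} {φ ψ : Site d → Prop} {y y' : List (Site d)}

open Classical in
-- Since `G 0 = 1`, unvisited sites may be added to the product; two paths can then be compared over
-- a common index set.
theorem boundWeight_eq_prod (hG : IsTail G) {s : Finset (Site d)}
    (hs : ∀ x, φ x → x ∈ y → x ∈ s) : boundWeight G φ y = ∏ x ∈ s with φ x, G (y.count x) := by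
  rw [boundWeight]
  refine Finset.prod_subset_one_on_sdiff (fun x hx => ?_) (fun x hx => ?_) fun _ _ => rfl
  · rw [Finset.mem_filter, List.mem_toFinset] at hx
    exact Finset.mem_filter.2 ⟨hs x hx.2 hx.1, hx.2⟩
  · rw [Finset.mem_sdiff, Finset.mem_filter, Finset.mem_filter, List.mem_toFinset] at hx
    rw [List.count_eq_zero_of_not_mem fun h => hx.2 ⟨h, hx.1.2⟩, hG.zero]

theorem boundWeight_le_of_count_le (hG : IsTail G)
    (h : ∀ x, φ x → y'.count x ≤ y.count x) : boundWeight G φ y ≤ boundWeight G φ y' := by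
  classical
  rw [boundWeight_eq_prod hG (s := y.toFinset ∪ y'.toFinset) (by simp +contextual),
    boundWeight_eq_prod hG (y := y') (s := y.toFinset ∪ y'.toFinset) (by simp +contextual)]
  exact Finset.prod_le_prod' fun x hx => hG.antitone (h x (Finset.mem_filter.1 hx).2)

theorem boundWeight_congr (hG : IsTail G) (h : ∀ x, φ x → y.count x = y'.count x) :
    boundWeight G φ y = boundWeight G φ y' :=
  le_antisymm (boundWeight_le_of_count_le hG fun x hx => (h x hx).ge)
    (boundWeight_le_of_count_le hG fun x hx => (h x hx).le)

theorem boundWeight_congr_set (h : ∀ x, φ x ↔ ψ x) : boundWeight G φ y = boundWeight G ψ y := by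
  obtain rfl : φ = ψ := funext fun x => propext (h x)
  rfl

theorem boundWeight_and_mul_and_not (ψ : Site d → Prop) :
    boundWeight G (fun x => φ x ∧ ψ x) y * boundWeight G (fun x => φ x ∧ ¬ ψ x) y =
      boundWeight G φ y := by
  classical
  rw [boundWeight, boundWeight, boundWeight]
  convert Finset.prod_filter_mul_prod_filter_not (y.toFinset.filter φ) ψ _ using 2
  all_goals
    refine Finset.prod_congr ?_ fun _ _ => rfl
    ext
    simp [and_assoc]

theorem boundWeight_map_add (c : Site d) :
    boundWeight G φ (y.map (c + ·)) = boundWeight G (fun x => φ (c + x)) y := by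
  classical
  have hinj : Function.Injective (c + ·) := add_right_injective c
  rw [boundWeight, boundWeight]
  symm
  refine Finset.prod_bij (fun x _ => c + x) ?_ (fun _ _ _ _ h => hinj h) ?_ ?_
  · simp
  · intro b hb
    simp only [Finset.mem_filter, List.mem_toFinset, List.mem_map] at hb
    obtain ⟨⟨a, ha, rfl⟩, hφ⟩ := hb
    exact ⟨a, by simp [ha, hφ], rfl⟩
  · intro x _
    rw [List.count_map_of_injective y (c + ·) hinj x]

end BoundWeight

section StepWeight

variable {d : ℕ} (p : Site d → ℝ≥0∞)

theorem stepWeight_map_add (a c : Site d) (x : List (Site d)) :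
    stepWeight p (a + c) (x.map (a + ·)) = stepWeight p c x := by
  induction x generalizing c with
  | nil => rfl
  | cons z x ih =>
    rw [List.map_cons, stepWeight, stepWeight, ih, add_sub_add_left_eq_sub]

theorem stepWeight_append_cons (c : Site d) (l : List (Site d)) (e : Site d) (x : List (Site d)) :
    stepWeight p c (l ++ e :: x) = stepWeight p c (l ++ [e]) * stepWeight p e x := by
  induction l generalizing c with
  | nil => simp [stepWeight]
  | cons z l ih => simp [stepWeight, ih, mul_assoc]

/-- Moving the cut point to the second piece makes that piece a translate of `0 :: x`. -/
theorem cat_concat (l : List (Site d)) (e : Site d) (x : List (Site d)) :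
    cat (l ++ [e]) x = l ++ (0 :: x).map (e + ·) := by
  simp [cat, List.getLastD_eq_getLast?]

theorem pathWeight_cat {y : List (Site d)} (hy : y ≠ []) (x : List (Site d)) :
    pathWeight p (cat y x) = pathWeight p y * stepWeight p 0 x := by
  obtain ⟨l, e, rfl⟩ : ∃ l e, y = l ++ [e] := ⟨_, _, (List.dropLast_append_getLast hy).symm⟩
  have h := stepWeight_map_add p e 0 x
  rw [add_zero] at h
  rw [cat_concat, ← h, List.map_cons, add_zero]
  rcases l with _ | ⟨c, l⟩
  · simp [pathWeight, stepWeight]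
  · simp [pathWeight, stepWeight_append_cons p c l e (x.map _)]

end StepWeight

section Split

variable {d : ℕ} [NeZero d]

theorem FirstPassage.ne_nil {n : ℕ} {y : List (Site d)} (h : FirstPassage n y) : y ≠ [] := by
  obtain ⟨N, hN, -⟩ := h
  exact List.ne_nil_of_length_eq_add_one hN

theorem FirstPassage.exists_concat {n : ℕ} {y : List (Site d)} (h : FirstPassage n y) :
    ∃ l e, y = l ++ [e] ∧ (∀ z ∈ l, z 0 < (n : ℤ)) ∧ (n : ℤ) ≤ e 0 := by
  obtain ⟨N, hN, hy⟩ := h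
  obtain ⟨h1, h2⟩ := hitTime_eq_coe_iff.1 hy
  refine ⟨(List.range N).map (ofList y), ofList y N, ?_, fun z hz => ?_, h1⟩
  · conv_lhs => rw [← pathTo_ofList hN, pathTo, List.range_succ]
    simp
  · obtain ⟨t, ht, rfl⟩ := List.mem_map.1 hz
    exact h2 t (List.mem_range.1 ht)

/-- The weight of a path started at `0` when all bounds at negative heights are infinite. -/
noncomputable def freeWeight (p : Site d → ℝ≥0∞) (G : ℕ → ℝ≥0∞) (x : List (Site d)) : ℝ≥0∞ :=
  stepWeight p 0 x * boundWeight G (fun z => 0 ≤ z 0) (0 :: x)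

/-- Sites are sorted by height. At or above `k` the first piece contributes only its end point,
which is also the start of the translated second piece. Below `k` the second piece can only add
visits, which lowers the weight, and it adds none if it stays above the cut. -/
theorem boundWeight_cat {G : ℕ → ℝ≥0∞} (hG : IsTail G) {k : ℕ} {l x : List (Site d)} {e : Site d}
    (hl : ∀ z ∈ l, z 0 < (k : ℤ)) (he : e 0 = k) :
    boundWeight G (fun z => 0 ≤ z 0) (cat (l ++ [e]) x) ≤
        boundWeight G (fun z => 0 ≤ z 0) (l ++ [e]) *
          boundWeight G (fun z => 0 ≤ z 0) (0 :: x) ∧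
      ((∀ z ∈ x, 0 ≤ z 0) → boundWeight G (fun z => 0 ≤ z 0) (cat (l ++ [e]) x) =
        boundWeight G (fun z => 0 ≤ z 0) (l ++ [e]) *
          boundWeight G (fun z => 0 ≤ z 0) (0 :: x)) := by
  have hlow : boundWeight G (fun z => 0 ≤ z 0 ∧ z 0 < (k : ℤ)) (l ++ [e]) =
      boundWeight G (fun z => 0 ≤ z 0) (l ++ [e]) := by
    rw [← boundWeight_and_mul_and_not (φ := fun z => 0 ≤ z 0) fun z => z 0 < (k : ℤ)]
    have h1 : boundWeight G (fun z => 0 ≤ z 0 ∧ ¬ z 0 < (k : ℤ)) (l ++ [e]) =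
        boundWeight G (fun z => 0 ≤ z 0 ∧ ¬ z 0 < (k : ℤ)) [e] := by
      refine boundWeight_congr hG fun z hz => ?_
      rw [List.count_append, List.count_eq_zero_of_not_mem fun h => hz.2 (hl z h), zero_add]
    -- `G 1 = 1` makes the single visit to the cut point free in the first piece, so that it can be
    -- counted again in the second.
    have h2 : boundWeight G (fun z => 0 ≤ z 0 ∧ ¬ z 0 < (k : ℤ)) [e] = 1 := by
      refine Finset.prod_eq_one fun z hz => ?_
      simp only [Finset.mem_filter, List.mem_toFinset, List.mem_singleton] at hz
      rw [hz.1, List.count_singleton_self, hG.one]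
    rw [h1, h2, mul_one]
  have hhigh : boundWeight G (fun z => 0 ≤ z 0 ∧ ¬ z 0 < (k : ℤ)) (cat (l ++ [e]) x) =
      boundWeight G (fun z => 0 ≤ z 0) (0 :: x) := by
    have h1 : boundWeight G (fun z => 0 ≤ z 0 ∧ ¬ z 0 < (k : ℤ)) (cat (l ++ [e]) x) =
        boundWeight G (fun z => 0 ≤ z 0 ∧ ¬ z 0 < (k : ℤ)) ((0 :: x).map (e + ·)) := by
      refine boundWeight_congr hG fun z hz => ?_
      rw [cat_concat, List.count_append, List.count_eq_zero_of_not_mem fun h => hz.2 (hl z h),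
        zero_add]
    rw [h1, boundWeight_map_add]
    refine boundWeight_congr_set fun z => ?_
    simp only [Pi.add_apply, he]
    omega
  rw [← boundWeight_and_mul_and_not (φ := fun z => 0 ≤ z 0) (y := cat (l ++ [e]) x)
    fun z => z 0 < (k : ℤ), hhigh, ← hlow]
  refine ⟨mul_le_mul_left (boundWeight_le_of_count_le hG fun z _ => ?_) _,
    fun hx => congrArg (· * _) (boundWeight_congr hG fun z hz => ?_)⟩
  · rw [cat, List.count_append (l₁ := l ++ [e])]
    exact Nat.le_add_right _ _
  · rw [cat_concat, List.count_append, List.count_append, List.map_cons, add_zero,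
      List.count_cons (l := x.map _), List.count_eq_zero_of_not_mem (l := x.map _), zero_add,
      List.count_cons, List.count_nil, zero_add]
    rw [List.mem_map]
    rintro ⟨w, hw, rfl⟩
    have := hx w hw
    have := hz.2
    simp only [Pi.add_apply, he] at this
    omega

end Split

namespace Model

variable {d : ℕ} [NeZero d] {Ω : Type*} [MeasurableSpace Ω] {M : Model d Ω} {μ : Measure Ω}

theorem Regular.isTail [IsProbabilityMeasure μ] (hM : M.Regular μ) : IsTail (M.boundTail μ) where
  zero := by simp [boundTail]
  one := by
    rw [boundTail, ← prob_compl_eq_zero_iff]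
    · refine mem_ae_iff.1 (Filter.mem_of_superset hM.virgin.one_le fun ω hω => ?_)
      simpa using hω
    · exact hM.measurable_env 0 (MeasurableSet.of_discrete (s := Set.Ici ((1 : ℕ) : ℕ∞)))
  antitone _ _ h := measure_mono fun _ hω => le_trans (Nat.cast_le.2 h) (Set.mem_ofPred_eq ▸ hω)

open Classical in
theorem weight_zeroModel [IsProbabilityMeasure μ] (y : List (Site d)) :
    M.zeroModel.weight μ y = if y.head? = some 0 ∧ ∀ x ∈ y, 0 ≤ x 0 then
      pathWeight (M.stepLaw μ) y * boundWeight (M.boundTail μ) (fun x => 0 ≤ x 0) y else 0 := by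
  rw [weight, measure_belowSet_zeroModel, stepLaw_zeroModel, boundTail_zeroModel]
  split_ifs <;> simp

theorem weight_zeroModel_zeroModel [IsProbabilityMeasure μ] (y : List (Site d)) :
    M.zeroModel.zeroModel.weight μ y = M.zeroModel.weight μ y := by
  rw [weight_zeroModel, weight_zeroModel, stepLaw_zeroModel, boundTail_zeroModel]

theorem weight_zeroModel_cons [IsProbabilityMeasure μ] {x : List (Site d)}
    (hx : ∀ z ∈ x, 0 ≤ z 0) :
    M.zeroModel.weight μ (0 :: x) = freeWeight (M.stepLaw μ) (M.boundTail μ) x := by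
  rw [weight_zeroModel, if_pos ⟨rfl, by simpa using hx⟩]
  rfl

theorem exists_cons_of_weight_zeroModel_ne_zero [IsProbabilityMeasure μ] {y : List (Site d)}
    (h : M.zeroModel.weight μ y ≠ 0) : ∃ x, y = 0 :: x ∧ ∀ z ∈ x, 0 ≤ z 0 := by
  classical
  rw [weight_zeroModel] at h
  split_ifs at h with hy
  · rcases y with _ | ⟨c, x⟩
    · simp at hy
    · obtain ⟨h1, h2⟩ := hy
      obtain rfl : c = 0 := by simpa using h1
      exact ⟨x, rfl, fun z hz => h2 z (List.mem_cons_of_mem _ hz)⟩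
  · exact absurd rfl h

/-- The second piece may go below the cut here. Its visits there can only violate more bounds, so
ignoring them gives an upper bound. -/
theorem Regular.weight_cat_le [IsProbabilityMeasure μ] (hM : M.Regular μ) {k K : ℕ}
    {y x : List (Site d)} (hk : FirstPassage k y) (hK : y.length = K + 1)
    (hyK : ofList y K 0 = k) :
    M.weight μ (cat y x) ≤ M.weight μ y * freeWeight (M.stepLaw μ) (M.boundTail μ) x := by
  obtain ⟨l, e, rfl, hl, -⟩ := hk.exists_concat
  have he : e 0 = k := by
    rw [← getLastD_eq_ofList hK] at hyK
    simpa [List.getLastD_eq_getLast?] using hyK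
  rw [weight, weight, freeWeight, pathWeight_cat _ hk.ne_nil]
  have hb : M.belowSet (cat (l ++ [e]) x) ⊆ M.belowSet (l ++ [e]) := fun ω hω =>
    ⟨by rw [← hω.1, cat]; cases l <;> rfl, fun z hz => le_trans (by
      rw [cat, List.count_append (l₁ := l ++ [e])]
      exact_mod_cast Nat.le_add_right _ _) (hω.2 z hz)⟩
  calc _ ≤ μ (M.belowSet (l ++ [e])) *
        (pathWeight (M.stepLaw μ) (l ++ [e]) * stepWeight (M.stepLaw μ) 0 x) *
        (boundWeight (M.boundTail μ) (fun z => 0 ≤ z 0) (l ++ [e]) *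
          boundWeight (M.boundTail μ) (fun z => 0 ≤ z 0) (0 :: x)) := by
        gcongr
        exact (boundWeight_cat hM.isTail hl he).1
    _ = _ := by ring

/-- Regeneration: a continuation that stays at or above the cut level meets only fresh bounds there,
apart from the free visit to the cut point. -/
theorem Regular.weight_cat [IsProbabilityMeasure μ] (hM : M.Regular μ) {k K : ℕ}
    {y x : List (Site d)} (hk : FirstPassage k y) (hK : y.length = K + 1)
    (hyK : ofList y K 0 = k) (hx : ∀ z ∈ x, 0 ≤ z 0) :
    M.weight μ (cat y x) = M.weight μ y * M.zeroModel.weight μ (0 :: x) := by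
  obtain ⟨l, e, rfl, hl, -⟩ := hk.exists_concat
  have he : e 0 = k := by
    rw [← getLastD_eq_ofList hK] at hyK
    simpa [List.getLastD_eq_getLast?] using hyK
  rw [weight_zeroModel_cons hx, weight, weight, freeWeight, pathWeight_cat _ hk.ne_nil,
    (boundWeight_cat hM.isTail hl he).2 hx]
  have hb : M.belowSet (cat (l ++ [e]) x) = M.belowSet (l ++ [e]) := by
    ext ω
    refine and_congr (by rw [cat]; cases l <;> rfl) (forall₂_congr fun z hz => ?_)
    rw [cat_concat, List.count_append, List.count_append, List.map_cons, add_zero,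
      List.count_cons (l := x.map _), List.count_eq_zero_of_not_mem (l := x.map _), zero_add,
      List.count_cons, List.count_nil, zero_add]
    rw [List.mem_map]
    rintro ⟨w, hw, rfl⟩
    have := hx w hw
    simp only [Pi.add_apply, he] at hz
    omega
  rw [hb]
  ring

end Model

/-! ### Renewal equations for the probabilities to reach a height. -/

section KappaZero

variable {d : ℕ} [NeZero d]

theorem nonneg_of_kappa_eq_zero {m : ℕ} {x : List (Site d)} (hm : FirstPassage m (0 :: x))
    (h : kappa m (ofList (0 :: x)) = ((0 : ℕ) : WithBot ℕ)) : ∀ z ∈ x, 0 ≤ z 0 := by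
  have hx := hm.hitTime_eq (N := x.length) (by simp)
  obtain ⟨-, hs, -⟩ := kappa_eq_coe_iff.1 h
  obtain ⟨-, K, hK, -, hs⟩ := (isSeparating_iff hx).1 hs
  have h0 : hitTime 0 (ofList (0 :: x)) = ((0 : ℕ) : ℕ∞) :=
    hitTime_eq_coe_iff.2 ⟨by simp [ofList], by simp⟩
  obtain rfl : K = 0 := by exact_mod_cast hK.symm.trans h0
  intro z hz
  obtain ⟨j, hj, rfl⟩ := List.mem_iff_getElem.1 hz
  have hj' : x[j] = ofList (0 :: x) (j + 1) := by simp [ofList, hj]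
  rw [hj']
  -- The separation condition does not cover the final time; there the height is at least `m` by
  -- first passage.
  rcases Nat.lt_or_ge (j + 1) x.length with hlt | hge
  · simpa using hs (j + 1) (by omega) hlt
  · rw [show j + 1 = x.length by omega]
    have := (hitTime_eq_coe_iff.1 hx).1
    omega

theorem isSeparating_zero_of_nonneg {m : ℕ} {x : List (Site d)} (hm : FirstPassage m (0 :: x))
    (h : ∀ z ∈ x, 0 ≤ z 0) : IsSeparating m (ofList (0 :: x)) 0 := by
  have hx := hm.hitTime_eq (N := x.length) (by simp)
  refine (isSeparating_iff hx).2 ⟨Nat.zero_le _, 0, hitTime_eq_coe_iff.2 ⟨by simp [ofList], by simp⟩,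
    by simp [ofList], fun t h1 h2 => ?_⟩
  obtain ⟨j, rfl⟩ := Nat.exists_eq_add_of_lt h1
  have hj : j < x.length := by omega
  have : ofList (0 :: x) (0 + j + 1) = x[j] := by simp [ofList, hj]
  rw [this]
  simpa using h _ (List.getElem_mem hj)

end KappaZero

namespace Model

variable {d : ℕ} [NeZero d] {Ω : Type*} [MeasurableSpace Ω]

/-- The probability to reach height `n` alive. -/
noncomputable def reach (M : Model d Ω) (μ : Measure Ω) (n : ℕ) : ℝ≥0∞ :=
  open Classical in ∑' y, if FirstPassage n y then M.weight μ y else 0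

/-- The probability to reach height `n` alive without a separating level below `n`. -/
noncomputable def firstReach (M : Model d Ω) (μ : Measure Ω) (n : ℕ) : ℝ≥0∞ :=
  open Classical in
  ∑' y, if FirstPassage n y ∧ eta n (ofList y) = 0 then M.weight μ y else 0

open Classical in
/-- The weight of `x`, as a piece of the path between two consecutive separating levels at
distance `l`. -/
noncomputable def blockWeight (M : Model d Ω) (μ : Measure Ω) (l : ℕ) (x : List (Site d)) :
    ℝ≥0∞ :=
  if FirstPassage l (0 :: x) ∧ kappa l (ofList (0 :: x)) = ((0 : ℕ) : WithBot ℕ) then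
    M.zeroModel.weight μ (0 :: x) else 0

/-- The probability that two consecutive separating levels are at distance `l`. -/
noncomputable def gap (M : Model d Ω) (μ : Measure Ω) (l : ℕ) : ℝ≥0∞ :=
  ∑' x, M.blockWeight μ l x

variable {M : Model d Ω} {μ : Measure Ω} [IsProbabilityMeasure μ]

open Classical in
-- Cutting at the largest separating level `k < n` matches paths to `n` with pairs of a path to `k`
-- and a block of height `n - k`. The predicate `Q` is carried along so that one identity serves
-- both the renewal equation and the law of the core.
theorem Regular.tsum_kappa_eq (hM : M.Regular μ) {k n : ℕ} (hkn : k < n)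
    (Q : List (Site d) → Prop) :
    (∑' z, if FirstPassage n z ∧ kappa n (ofList z) = (k : WithBot ℕ) ∧ Q z then
        M.weight μ z else 0) =
      ∑' q : List (Site d) × List (Site d), if FirstPassage k q.1 ∧ Q (cat q.1 q.2) then
        M.weight μ q.1 * M.blockWeight μ (n - k) q.2 else 0 := by
  have key : ∀ (y x : List (Site d)) (K : ℕ), FirstPassage k y → y.length = K + 1 →
      ofList y K 0 = k →
      (if FirstPassage n (cat y x) ∧ kappa n (ofList (cat y x)) = (k : WithBot ℕ) ∧ Q (cat y x)
        then M.weight μ (cat y x) else 0) =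
      if FirstPassage k y ∧ Q (cat y x) then
        M.weight μ y * M.blockWeight μ (n - k) x else 0 := by
    intro y x K hy hK hyK
    obtain ⟨m, rfl⟩ := Nat.exists_eq_add_of_le hkn.le
    rw [Nat.add_sub_cancel_left, blockWeight]
    by_cases hm : FirstPassage m (0 :: x)
    · by_cases hκ : kappa m (ofList (0 :: x)) = ((0 : ℕ) : WithBot ℕ)
      · by_cases hQ : Q (cat y x)
        · rw [if_pos ⟨(firstPassage_cat_iff hK hy hyK m).2 hm, (kappa_cat_iff hK hy hyK hm).2 hκ, hQ⟩,
            if_pos ⟨hy, hQ⟩, if_pos ⟨hm, hκ⟩,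
            hM.weight_cat hy hK hyK (nonneg_of_kappa_eq_zero hm hκ)]
        · simp [hQ]
      · rw [if_neg fun h => hκ ((kappa_cat_iff hK hy hyK hm).1 h.2.1)]
        simp only [hκ, and_false, if_false, mul_zero, ite_self]
    · rw [if_neg fun h => hm ((firstPassage_cat_iff hK hy hyK m).1 h.1)]
      simp [hm]
  have hend : ∀ y x : List (Site d), (if FirstPassage k y ∧ Q (cat y x) then
        M.weight μ y * M.blockWeight μ (n - k) x else 0) ≠ 0 →
      ∃ K, FirstPassage k y ∧ y.length = K + 1 ∧ ofList y K 0 = k := by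
    intro y x h
    split_ifs at h with hy
    · obtain ⟨K, hK, -⟩ := id hy.1
      exact ⟨K, hy.1, hK, hy.1.end_height (hM.skipFreeList (left_ne_zero_of_mul h)) hK⟩
    · exact absurd rfl h
  -- The correspondence needs skip-free paths, which is known only for positive weight; hence the
  -- sums are matched on their supports.
  refine tsum_eq_tsum_of_ne_zero_bij (fun q => cat q.1.1 q.1.2) ?_ ?_ ?_
  · rintro ⟨⟨y, x⟩, h⟩ ⟨⟨y', x'⟩, h'⟩ heq
    obtain ⟨K, hy, -⟩ := hend y x h
    obtain ⟨K', hy', -⟩ := hend y' x' h'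
    obtain ⟨rfl, rfl⟩ := hy.cat_inj hy' heq
    rfl
  · intro z hz
    rw [Function.mem_support] at hz
    have hz' := hz
    split_ifs at hz' with h
    · obtain ⟨y, x, K, rfl, hK, hy, hyK, -⟩ := h.1.exists_cat (hM.skipFreeList hz') hkn.le
      exact ⟨⟨⟨y, x⟩, by rwa [key y x K hy hK hyK] at hz⟩, rfl⟩
    · exact absurd rfl hz'
  · rintro ⟨⟨y, x⟩, h⟩
    obtain ⟨K, hy, hK, hyK⟩ := hend y x h
    exact key y x K hy hK hyK

open Classical in
-- A path of positive weight to height `n` either has no separating level below `n` or has a unique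
-- largest one, at which it is cut.
theorem Regular.reach_eq (hM : M.Regular μ) (n : ℕ) :
    M.reach μ n = M.firstReach μ n + ∑ k ∈ Finset.range n, M.reach μ k * M.gap μ (n - k) := by
  have h1 : ∀ k ∈ Finset.range n, M.reach μ k * M.gap μ (n - k) =
      ∑' z, if FirstPassage n z ∧ kappa n (ofList z) = (k : WithBot ℕ) then
        M.weight μ z else 0 := by
    intro k hk
    have := hM.tsum_kappa_eq (Finset.mem_range.1 hk) fun _ => True
    simp only [and_true] at this
    rw [this, reach, gap, ← ENNReal.tsum_mul_right]
    refine Eq.trans ?_ (ENNReal.tsum_prod (f := fun y x => if FirstPassage k y then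
      M.weight μ y * M.blockWeight μ (n - k) x else 0)).symm
    refine tsum_congr fun y => ?_
    rw [← ENNReal.tsum_mul_left]
    refine tsum_congr fun x => ?_
    split_ifs <;> simp
  rw [Finset.sum_congr rfl h1, ← Summable.tsum_finsetSum fun _ _ => ENNReal.summable, reach,
    firstReach, ← ENNReal.tsum_add]
  refine tsum_congr fun z => ?_
  by_cases hz : FirstPassage n z
  · by_cases hw : M.weight μ z = 0
    · simp [hw]
    · obtain ⟨N, hN, hh⟩ := id hz
      have hs := hM.skipFreeList hw
      rw [SkipFreeList, hN, Nat.add_sub_cancel] at hs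
      simp only [hz, true_and, if_true]
      rcases hk : kappa n (ofList z) with _ | k
      · rw [if_pos ((eta_eq_zero_iff hs hh).2 hk), Finset.sum_eq_zero, add_zero]
        intro k _
        exact if_neg (WithBot.bot_ne_coe)
      · rw [if_neg, zero_add, Finset.sum_eq_single k]
        · rw [if_pos]
          rfl
        · intro j _ hj
          refine if_neg fun h => hj ?_
          exact (WithBot.coe_injective h).symm
        · intro h
          exact absurd (Finset.mem_range.2 (kappa_eq_coe_iff.1 hk).1) h
        · rw [eta_eq_zero_iff hs hh, hk]
          exact WithBot.coe_ne_bot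
  · simp [hz]

theorem gap_zeroModel : M.zeroModel.gap μ = M.gap μ := by
  ext l
  exact tsum_congr fun x => by rw [blockWeight, blockWeight, weight_zeroModel_zeroModel]

theorem Regular.reach_zeroModel_zero (hM : M.Regular μ) : M.zeroModel.reach μ 0 = 1 := by
  classical
  have h1 : M.zeroModel.weight μ [0] = 1 := by
    rw [weight_zeroModel_cons (by simp), freeWeight, stepWeight, one_mul, boundWeight]
    refine Finset.prod_eq_one fun z hz => ?_
    simp only [Finset.mem_filter, List.mem_toFinset, List.mem_singleton] at hz
    rw [hz.1, List.count_singleton_self, hM.isTail.one]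
  rw [reach, tsum_eq_single [0], if_pos, h1]
  · exact ⟨0, rfl, hitTime_eq_coe_iff.2 ⟨by simp [ofList], by simp⟩⟩
  · intro y hy
    split_ifs with h
    · by_contra hw
      obtain ⟨x, rfl, -⟩ := exists_cons_of_weight_zeroModel_ne_zero hw
      have hx := (hitTime_eq_coe_iff.1 (h.hitTime_eq (N := x.length) (by simp))).2
      refine hy ?_
      rcases x with _ | ⟨z, x⟩
      · rfl
      · have := hx 0 (by simp)
        simp [ofList] at this
    · rfl

/-- Under `P_0` a surviving path never goes below its start, so level `0` is separating and the
delay term vanishes. -/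
theorem Regular.reach_zeroModel_eq (hM : M.Regular μ) {n : ℕ} (hn : 1 ≤ n) :
    M.zeroModel.reach μ n =
      ∑ k ∈ Finset.range n, M.zeroModel.reach μ k * M.gap μ (n - k) := by
  classical
  rw [hM.zeroModel_regular.reach_eq n, gap_zeroModel, firstReach, ENNReal.tsum_eq_zero.2, zero_add]
  intro y
  split_ifs with h
  · by_contra hw
    obtain ⟨N, hN, hh⟩ := id h.1
    have hs := hM.zeroModel_regular.skipFreeList hw
    rw [SkipFreeList, hN, Nat.add_sub_cancel] at hs
    obtain ⟨x, rfl, hx⟩ := exists_cons_of_weight_zeroModel_ne_zero hw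
    rw [eta_eq_zero_iff hs hh, kappa_eq_bot_iff] at h
    exact h.2 0 hn (isSeparating_zero_of_nonneg h.1 hx)
  · rfl

end Model

/-- For upper bounds no bijection is needed: it is enough that each nonzero term is dominated by a
term of one of its codes, however many codes there are. -/
theorem tsum_le_tsum_of_exists {α β : Type*} (c : β → α) (F : α → ℝ≥0∞) (f : β → ℝ≥0∞)
    (h : ∀ a, F a ≠ 0 → ∃ b, c b = a ∧ F a ≤ f b) : ∑' a, F a ≤ ∑' b, f b := by
  classical
  calc ∑' a, F a ≤ ∑' a, ∑' b, if c b = a then f b else 0 := by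
        refine ENNReal.tsum_le_tsum fun a => ?_
        by_cases ha : F a = 0
        · simp [ha]
        · obtain ⟨b, hb, hle⟩ := h a ha
          exact hle.trans ((if_pos hb).ge.trans (ENNReal.le_tsum b))
    _ = ∑' b, ∑' a, if c b = a then f b else 0 := ENNReal.tsum_comm
    _ = ∑' b, f b := tsum_congr fun b => by rw [tsum_ite_eq']

/-! ### Submultiplicativity of the reach probabilities up to a constant. -/

section Free

variable {d : ℕ} [NeZero d]

/-- The probability to reach height `m` alive from `0` when all bounds at negative heights are
infinite. -/
noncomputable def freeReach (p : Site d → ℝ≥0∞) (G : ℕ → ℝ≥0∞) (m : ℕ) : ℝ≥0∞ :=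
  open Classical in ∑' x, if FirstPassage m (0 :: x) then freeWeight p G x else 0

/-- The mean number of visits to level `0` made alive by the walk started from `0`, when all
bounds outside level `0` are infinite. -/
noncomputable def levelVisits (p : Site d → ℝ≥0∞) (G : ℕ → ℝ≥0∞) : ℝ≥0∞ :=
  open Classical in
  ∑' x, if ((0 : Site d) :: x).getLastD 0 0 = 0 then
    stepWeight p 0 x * boundWeight G (fun z => z 0 = 0) (0 :: x) else 0

theorem exists_split_last_nonpos {c : Site d} (hc : c 0 ≤ 0) (x : List (Site d)) :
    ∃ l e r, c :: x = l ++ e :: r ∧ e 0 ≤ 0 ∧ ∀ z ∈ r, 0 < z 0 := by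
  induction x using List.reverseRecOn with
  | nil => exact ⟨[], c, [], by simp, hc, by simp⟩
  | append_singleton x z ih =>
    obtain ⟨l, e, r, h, he, hr⟩ := ih
    rcases le_or_gt (z 0) 0 with hz | hz
    · exact ⟨c :: x, z, [], by simp, hz, by simp⟩
    · refine ⟨l, e, r ++ [z], ?_, he, ?_⟩
      · rw [← List.cons_append, h]
        simp
      · simpa [or_imp, forall_and] using ⟨hr, hz⟩

theorem firstPassage_of_append {m : ℕ} {l r : List (Site d)} {e : Site d} (he : e 0 = 0)
    (h : FirstPassage m (l ++ e :: r)) : FirstPassage m (0 :: r.map (· - e)) := by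
  obtain ⟨N, hN, hh⟩ := h
  rw [List.length_append, List.length_cons] at hN
  obtain rfl : N = l.length + r.length := by omega
  have hv : ∀ t ≤ r.length,
      ofList (0 :: r.map (· - e)) t 0 = ofList (l ++ e :: r) (l.length + t) 0 := by
    intro t ht
    rw [ofList, ofList, List.getD_append_right _ _ _ _ (by omega), Nat.add_sub_cancel_left]
    rcases t with _ | t
    · simp [he]
    · rw [List.getD_cons_succ, List.getD_cons_succ, List.getD_eq_getElem _ _ (by simpa using ht),
        List.getD_eq_getElem _ _ (by omega), List.getElem_map, Pi.sub_apply, he, sub_zero]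
  rw [hitTime_eq_coe_iff] at hh
  refine ⟨r.length, by simp, hitTime_eq_coe_iff.2 ⟨?_, fun t ht => ?_⟩⟩
  · rw [hv _ le_rfl]
    exact hh.1
  · rw [hv _ ht.le]
    exact hh.2 _ (by omega)

/-- The bounds at level `0` are charged to the first piece and those above to the second; visits of
the first piece above level `0` are dropped, which can only raise the weight. The second piece meets
level `0` just once, at no cost since `G 1 = 1`. -/
theorem boundWeight_split_last {G : ℕ → ℝ≥0∞} (hG : IsTail G) {l x : List (Site d)} {e : Site d}
    (he : e 0 = 0) (hx : ∀ z ∈ x, 0 < z 0) :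
    boundWeight G (fun z => 0 ≤ z 0) (cat (l ++ [e]) x) ≤
      boundWeight G (fun z => z 0 = 0) (l ++ [e]) * boundWeight G (fun z => 0 ≤ z 0) (0 :: x) := by
  rw [← boundWeight_and_mul_and_not (φ := fun z => 0 ≤ z 0) (y := cat (l ++ [e]) x)
    fun z => z 0 = 0]
  have h0 : boundWeight G (fun z => 0 ≤ z 0 ∧ z 0 = 0) (0 :: x) = 1 := by
    have : boundWeight G (fun z => 0 ≤ z 0 ∧ z 0 = 0) (0 :: x) =
        boundWeight G (fun z => 0 ≤ z 0 ∧ z 0 = 0) [(0 : Site d)] := by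
      refine boundWeight_congr hG fun z hz => ?_
      rw [List.count_cons, List.count_eq_zero_of_not_mem fun h => (hx z h).ne' hz.2,
        List.count_cons, List.count_nil]
    rw [this]
    refine Finset.prod_eq_one fun z hz => ?_
    simp only [Finset.mem_filter, List.mem_toFinset, List.mem_singleton] at hz
    rw [hz.1, List.count_singleton_self, hG.one]
  rw [← boundWeight_and_mul_and_not (φ := fun z => 0 ≤ z 0) (y := 0 :: x) fun z => z 0 = 0, h0,
    one_mul]
  refine mul_le_mul' (le_of_eq ?_) ?_
  · rw [boundWeight_congr_set (φ := fun z : Site d => 0 ≤ z 0 ∧ z 0 = 0) (ψ := fun z => z 0 = 0)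
      fun z => by omega]
    refine boundWeight_congr hG fun z hz => ?_
    rw [cat, List.count_append (l₁ := l ++ [e]), List.count_eq_zero_of_not_mem (l := x.map _),
      add_zero]
    rw [List.mem_map]
    rintro ⟨w, hw, rfl⟩
    have := hx w hw
    simp only [List.getLastD_eq_getLast?, List.getLast?_append, List.getLast?_singleton,
      Option.some_or, Option.getD_some, Pi.add_apply, he] at hz
    omega
  · have h1 : boundWeight G (fun z => 0 ≤ z 0 ∧ ¬ z 0 = 0) (0 :: x) =
        boundWeight G (fun z => 0 ≤ z 0 ∧ ¬ z 0 = 0) ((0 :: x).map (e + ·)) := by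
      rw [boundWeight_map_add]
      exact boundWeight_congr_set fun z => by simp [he]
    rw [h1]
    refine boundWeight_le_of_count_le hG fun z _ => ?_
    rw [cat_concat, List.count_append]
    exact Nat.le_add_left _ _

end Free

namespace Model

variable {d : ℕ} [NeZero d] {Ω : Type*} [MeasurableSpace Ω] {M : Model d Ω} {μ : Measure Ω}
  [IsProbabilityMeasure μ]

theorem Regular.reach_le_one (hM : M.Regular μ) (n : ℕ) : M.reach μ n ≤ 1 := by
  refine le_of_eq_of_le ?_
    (prob_le_one (μ := μ) (s := {ω | hitTime n (M.path ω) < M.death ω ∧ True}))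
  rw [hM.measure_stopped n fun _ => True, reach]
  refine tsum_congr fun y => ?_
  by_cases hy : FirstPassage n y <;> simp [hy]

/-- The path is cut at its first passage of `k`, and the second piece forgets the bounds below that
height. -/
theorem Regular.reach_add_le (hM : M.Regular μ) (k m : ℕ) :
    M.reach μ (k + m) ≤ M.reach μ k * freeReach (M.stepLaw μ) (M.boundTail μ) m := by
  classical
  rw [reach, reach, freeReach, ← ENNReal.tsum_mul_right]
  simp_rw [← ENNReal.tsum_mul_left]
  rw [← ENNReal.tsum_prod (f := fun y x => (if FirstPassage k y then M.weight μ y else 0) *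
    if FirstPassage m (0 :: x) then freeWeight (M.stepLaw μ) (M.boundTail μ) x else 0)]
  refine tsum_le_tsum_of_exists (fun q => cat q.1 q.2) _ _ fun z hz => ?_
  split_ifs at hz with h
  · obtain ⟨y, x, K, rfl, hK, hy, hyK, hx⟩ :=
      h.exists_cat (hM.skipFreeList hz) (Nat.le_add_right k m)
    rw [Nat.add_sub_cancel_left] at hx
    refine ⟨⟨y, x⟩, rfl, ?_⟩
    simp only [if_pos h, if_pos hy, if_pos hx]
    exact hM.weight_cat_le hy hK hyK
  · exact absurd rfl hz

omit [IsProbabilityMeasure μ] in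
theorem Regular.stepLaw_skipFree (hM : M.Regular μ) {s : Site d} (hs : M.stepLaw μ s ≠ 0) :
    s 0 ≤ 1 := by
  by_contra! hlt
  refine hs (measure_mono_null (fun ω hω => ?_) hM.skipFree.le_one)
  simp only [Set.mem_ofPred_eq] at hω
  simp [hω]
  omega

/-- The path is cut at its last visit to level `0`. What precedes is counted by `levelVisits`, which
keeps only the bounds at that level; what follows stays positive and is a path of the model behind
`P_0`. -/
theorem Regular.freeReach_le (hM : M.Regular μ) (m : ℕ) :
    freeReach (M.stepLaw μ) (M.boundTail μ) m ≤
      levelVisits (M.stepLaw μ) (M.boundTail μ) * M.zeroModel.reach μ m := by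
  classical
  have hG := hM.isTail
  have h1 : (∑' x, if FirstPassage m (0 :: x) then M.zeroModel.weight μ (0 :: x) else 0) ≤
      M.zeroModel.reach μ m :=
    ENNReal.tsum_comp_le_tsum_of_injective (List.cons_injective (a := (0 : Site d)))
      fun y => if FirstPassage m y then M.zeroModel.weight μ y else 0
  refine le_trans ?_ (mul_le_mul_right h1 _)
  rw [freeReach, levelVisits, ← ENNReal.tsum_mul_right]
  simp_rw [← ENNReal.tsum_mul_left]
  rw [← ENNReal.tsum_prod (f := fun x' x => (if ((0 : Site d) :: x').getLastD 0 0 = 0 then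
      stepWeight (M.stepLaw μ) 0 x' * boundWeight (M.boundTail μ) (fun z => z 0 = 0) (0 :: x')
      else 0) * if FirstPassage m (0 :: x) then M.zeroModel.weight μ (0 :: x) else 0)]
  refine tsum_le_tsum_of_exists (fun q => (cat (0 :: q.1) q.2).tail) _ _ fun x hx => ?_
  split_ifs at hx with h
  · obtain ⟨l, e, r, hlr, he, hr⟩ := exists_split_last_nonpos (c := (0 : Site d)) le_rfl x
    have hrel : r = (r.map (· - e)).map (e + ·) := by simp [Function.comp_def]
    have hstep : stepWeight (M.stepLaw μ) e r ≠ 0 := by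
      have : pathWeight (M.stepLaw μ) (0 :: x) ≠ 0 := left_ne_zero_of_mul hx
      rcases l with _ | ⟨c, l⟩
      · rw [hlr] at this
        exact this
      · rw [hlr, List.cons_append, pathWeight, stepWeight_append_cons] at this
        exact right_ne_zero_of_mul this
    -- Either the path ends at `e`, whose height is then at least `m ≥ 0`, or the next site is
    -- positive and a single step climbs by at most one.
    have he0 : e 0 = 0 := by
      refine le_antisymm he ?_
      rcases r with _ | ⟨z, r⟩
      · have h' := h
        rw [hlr] at h'
        obtain ⟨l', e', heq, -, hm⟩ := h'.exists_concat
        obtain ⟨rfl, hee⟩ := List.append_inj' heq rfl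
        simp only [List.cons.injEq, and_true] at hee
        subst hee
        omega
      · have h2 := hM.stepLaw_skipFree (left_ne_zero_of_mul hstep)
        have h3 := hr z (by simp)
        simp only [Pi.sub_apply] at h2
        omega
    obtain ⟨x', hx'⟩ : ∃ x', l ++ [e] = 0 :: x' := by
      rcases l with _ | ⟨c, l⟩
      · simp only [List.nil_append, List.cons.injEq] at hlr
        exact ⟨[], by simp [hlr.1]⟩
      · simp only [List.cons_append, List.cons.injEq] at hlr
        exact ⟨l ++ [e], by simp [hlr.1]⟩
    have hcat : 0 :: x = cat (l ++ [e]) (r.map (· - e)) := by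
      rw [cat_concat, List.map_cons, ← hrel, add_zero, hlr]
    have hpos : ∀ z ∈ r.map (· - e), 0 < z 0 := by
      intro z hz
      obtain ⟨w, hw, rfl⟩ := List.mem_map.1 hz
      simpa [he0] using hr w hw
    have hfp : FirstPassage m (0 :: r.map (· - e)) := firstPassage_of_append he0 (hlr ▸ h)
    have hlast : ((0 : Site d) :: x').getLastD 0 0 = 0 := by
      rw [← hx']
      simpa [List.getLastD_eq_getLast?] using he0
    refine ⟨⟨x', r.map (· - e)⟩, ?_, ?_⟩
    · simp only
      rw [← hx', ← hcat, List.tail_cons]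
    · simp only [if_pos h, if_pos hfp, if_pos hlast]
      rw [weight_zeroModel_cons fun z hz => (hpos z hz).le, freeWeight, freeWeight]
      have e1 : stepWeight (M.stepLaw μ) 0 x = stepWeight (M.stepLaw μ) 0 x' *
          stepWeight (M.stepLaw μ) 0 (r.map (· - e)) := by
        have := pathWeight_cat (M.stepLaw μ) (y := 0 :: x') (by simp) (r.map (· - e))
        rwa [← hx', ← hcat, hx'] at this
      have e2 := boundWeight_split_last hG (l := l) he0 hpos
      rw [← hcat, hx'] at e2
      calc _ ≤ stepWeight (M.stepLaw μ) 0 x' * stepWeight (M.stepLaw μ) 0 (r.map (· - e)) *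
            (boundWeight (M.boundTail μ) (fun z => z 0 = 0) (0 :: x') *
              boundWeight (M.boundTail μ) (fun z => 0 ≤ z 0) (0 :: r.map (· - e))) := by
            rw [e1]
            exact mul_le_mul_right e2 _
        _ = _ := by ring
  · exact absurd rfl hx

end Model

/-! ### A non-degenerate walk on a torsion-free group spreads out. -/

section Concentration

variable {V : Type*} [AddCommGroup V]

/-- The mean of `f` after one step, with law `ν`, from the site `c`. -/
noncomputable def avg (ν : V → ℝ≥0∞) (f : V → ℝ≥0∞) (c : V) : ℝ≥0∞ := ∑' s, ν s * f (c + s)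

/-- The mean of `f` after one step from the site `c`, equal to `v` or to `w` with the same
probability. -/
noncomputable def coinAvg (v w : V) (f : V → ℝ≥0∞) (c : V) : ℝ≥0∞ :=
  2⁻¹ * (f (c + v) + f (c + w))

theorem avg_add (ν f g : V → ℝ≥0∞) : avg ν (f + g) = avg ν f + avg ν g := by
  ext c
  simp [avg, mul_add, ENNReal.tsum_add]

theorem avg_one {ν : V → ℝ≥0∞} (hν : ∑' s, ν s = 1) : avg ν 1 = 1 := by
  ext c
  simp [avg, hν]

theorem iterate_avg_add (ν f g : V → ℝ≥0∞) (n : ℕ) :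
    (avg ν)^[n] (f + g) = (avg ν)^[n] f + (avg ν)^[n] g := by
  induction n with
  | zero => rfl
  | succ n ih => rw [Function.iterate_succ_apply', ih, avg_add, Function.iterate_succ_apply',
      Function.iterate_succ_apply']

theorem iterate_avg_zero (ν : V → ℝ≥0∞) (n : ℕ) : (avg ν)^[n] 0 = 0 := by
  induction n with
  | zero => rfl
  | succ n ih =>
    rw [Function.iterate_succ_apply', ih]
    ext c
    simp [avg]

theorem iterate_avg_one {ν : V → ℝ≥0∞} (hν : ∑' s, ν s = 1) (n : ℕ) : (avg ν)^[n] 1 = 1 := by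
  induction n with
  | zero => rfl
  | succ n ih => rw [Function.iterate_succ_apply', ih, avg_one hν]

theorem iterate_avg_translate (ν f : V → ℝ≥0∞) (a : V) (n : ℕ) (c : V) :
    (avg ν)^[n] (fun x => f (a + x)) c = (avg ν)^[n] f (a + c) := by
  induction n generalizing c with
  | zero => rfl
  | succ n ih =>
    rw [Function.iterate_succ_apply', Function.iterate_succ_apply', avg, avg]
    exact tsum_congr fun s => by rw [ih, add_assoc]

theorem commute_avg_coinAvg (ν : V → ℝ≥0∞) (v w : V) :
    Function.Commute (avg ν) (coinAvg v w) := by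
  intro f
  ext c
  simp only [avg, coinAvg]
  rw [← ENNReal.tsum_add, ← ENNReal.tsum_mul_left]
  refine tsum_congr fun s => ?_
  rw [add_right_comm c s v, add_right_comm c s w]
  ring

theorem iterate_coinAvg (v w : V) (f : V → ℝ≥0∞) (N : ℕ) (c : V) :
    (coinAvg v w)^[N] f c = (2 ^ N)⁻¹ *
      ∑ ij ∈ Finset.HasAntidiagonal.antidiagonal N, N.choose ij.1 • f (c + (ij.1 • v + ij.2 • w)) := by
  induction N generalizing f with
  | zero => simp
  | succ N ih =>
    rw [Function.iterate_succ_apply, ih,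
      Finset.sum_antidiagonal_choose_succ_nsmul (fun i j => f (c + (i • v + j • w))) N, pow_succ,
      ENNReal.mul_inv (by simp) (by simp), mul_assoc]
    congr 1
    rw [← Finset.sum_add_distrib, Finset.mul_sum]
    refine Finset.sum_congr rfl fun ij hij => ?_
    rw [Nat.choose_symm_of_eq_add (Finset.HasAntidiagonal.mem_antidiagonal.1 hij).symm, coinAvg,
      show c + (ij.1 • v + ij.2 • w) + v = c + ((ij.1 + 1) • v + ij.2 • w) by
        rw [succ_nsmul]; abel,
      show c + (ij.1 • v + ij.2 • w) + w = c + (ij.1 • v + (ij.2 + 1) • w) by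
        rw [succ_nsmul]; abel]
    simp only [nsmul_eq_mul]
    ring

/-- A Wallis-type estimate: the ratio of consecutive central binomial coefficients reduces the
induction to `(2 n + 1) (2 n + 3) ≤ 4 (n + 1) ^ 2`. -/
theorem centralBinom_sq_le (n : ℕ) : n.centralBinom ^ 2 * (2 * n + 1) ≤ 16 ^ n := by
  induction n with
  | zero => simp
  | succ n ih =>
    have h := Nat.succ_mul_centralBinom_succ n
    have h2 : (n + 1) ^ 2 * ((n + 1).centralBinom ^ 2 * (2 * (n + 1) + 1)) ≤
        (n + 1) ^ 2 * 16 ^ (n + 1) := by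
      calc (n + 1) ^ 2 * ((n + 1).centralBinom ^ 2 * (2 * (n + 1) + 1))
          = ((n + 1) * (n + 1).centralBinom) ^ 2 * (2 * n + 3) := by ring
        _ = (n.centralBinom ^ 2 * (2 * n + 1)) * (4 * (2 * n + 1) * (2 * n + 3)) := by
          rw [h]; ring
        _ ≤ 16 ^ n * (16 * (n + 1) ^ 2) := Nat.mul_le_mul ih (by nlinarith)
        _ = _ := by ring
    exact Nat.le_of_mul_le_mul_left h2 (by positivity)

theorem choose_half_sq_le (N : ℕ) : N.choose (N / 2) ^ 2 * (N + 1) ≤ 4 ^ N := by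
  obtain ⟨n, rfl | rfl⟩ := Nat.even_or_odd' N
  · have := centralBinom_sq_le n
    rw [Nat.centralBinom] at this
    rwa [Nat.mul_div_cancel_left n two_pos, pow_mul]
  · have h := centralBinom_sq_le (n + 1)
    have h1 : (n + 1).centralBinom = 2 * (2 * n + 1).choose n := by
      rw [Nat.centralBinom, show 2 * (n + 1) = (2 * n + 1) + 1 by ring, Nat.choose_succ_succ,
        ← Nat.choose_symm_half n]
      ring
    rw [h1] at h
    rw [show (2 * n + 1) / 2 = n by omega]
    have h4 : 4 ^ (2 * n + 1) * 4 = 16 ^ (n + 1) := by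
      rw [show (16 : ℕ) = 4 ^ 2 by norm_num, ← pow_mul]
      ring
    nlinarith [Nat.zero_le ((2 * n + 1).choose n ^ 2)]

/-- The natural bound `(N + 1) ^ (-1/2)` is relaxed by the inequality of arithmetic and geometric
means to a bound affine in `1 / (N + 1)`. Affine bounds can be averaged over a random number of coin
tosses; `ε` is optimized only at the end. -/
theorem choose_div_two_pow_le {ε : ℝ} (hε : 0 < ε) (N i : ℕ) :
    (N.choose i : ℝ) / 2 ^ N ≤ (ε + 1 / (ε * (N + 1))) / 2 := by
  have h1 : (N.choose i : ℝ) / 2 ^ N ≤ (N.choose (N / 2) : ℝ) / 2 ^ N := by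
    gcongr
    exact Nat.choose_le_middle i N
  refine h1.trans ?_
  have h2 : ((N.choose (N / 2) : ℝ) / 2 ^ N) ^ 2 ≤ 1 / (N + 1) := by
    rw [div_pow, ← pow_mul, mul_comm N 2, pow_mul, div_le_div_iff₀ (by positivity) (by positivity)]
    have := choose_half_sq_le N
    norm_num
    exact_mod_cast this
  set a := (N.choose (N / 2) : ℝ) / 2 ^ N
  have h3 : 1 / (ε * (N + 1)) = (1 / (N + 1 : ℝ)) / ε := by field_simp
  rw [h3, le_div_iff₀ two_pos, ← sub_nonneg]
  have h4 : ε + 1 / (N + 1 : ℝ) / ε - a * 2 = ((ε - a) ^ 2 + (1 / (N + 1) - a ^ 2)) / ε := by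
    field_simp
    ring
  rw [h4]
  exact div_nonneg (add_nonneg (sq_nonneg _) (sub_nonneg.2 h2)) hε.le

variable [IsAddTorsionFree V]

open Classical in
-- By torsion-freeness the end points `i v + (N - i) w` are distinct, so at most one binomial
-- coefficient contributes at `z`.
theorem iterate_coinAvg_le {v w : V} (hvw : v ≠ w) {ε : ℝ} (hε : 0 < ε) (z : V) (N : ℕ) (c : V) :
    (coinAvg v w)^[N] (Pi.single z 1) c ≤ ENNReal.ofReal ((ε + 1 / (ε * (N + 1))) / 2) := by
  rw [iterate_coinAvg]
  have huniq : ∀ ij ∈ Finset.HasAntidiagonal.antidiagonal N, ∀ kl ∈ Finset.HasAntidiagonal.antidiagonal N,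
      c + (ij.1 • v + ij.2 • w) = z → c + (kl.1 • v + kl.2 • w) = z → ij = kl := by
    intro ij hij kl hkl h1 h2
    rw [Finset.HasAntidiagonal.mem_antidiagonal] at hij hkl
    have h3 := add_left_cancel (h1.trans h2.symm)
    have h4 : ((ij.1 : ℤ) - kl.1) • (v - w) = 0 := by
      have e1 : (ij.2 : ℤ) = N - ij.1 := by omega
      have e2 : (kl.2 : ℤ) = N - kl.1 := by omega
      have h5 : (ij.1 : ℤ) • v + (ij.2 : ℤ) • w - ((kl.1 : ℤ) • v + (kl.2 : ℤ) • w) = 0 := by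
        simp only [natCast_zsmul, h3, sub_self]
      rw [e1, e2] at h5
      rw [← h5]
      module
    rcases smul_eq_zero.1 h4 with h | h
    · ext <;> omega
    · exact absurd (sub_eq_zero.1 h) hvw
  by_cases hex : ∃ ij ∈ Finset.HasAntidiagonal.antidiagonal N, c + (ij.1 • v + ij.2 • w) = z
  · obtain ⟨ij, hij, hz⟩ := hex
    rw [Finset.sum_eq_single ij]
    · rw [hz, Pi.single_eq_same, nsmul_eq_mul, mul_one]
      refine le_trans (le_of_eq ?_) (ENNReal.ofReal_le_ofReal (choose_div_two_pow_le hε N ij.1))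
      rw [ENNReal.ofReal_div_of_pos (by positivity), ENNReal.ofReal_natCast,
        ENNReal.ofReal_pow two_pos.le, ENNReal.ofReal_ofNat, div_eq_mul_inv, mul_comm]
    · intro kl hkl hne
      rw [Pi.single_eq_of_ne, smul_zero]
      exact fun h => hne (huniq kl hkl ij hij h hz)
    · exact fun h => absurd hij h
  · push Not at hex
    rw [Finset.sum_eq_zero fun ij hij => by rw [Pi.single_eq_of_ne (hex ij hij), smul_zero]]
    simp

/-- The denominator gains `1` with probability `2 a`. Claiming only the gain `a`, half of the mean,
leaves room for the convexity of `1 / x`, thanks to `x ≥ 1`. -/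
theorem concentration_step {a ε x : ℝ} (ha : 0 < a) (ha1 : 2 * a ≤ 1) (hε : 0 < ε) (hx : 1 ≤ x) :
    2 * a * ((ε + 1 / (ε * (x + 1))) / 2) + (1 - 2 * a) * ((ε + 1 / (ε * x)) / 2) ≤
      (ε + 1 / (ε * (x + a))) / 2 := by
  have key : 2 * a / (x + 1) + (1 - 2 * a) / x ≤ 1 / (x + a) := by
    have hx0 : 0 < x := by linarith
    rw [div_add_div _ _ (by positivity) hx0.ne', div_le_div_iff₀ (by positivity) (by positivity)]
    nlinarith [mul_pos ha hx0, mul_pos ha ha, mul_nonneg ha.le (sub_nonneg.2 hx)]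
  have h1 : 2 * a * ((ε + 1 / (ε * (x + 1))) / 2) + (1 - 2 * a) * ((ε + 1 / (ε * x)) / 2) =
      (ε + (2 * a / (x + 1) + (1 - 2 * a) / x) / ε) / 2 := by
    have : x + 1 ≠ 0 := by linarith
    have : x ≠ 0 := by linarith
    field_simp
    ring
  have h2 : 1 / (ε * (x + a)) = 1 / (x + a) / ε := by
    have : x + a ≠ 0 := by linarith
    field_simp
  rw [h1, h2]
  gcongr

open Classical in
-- The law `ν` is `2 a` times a fair coin on `v` and `w` plus a remainder. Coin steps commute with
-- all others and are collected in `N`, so the spreading of the coins alone controls the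
-- concentration.
theorem iterate_avg_coinAvg_le {ν : V → ℝ≥0∞} (hν : ∑' s, ν s = 1) {v w : V} (hvw : v ≠ w) {a : ℝ}
    (ha : 0 < a) (hv : ENNReal.ofReal a ≤ ν v) (hw : ENNReal.ofReal a ≤ ν w) {ε : ℝ} (hε : 0 < ε)
    (z : V) (T N : ℕ) (c : V) :
    (avg ν)^[T] ((coinAvg v w)^[N] (Pi.single z 1)) c ≤
      ENNReal.ofReal ((ε + 1 / (ε * (N + 1 + a * T))) / 2) := by
  induction T generalizing N c with
  | zero => simpa using iterate_coinAvg_le hvw hε z N c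
  | succ T ih =>
    set κ : V → ℝ≥0∞ := fun s => ENNReal.ofReal a * ((Pi.single v 1 : V → ℝ≥0∞) s + (Pi.single w 1 : V → ℝ≥0∞) s) with hκ
    have hκν : ∀ s, κ s ≤ ν s := by
      intro s
      simp only [hκ]
      by_cases h1 : s = v
      · subst h1
        simpa [Pi.single_eq_of_ne hvw] using hv
      · by_cases h2 : s = w
        · subst h2
          simpa [Pi.single_eq_of_ne h1] using hw
        · simp [Pi.single_eq_of_ne h1, Pi.single_eq_of_ne h2]
    have hsingle : ∀ (u : V) (f : V → ℝ≥0∞), ∑' s, (Pi.single u 1 : V → ℝ≥0∞) s * f s = f u := by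
      intro u f
      rw [tsum_eq_single u fun s hs => by rw [Pi.single_eq_of_ne hs, zero_mul]]
      simp
    have hκsum : ∀ f : V → ℝ≥0∞, ∑' s, κ s * f s = ENNReal.ofReal a * (f v + f w) := by
      intro f
      simp only [hκ, mul_assoc, add_mul]
      rw [ENNReal.tsum_mul_left, ENNReal.tsum_add, hsingle, hsingle]
    have hR : ∀ s, ν s = κ s + (ν s - κ s) := fun s => (add_tsub_cancel_of_le (hκν s)).symm
    have hsumR : ENNReal.ofReal (2 * a) + ∑' s, (ν s - κ s) = 1 := by
      have h1 := hκsum 1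
      simp only [Pi.one_apply, mul_one] at h1
      rw [← hν, tsum_congr hR, ENNReal.tsum_add, h1, one_add_one_eq_two,
        ENNReal.ofReal_mul two_pos.le, ENNReal.ofReal_ofNat, mul_comm]
    have ha1 : 2 * a ≤ 1 := by
      rw [← ENNReal.ofReal_le_one, ← hsumR]
      exact le_self_add
    have hsumR' : ∑' s, (ν s - κ s) = ENNReal.ofReal (1 - 2 * a) := by
      rw [ENNReal.ofReal_sub _ (by positivity), ENNReal.ofReal_one]
      exact ENNReal.eq_sub_of_add_eq ENNReal.ofReal_ne_top (by rw [add_comm, hsumR])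
    set H := (avg ν)^[T] ((coinAvg v w)^[N] (Pi.single z 1)) with hH
    have hcoin : ENNReal.ofReal a * (H (c + v) + H (c + w)) ≤
        ENNReal.ofReal (2 * a) * ENNReal.ofReal ((ε + 1 / (ε * (N + 1 + 1 + a * T))) / 2) := by
      -- A step that uses the coin is commuted past the remaining `T` steps and raises the number of
      -- coins by one.
      have h1 := ih (N + 1) c
      rw [Function.iterate_succ_apply', (commute_avg_coinAvg ν v w).iterate_left T _, ← hH,
        coinAvg] at h1
      rw [ENNReal.ofReal_mul two_pos.le, ENNReal.ofReal_ofNat]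
      push_cast at h1
      calc _ = 2 * ENNReal.ofReal a * (2⁻¹ * (H (c + v) + H (c + w))) := by
            rw [mul_comm (2 : ℝ≥0∞), mul_assoc, ← mul_assoc 2 2⁻¹,
              ENNReal.mul_inv_cancel (by simp) (by simp), one_mul]
        _ ≤ _ := mul_le_mul_right h1 _
    rw [Function.iterate_succ_apply', ← hH, avg]
    calc ∑' s, ν s * H (c + s) = ∑' s, κ s * H (c + s) + ∑' s, (ν s - κ s) * H (c + s) := by
          rw [← ENNReal.tsum_add]
          exact tsum_congr fun s => by rw [← add_mul, ← hR]
      _ ≤ ENNReal.ofReal (2 * a) * ENNReal.ofReal ((ε + 1 / (ε * (N + 1 + 1 + a * T))) / 2) +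
          ENNReal.ofReal (1 - 2 * a) * ENNReal.ofReal ((ε + 1 / (ε * (N + 1 + a * T))) / 2) := by
          refine add_le_add ((hκsum fun s => H (c + s)).trans_le hcoin) ?_
          rw [← hsumR', ← ENNReal.tsum_mul_right]
          exact ENNReal.tsum_le_tsum fun s => mul_le_mul_right (ih N _) _
      _ ≤ _ := by
          have hx : (1 : ℝ) ≤ N + 1 + a * T := by
            nlinarith [N.cast_nonneg (α := ℝ), mul_nonneg ha.le (T.cast_nonneg (α := ℝ))]
          have h := concentration_step ha ha1 hε hx
          rw [← ENNReal.ofReal_mul (by positivity), ← ENNReal.ofReal_mul (by linarith),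
            ← ENNReal.ofReal_add (by positivity)
              (mul_nonneg (by linarith) (by positivity))]
          refine ENNReal.ofReal_le_ofReal (le_trans (le_of_eq ?_) (h.trans (le_of_eq ?_)))
          · rw [add_right_comm ((N : ℝ) + 1) 1]
          · rw [Nat.cast_succ, mul_add a, mul_one, ← add_assoc]

open Classical in
/-- A walk on a torsion-free group with a non-degenerate step law avoids a set of `n` sites with
probability at least `1 / 2` after a time of order `n ^ 2`. -/
theorem exists_iterate_avg_le_half {ν : V → ℝ≥0∞} (hν : ∑' s, ν s = 1) {v w : V} (hvw : v ≠ w)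
    (hv : ν v ≠ 0) (hw : ν w ≠ 0) :
    ∃ A : ℕ, ∀ (D : Finset V) (c : V),
      (avg ν)^[A * D.card ^ 2] (fun x => if x ∈ D then 1 else 0) c ≤ 2⁻¹ := by
  obtain ⟨a, ha, hav, haw⟩ :
      ∃ a : ℝ, 0 < a ∧ ENNReal.ofReal a ≤ ν v ∧ ENNReal.ofReal a ≤ ν w := by
    have hle : ∀ s, ν s ≠ ⊤ := fun s =>
      ((ENNReal.le_tsum s).trans_lt (hν ▸ ENNReal.one_lt_top)).ne
    refine ⟨min (ν v).toReal (ν w).toReal,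
      lt_min (ENNReal.toReal_pos hv (hle v)) (ENNReal.toReal_pos hw (hle w)), ?_, ?_⟩
    · exact ENNReal.ofReal_le_of_le_toReal (min_le_left _ _)
    · exact ENNReal.ofReal_le_of_le_toReal (min_le_right _ _)
  -- With `ε = 1 / (2 n)` and `A n ^ 2` steps, `a * A ≥ 4` bounds the probability of each site by `1
  -- / (2 n)`; the `n` sites of `D` together have at most `1 / 2`.
  obtain ⟨A, hA⟩ := exists_nat_ge (4 / a)
  refine ⟨A, fun D c => ?_⟩
  have hsum : ∀ (T : ℕ) (D : Finset V), (avg ν)^[T] (fun x => if x ∈ D then 1 else 0) c =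
      ∑ z ∈ D, (avg ν)^[T] (Pi.single z 1) c := by
    intro T D
    induction D using Finset.induction_on with
    | empty =>
      have : (fun x : V => if x ∈ (∅ : Finset V) then (1 : ℝ≥0∞) else 0) = 0 := by ext; simp
      rw [this, iterate_avg_zero]
      rfl
    | insert z D hz ih =>
      have : (fun x : V => if x ∈ insert z D then (1 : ℝ≥0∞) else 0) =
          Pi.single z 1 + fun x => if x ∈ D then 1 else 0 := by
        ext x
        by_cases hx : x = z
        · subst hx
          simp [hz]
        · simp [hx]
      rw [this, iterate_avg_add, Finset.sum_insert hz, Pi.add_apply, ih]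
  rw [hsum]
  rcases D.eq_empty_or_nonempty with rfl | hD
  · simp
  have hn : (0 : ℝ) < D.card := by exact_mod_cast hD.card_pos
  set n := D.card
  have hb : ∀ z ∈ D, (avg ν)^[A * n ^ 2] (Pi.single z 1) c ≤ ENNReal.ofReal (1 / (2 * n)) := by
    intro z _
    have hε : (0 : ℝ) < 1 / (2 * n) := by positivity
    have h := iterate_avg_coinAvg_le hν hvw ha hav haw hε z (A * n ^ 2) 0 c
    refine h.trans (ENNReal.ofReal_le_ofReal ?_)
    have hAa : 4 ≤ a * A := by
      rw [div_le_iff₀ ha] at hA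
      linarith
    have h1 : 1 / (1 / (2 * (n : ℝ)) * (((0 : ℕ) : ℝ) + 1 + a * ((A * n ^ 2 : ℕ) : ℝ))) ≤
        1 / (2 * n) := by
      refine one_div_le_one_div_of_le (by positivity) ?_
      push_cast
      rw [zero_add, one_div, inv_mul_eq_div, le_div_iff₀ (by positivity)]
      nlinarith [mul_le_mul_of_nonneg_right hAa (sq_nonneg (n : ℝ))]
    linarith
  refine (Finset.sum_le_sum hb).trans ?_
  rw [Finset.sum_const, nsmul_eq_mul]
  change (n : ℝ≥0∞) * _ ≤ _
  rw [← ENNReal.ofReal_natCast, ← ENNReal.ofReal_mul hn.le]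
  have : (n : ℝ) * (1 / (2 * n)) = 2⁻¹ := by field_simp
  rw [this, ENNReal.ofReal_inv_of_pos two_pos, ENNReal.ofReal_ofNat]

end Concentration

/-! ### A walk that records its visits, weighted by the bounds. -/

section Chain

variable {V : Type*} [AddCommGroup V]

/-- The mean of `F`, a function of the position of a walk and of the multiset of the sites visited
by it, after one step with law `ν`. -/
noncomputable def histAvg (ν : V → ℝ≥0∞) (F : V → Multiset V → ℝ≥0∞) (c : V) (s : Multiset V) :
    ℝ≥0∞ :=
  ∑' x, ν x * F (c + x) ((c + x) ::ₘ s)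

variable {ν : V → ℝ≥0∞}

/-- Records only grow along the walk, so the comparison is needed only for records above the initial
one. -/
theorem iterate_histAvg_le_of_le {F F' : V → Multiset V → ℝ≥0∞} {s : Multiset V} (n : ℕ)
    (h : ∀ c s', s ≤ s' → F c s' ≤ F' c s') (c : V) :
    (histAvg ν)^[n] F c s ≤ (histAvg ν)^[n] F' c s := by
  have : ∀ s', s ≤ s' → ∀ c, (histAvg ν)^[n] F c s' ≤ (histAvg ν)^[n] F' c s' := by
    induction n with
    | zero => exact fun s' hs c => h c s' hs
    | succ n ih =>
      intro s' hs c
      rw [Function.iterate_succ_apply', Function.iterate_succ_apply']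
      exact ENNReal.tsum_le_tsum fun x =>
        mul_le_mul_right (ih _ (hs.trans (Multiset.le_cons_self _ _)) _) _
  exact this s le_rfl c

theorem iterate_histAvg_position (f : V → ℝ≥0∞) (n : ℕ) (c : V) (s : Multiset V) :
    (histAvg ν)^[n] (fun c _ => f c) c s = (avg ν)^[n] f c := by
  induction n generalizing c s with
  | zero => rfl
  | succ n ih =>
    rw [Function.iterate_succ_apply', Function.iterate_succ_apply', histAvg, avg]
    exact tsum_congr fun x => by rw [ih]

theorem iterate_histAvg_add (F F' : V → Multiset V → ℝ≥0∞) (n : ℕ) (c : V) (s : Multiset V) :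
    (histAvg ν)^[n] (fun c s => F c s + F' c s) c s =
      (histAvg ν)^[n] F c s + (histAvg ν)^[n] F' c s := by
  induction n generalizing c s with
  | zero => rfl
  | succ n ih =>
    simp only [Function.iterate_succ_apply', histAvg]
    rw [← ENNReal.tsum_add]
    exact tsum_congr fun x => by rw [ih, mul_add]

theorem iterate_histAvg_mul (a : ℝ≥0∞) (F : V → Multiset V → ℝ≥0∞) (n : ℕ) (c : V)
    (s : Multiset V) :
    (histAvg ν)^[n] (fun c s => a * F c s) c s = a * (histAvg ν)^[n] F c s := by
  induction n generalizing c s with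
  | zero => rfl
  | succ n ih =>
    simp only [Function.iterate_succ_apply', histAvg]
    rw [← ENNReal.tsum_mul_left]
    exact tsum_congr fun x => by rw [ih, mul_left_comm]

theorem iterate_histAvg_const (hν : ∑' s, ν s = 1) (a : ℝ≥0∞) (n : ℕ) (c : V) (s : Multiset V) :
    (histAvg ν)^[n] (fun _ _ => a) c s = a := by
  have h1 := iterate_histAvg_mul (ν := ν) a (fun _ _ => 1) n c s
  have h2 := iterate_histAvg_position (ν := ν) 1 n c s
  rw [iterate_avg_one hν] at h2
  simp only [mul_one] at h1
  rw [h1]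
  simp only [Pi.one_apply] at h2
  rw [h2, mul_one]

theorem iterate_histAvg_sum (F : ℕ → V → Multiset V → ℝ≥0∞) (n t : ℕ) (c : V) (s : Multiset V) :
    (histAvg ν)^[n] (fun c s => ∑ j ∈ Finset.range t, F j c s) c s =
      ∑ j ∈ Finset.range t, (histAvg ν)^[n] (F j) c s := by
  induction t with
  | zero =>
    have := iterate_histAvg_mul (ν := ν) 0 (fun _ _ => 0) n c s
    simpa using this
  | succ t ih =>
    simp only [Finset.sum_range_succ]
    rw [iterate_histAvg_add, ih]

open Classical in
/-- The sites that occur at least `K` times in `s`. -/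
noncomputable def frequent (K : ℕ) (s : Multiset V) : Finset V :=
  s.toFinset.filter fun x => K ≤ s.count x

open Classical in
omit [AddCommGroup V] in
theorem mem_frequent {K : ℕ} (hK : 1 ≤ K) {s : Multiset V} {x : V} :
    x ∈ frequent K s ↔ K ≤ s.count x := by
  rw [frequent, Finset.mem_filter, Multiset.mem_toFinset]
  exact ⟨fun h => h.2, fun h => ⟨Multiset.count_pos.1 (by omega), h⟩⟩

open Classical in
omit [AddCommGroup V] in
theorem frequent_mono {K : ℕ} {s s' : Multiset V} (h : s ≤ s') : frequent K s ⊆ frequent K s' := by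
  intro x hx
  rw [frequent, Finset.mem_filter, Multiset.mem_toFinset] at hx ⊢
  exact ⟨Multiset.mem_of_le h hx.1, hx.2.trans (Multiset.count_le_of_le x h)⟩

open Classical in
-- The walk makes `j` loops of `r` steps from `x`, each with the same return probability and each
-- adding a visit to `x` at its end.
theorem le_iterate_histAvg_return {r : ℕ} (hr : 1 ≤ r) (x : V) (j : ℕ) (s : Multiset V) :
    ((avg ν)^[r] (Pi.single 0 1) 0) ^ j ≤
      (histAvg ν)^[r * j] (fun _ s' => if s.count x + j ≤ s'.count x then 1 else 0) x s := by
  have hx : (avg ν)^[r] (Pi.single 0 1) 0 = (avg ν)^[r] (Pi.single x 1) x := by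
    have h := iterate_avg_translate ν (Pi.single x 1) x r 0
    rw [add_zero] at h
    rw [← h]
    refine congrFun (congrArg _ (funext fun z => ?_)) 0
    simp [Pi.single_apply]
  rw [hx]
  induction j generalizing s with
  | zero => simp
  | succ j ih =>
    set ρ := (avg ν)^[r] (Pi.single x 1) x
    set F : V → Multiset V → ℝ≥0∞ :=
      fun _ s' => if s.count x + (j + 1) ≤ s'.count x then 1 else 0
    have h1 : ∀ s', s.count x + 1 ≤ s'.count x → ρ ^ j ≤ (histAvg ν)^[r * j] F x s' := by
      intro s' hs'
      refine (ih s').trans (iterate_histAvg_le_of_le _ (fun c s'' _ => ?_) x)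
      simp only [F]
      split_ifs
      · exact le_rfl
      · omega
      · exact zero_le
      · exact le_rfl
    -- The last step of the first loop is isolated, since its arrival at `x` is the visit to be
    -- recorded.
    obtain ⟨r', rfl⟩ : ∃ r', r = r' + 1 := ⟨r - 1, by omega⟩
    rw [show (r' + 1) * (j + 1) = (r' + 1) + (r' + 1) * j by ring, Function.iterate_add_apply,
      Function.iterate_succ_apply, pow_succ]
    calc ρ ^ j * ρ = ρ ^ j * (histAvg ν)^[r'] (fun c _ => avg ν (Pi.single x 1) c) x s := by
          rw [iterate_histAvg_position, ← Function.iterate_succ_apply]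
      _ = (histAvg ν)^[r'] (fun c _ => ρ ^ j * avg ν (Pi.single x 1) c) x s := by
          rw [iterate_histAvg_mul]
      _ ≤ _ := by
          refine iterate_histAvg_le_of_le _ (fun c s' hs' => ?_) x
          rw [avg, histAvg, ← ENNReal.tsum_mul_left]
          refine ENNReal.tsum_le_tsum fun z => ?_
          rw [mul_left_comm]
          refine mul_le_mul_right ?_ _
          by_cases hz : c + z = x
          · rw [hz, Pi.single_eq_same, mul_one]
            refine h1 _ ?_
            rw [Multiset.count_cons_self]
            exact Nat.succ_le_succ (Multiset.count_le_of_le x hs')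
          · rw [Pi.single_eq_of_ne hz, mul_zero]
            exact zero_le

open Classical in
-- At time `T` the walk is off the frequent sites with probability at least `1 / 2`; by `K` loops it
-- then turns its current site into a new frequent one.
theorem le_iterate_histAvg_frequent (hν : ∑' s, ν s = 1) {K r T : ℕ} (hK : 1 ≤ K) (hr : 1 ≤ r)
    (s : Multiset V)
    (hT : ∀ c, (avg ν)^[T] (fun x => if x ∈ frequent K s then 1 else 0) c ≤ 2⁻¹) (c : V) :
    2⁻¹ * ((avg ν)^[r] (Pi.single 0 1) 0) ^ K ≤ (histAvg ν)^[T + r * K]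
      (fun _ s' => if (frequent K s).card + 1 ≤ (frequent K s').card then 1 else 0) c s := by
  set ρ := (avg ν)^[r] (Pi.single 0 1) 0
  have h1 : 2⁻¹ ≤ (avg ν)^[T] (fun x => if x ∈ frequent K s then 0 else 1) c := by
    have h2 : (fun x => if x ∈ frequent K s then 1 else 0) +
        (fun x => if x ∈ frequent K s then 0 else 1) = (1 : V → ℝ≥0∞) := by
      ext x
      by_cases hx : x ∈ frequent K s <;> simp [hx]
    have h3 := iterate_avg_add ν (fun x => if x ∈ frequent K s then 1 else 0)
      (fun x => if x ∈ frequent K s then 0 else 1) T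
    rw [h2, iterate_avg_one hν] at h3
    have h4 := congrFun h3 c
    simp only [Pi.one_apply, Pi.add_apply] at h4
    have h5 : (1 : ℝ≥0∞) - 2⁻¹ = 2⁻¹ := ENNReal.one_sub_inv_two
    rw [← h5]
    refine tsub_le_iff_right.2 (h4.le.trans ?_)
    rw [add_comm]
    exact add_le_add_right (hT c) _
  rw [Function.iterate_add_apply, mul_comm]
  calc ρ ^ K * 2⁻¹ ≤ ρ ^ K * (avg ν)^[T] (fun x => if x ∈ frequent K s then 0 else 1) c :=
        mul_le_mul_right h1 _
    _ = (histAvg ν)^[T] (fun x _ => ρ ^ K * if x ∈ frequent K s then 0 else 1) c s := by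
        rw [iterate_histAvg_mul, iterate_histAvg_position]
    _ ≤ _ := by
        refine iterate_histAvg_le_of_le _ (fun x s' hs' => ?_) c
        split_ifs with hx
        · simp
        · rw [mul_one]
          refine (le_iterate_histAvg_return hr x K s').trans
            (iterate_histAvg_le_of_le _ (fun c' s'' hs'' => ?_) x)
          split_ifs with h1 h2
          · exact le_rfl
          · exfalso
            refine h2 ?_
            rw [← Finset.card_insert_of_notMem hx]
            refine Finset.card_le_card (Finset.insert_subset ?_ (frequent_mono (hs'.trans hs'')))
            exact (mem_frequent hK).2 (by omega)
          · exact zero_le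
          · exact le_rfl

theorem tsum_sq_mul_geometric_ne_top {g : ℝ≥0∞} (hg : g < 1) (A B : ℕ) (b : ℝ≥0∞) (hb : b ≠ ⊤) :
    ∑' i : ℕ, b * ((A * i ^ 2 + B : ℕ) : ℝ≥0∞) * g ^ i ≠ ⊤ := by
  simp_rw [mul_assoc]
  rw [ENNReal.tsum_mul_left]
  refine ENNReal.mul_ne_top hb ?_
  have hg' : ‖g.toReal‖ < 1 := by
    rw [Real.norm_of_nonneg ENNReal.toReal_nonneg]
    simpa using ENNReal.toReal_lt_of_lt_ofReal (by simpa using hg)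
  have h2 := summable_pow_mul_geometric_of_norm_lt_one 2 hg'
  have h0 := summable_pow_mul_geometric_of_norm_lt_one 0 hg'
  have h : Summable fun i : ℕ => ((A * i ^ 2 + B : ℕ) : ℝ) * g.toReal ^ i := by
    refine ((h2.mul_left (A : ℝ)).add (h0.mul_left (B : ℝ))).congr fun i => ?_
    push_cast
    ring
  have h3 := h.tsum_ofReal_ne_top
  convert h3 using 3 with i
  rw [ENNReal.ofReal_mul (by positivity), ENNReal.ofReal_natCast,
    ENNReal.ofReal_pow ENNReal.toReal_nonneg, ENNReal.ofReal_toReal (hg.trans ENNReal.one_lt_top).ne]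

open Classical in
-- With `n` frequent sites the weight is at most `g ^ n`, and within a period of `T n` steps their
-- number increases with probability at least `p`. So the mean time spent with `n` such sites is at
-- most `T n / p`. The induction is on the time horizon, one period at a time.
theorem sum_histAvg_le {g p : ℝ≥0∞} (hg : g ≤ 1) (hν : ∑' s, ν s = 1) {K : ℕ}
    {T : ℕ → ℕ} (hT : ∀ n, 1 ≤ T n) (hp0 : p ≠ 0) (hp1 : p ≤ 1)
    (hp : ∀ (s : Multiset V) (c : V), p ≤ (histAvg ν)^[T (frequent K s).card]
      (fun _ s' => if (frequent K s).card + 1 ≤ (frequent K s').card then 1 else 0) c s)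
    (t : ℕ) (c : V) (s : Multiset V) :
    ∑ j ∈ Finset.range t, (histAvg ν)^[j] (fun _ s => g ^ (frequent K s).card) c s ≤
      ∑' i, if (frequent K s).card ≤ i then p⁻¹ * T i * g ^ i else 0 := by
  set R : ℕ → ℝ≥0∞ := fun n => ∑' i, if n ≤ i then p⁻¹ * T i * g ^ i else 0 with hR
  have hRanti : Antitone R := fun n n' hn => ENNReal.tsum_le_tsum fun i => by
    split_ifs
    · exact le_rfl
    · omega
    · exact zero_le
    · exact le_rfl
  have hRsucc : ∀ n, R n = p⁻¹ * T n * g ^ n + R (n + 1) := by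
    intro n
    simp only [hR]
    rw [← tsum_ite_eq n (fun i => p⁻¹ * T i * g ^ i), ← ENNReal.tsum_add]
    refine tsum_congr fun i => ?_
    rcases lt_trichotomy n i with h | rfl | h
    · simp [h.le, Nat.succ_le_of_lt h, h.ne']
    · simp
    · simp [not_le.2 h, h.ne, show ¬ n + 1 ≤ i by omega]
  have hptop : p ≠ ⊤ := (hp1.trans_lt ENNReal.one_lt_top).ne
  induction t using Nat.strong_induction_on generalizing c s with
  | _ t ih =>
    change _ ≤ R _
    set n := (frequent K s).card with hn
    have hterm : ∀ j, (histAvg ν)^[j] (fun _ s => g ^ (frequent K s).card) c s ≤ g ^ n := by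
      intro j
      calc _ ≤ (histAvg ν)^[j] (fun _ _ => g ^ n) c s :=
            iterate_histAvg_le_of_le j (fun c' s' hs' =>
              pow_le_pow_right_of_le_one' hg (Finset.card_le_card (frequent_mono hs'))) c
        _ = g ^ n := iterate_histAvg_const hν _ _ _ _
    have hsum : ∀ t', ∑ j ∈ Finset.range t', (histAvg ν)^[j]
        (fun _ s => g ^ (frequent K s).card) c s ≤ t' * g ^ n := by
      intro t'
      refine (Finset.sum_le_sum fun j _ => hterm j).trans ?_
      rw [Finset.sum_const, Finset.card_range, nsmul_eq_mul]
    -- A period costs `T n * g ^ n`, which is `p` times the leading term of `R n`; a period without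
    -- progress, of probability at most `1 - p`, incurs the leading term again. The coefficients `p`
    -- and `1 - p` add up to one.
    have hcT : p * (p⁻¹ * T n * g ^ n) = T n * g ^ n := by
      rw [mul_assoc, ← mul_assoc p, ENNReal.mul_inv_cancel hp0 hptop, one_mul]
    rcases le_or_gt t (T n) with hle | hlt
    · calc _ ≤ (t : ℝ≥0∞) * g ^ n := hsum t
        _ ≤ T n * g ^ n := by gcongr
        _ = p * (p⁻¹ * T n * g ^ n) := hcT.symm
        _ ≤ p⁻¹ * T n * g ^ n := mul_le_of_le_one_left' hp1
        _ ≤ R n := (hRsucc n).symm ▸ le_self_add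
    · obtain ⟨t', rfl⟩ := Nat.exists_eq_add_of_lt hlt
      rw [add_assoc, Finset.sum_range_add]
      have h1 : ∑ j ∈ Finset.range (t' + 1), (histAvg ν)^[T n + j]
          (fun _ s => g ^ (frequent K s).card) c s ≤ (1 - p) * (p⁻¹ * T n * g ^ n) + R (n + 1) := by
        have h2 : (histAvg ν)^[T n] (fun _ s' => if (frequent K s').card ≤ n then 1 else 0) c s ≤
            1 - p := by
          have h3 := iterate_histAvg_add (ν := ν)
            (fun _ s' => if (frequent K s').card ≤ n then 1 else 0)
            (fun _ s' => if n + 1 ≤ (frequent K s').card then 1 else 0) (T n) c s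
          have h4 : (fun (_ : V) (s' : Multiset V) => (if (frequent K s').card ≤ n then 1 else 0) +
              if n + 1 ≤ (frequent K s').card then 1 else 0) = fun _ _ => (1 : ℝ≥0∞) := by
            ext c' s'
            by_cases h : (frequent K s').card ≤ n
            · simp [h, show ¬ n + 1 ≤ (frequent K s').card by omega]
            · simp [h, show n + 1 ≤ (frequent K s').card by omega]
          rw [h4, iterate_histAvg_const hν] at h3
          refine ENNReal.le_sub_of_add_le_right hptop ?_
          exact (add_le_add_right (hp s c) _).trans h3.ge
        calc _ = (histAvg ν)^[T n] (fun c s => ∑ j ∈ Finset.range (t' + 1), (histAvg ν)^[j]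
              (fun _ s => g ^ (frequent K s).card) c s) c s := by
              rw [iterate_histAvg_sum]
              exact Finset.sum_congr rfl fun j _ => by rw [Function.iterate_add_apply]
          _ ≤ (histAvg ν)^[T n] (fun _ s' => (p⁻¹ * T n * g ^ n) *
              (if (frequent K s').card ≤ n then 1 else 0) + R (n + 1)) c s := by
              refine iterate_histAvg_le_of_le _ (fun c' s' hs' => ?_) c
              refine (ih (t' + 1) (by have := hT n; omega) c' s').trans ?_
              change R _ ≤ _
              have hge : n ≤ (frequent K s').card := Finset.card_le_card (frequent_mono hs')
              split_ifs with h
              · rw [le_antisymm h hge, mul_one, hRsucc n]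
              · rw [mul_zero, zero_add]
                exact hRanti (by omega)
          _ ≤ _ := by
              rw [iterate_histAvg_add, iterate_histAvg_mul, iterate_histAvg_const hν, mul_comm]
              exact add_le_add_left (mul_le_mul_left h2 _) _
      calc _ ≤ T n * g ^ n + ((1 - p) * (p⁻¹ * T n * g ^ n) + R (n + 1)) :=
            add_le_add (hsum _) h1
        _ = R n := by
            rw [← hcT, ← add_assoc, ← add_mul, add_tsub_cancel_of_le hp1, one_mul, ← hRsucc]

/-- The probability that bounds with tail `G` admit the visits recorded in `s`. -/
noncomputable def histWeight (G : ℕ → ℝ≥0∞) (_ : V) (s : Multiset V) : ℝ≥0∞ :=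
  open Classical in ∏ x ∈ s.toFinset, G (s.count x)

omit [AddCommGroup V] in
theorem histWeight_le {G : ℕ → ℝ≥0∞} (hG : IsTail G) (K : ℕ) (c : V) (s : Multiset V) :
    histWeight G c s ≤ G K ^ (frequent K s).card := by
  classical
  rw [histWeight, ← Finset.prod_filter_mul_prod_filter_not s.toFinset fun x => K ≤ s.count x]
  calc _ ≤ (∏ x ∈ s.toFinset with K ≤ s.count x, G K) * 1 := by
        refine mul_le_mul' (Finset.prod_le_prod' fun x hx => hG.antitone (Finset.mem_filter.1 hx).2)
          (Finset.prod_le_one' fun x _ => hG.le_one _)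
    _ = _ := by
        rw [mul_one, Finset.prod_const, frequent]

/-- A recurrent non-degenerate walk makes a finite mean number of steps before it violates one of
the independent bounds, if these are not all infinite. -/
theorem tsum_histAvg_ne_top [IsAddTorsionFree V] {G : ℕ → ℝ≥0∞} (hG : IsTail G)
    (hν : ∑' s, ν s = 1) {K : ℕ} (hK : G K < 1) {v w : V} (hvw : v ≠ w) (hv : ν v ≠ 0)
    (hw : ν w ≠ 0) (hret : ∃ r, 1 ≤ r ∧ (open Classical in
      (avg ν)^[r] (Pi.single 0 1) 0 ≠ 0)) (c : V) (s : Multiset V) :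
    ∑' j, (histAvg ν)^[j] (histWeight G) c s ≠ ⊤ := by
  classical
  have hK1 : 1 ≤ K := by
    by_contra! h
    obtain rfl : K = 0 := by omega
    exact absurd hG.zero hK.ne
  obtain ⟨r, hr, hret⟩ := hret
  obtain ⟨A, hA⟩ := exists_iterate_avg_le_half hν hvw hv hw
  set ρ := (avg ν)^[r] (Pi.single 0 1) 0
  have hρ1 : ρ ≤ 1 := by
    have h := iterate_avg_one hν r
    rw [← Pi.one_apply (M := fun _ : V => ℝ≥0∞) 0, ← h]
    have h2 : (1 : V → ℝ≥0∞) = Pi.single 0 1 + fun x => if x = 0 then 0 else 1 := by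
      ext x
      by_cases hx : x = 0 <;> simp [hx]
    rw [h2, iterate_avg_add]
    exact le_self_add
  have hp0 : 2⁻¹ * ρ ^ K ≠ 0 := mul_ne_zero (by simp) (pow_ne_zero K hret)
  have hp1 : 2⁻¹ * ρ ^ K ≤ 1 := mul_le_one' (by simp) (pow_le_one' hρ1 K)
  -- The period consists of `A n ^ 2` steps to leave the `n` frequent sites and `r K` steps for `K`
  -- loops.
  have hbound := sum_histAvg_le (ν := ν) (g := G K) (p := 2⁻¹ * ρ ^ K) (K := K)
    (T := fun n => A * n ^ 2 + r * K) hK.le hν (fun n => le_add_left (Nat.mul_pos hr hK1)) hp0 hp1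
    (fun s c => le_iterate_histAvg_frequent hν hK1 hr s (hA _) c)
  have hfin : ∑' i : ℕ, (2⁻¹ * ρ ^ K)⁻¹ * ((A * i ^ 2 + r * K : ℕ) : ℝ≥0∞) * G K ^ i ≠ ⊤ :=
    tsum_sq_mul_geometric_ne_top hK A (r * K) _ (ENNReal.inv_ne_top.2 hp0)
  refine ne_top_of_le_ne_top hfin ?_
  refine ENNReal.tsum_le_of_sum_range_le fun t => ?_
  refine le_trans (Finset.sum_le_sum fun j _ => ?_) ((hbound t c s).trans
    (ENNReal.tsum_le_tsum fun i => ?_))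
  · exact iterate_histAvg_le_of_le j (fun c s _ => histWeight_le hG K c s) c
  · split_ifs
    · exact le_rfl
    · exact zero_le

end Chain

/-! ### Visits to level `0` as a walk with step law `returnLaw`. -/

section Excursions

variable {d : ℕ} [NeZero d] {p : Site d → ℝ≥0∞}

/-- The law of the site of the first return to level `0`. -/
noncomputable def returnLaw (p : Site d → ℝ≥0∞) (z : Site d) : ℝ≥0∞ :=
  open Classical in
  ∑' l : List (Site d), if z 0 = 0 ∧ ∀ w ∈ l, w 0 ≠ 0 then stepWeight p 0 (l ++ [z]) else 0

theorem exists_split_first_return {x : List (Site d)} (h : ∃ z ∈ x, z 0 = 0) :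
    ∃ l z x', x = l ++ ((0 : Site d) :: x').map (z + ·) ∧ (∀ w ∈ l, w 0 ≠ 0) ∧ z 0 = 0 := by
  induction x with
  | nil => simp at h
  | cons a x ih =>
    by_cases ha : a 0 = 0
    · exact ⟨[], a, x.map (-a + ·), by simp [Function.comp_def], by simp, ha⟩
    · obtain ⟨z, hz, hz0⟩ := h
      have hzx : z ∈ x := (List.mem_cons.1 hz).resolve_left fun h => ha (h ▸ hz0)
      obtain ⟨l, z', x', rfl, hl, hz'⟩ := ih ⟨z, hzx, hz0⟩
      exact ⟨a :: l, z', x', by simp, by simpa [ha] using hl, hz'⟩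

omit [NeZero d] in
theorem stepWeight_split (l : List (Site d)) (z : Site d) (x' : List (Site d)) :
    stepWeight p 0 (l ++ ((0 : Site d) :: x').map (z + ·)) =
      stepWeight p 0 (l ++ [z]) * stepWeight p 0 x' := by
  have h := stepWeight_map_add p z 0 x'
  rw [List.map_cons, add_zero, stepWeight_append_cons, ← h, add_zero]

omit [NeZero d] in
theorem getLastD_split (l : List (Site d)) (z : Site d) (x' : List (Site d)) :
    ((0 : Site d) :: (l ++ ((0 : Site d) :: x').map (z + ·))).getLastD 0 =
      z + ((0 : Site d) :: x').getLastD 0 := by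
  have hne : ((0 : Site d) :: x').map (z + ·) ≠ [] := by simp
  rw [List.getLastD_eq_getLast?, ← List.cons_append, List.getLast?_append_of_ne_nil _ hne,
    List.getLast?_map, List.getLastD_eq_getLast?, List.getLast?_cons]
  simp

/-- The part of `levelVisits` that comes from the visit number `j`, for a walk started from `c`
after the visits recorded in `s`. -/
noncomputable def visitSum (p : Site d → ℝ≥0∞) (G : ℕ → ℝ≥0∞) (j : ℕ) (c : Site d)
    (s : Multiset (Site d)) : ℝ≥0∞ :=
  ∑' x : List (Site d), if ((0 : Site d) :: x).getLastD 0 0 = 0 ∧ x.countP (· 0 = 0) = j then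
    stepWeight p 0 x * histWeight G c (s + ((x.filter (· 0 = 0)).map (c + ·) : Multiset (Site d)))
    else 0

/-- Cutting at the first return to the level peels off one step with law `returnLaw`. The record `s`
keeps the earlier visits, so the product of tails is evaluated only at the end. -/
theorem visitSum_le (G : ℕ → ℝ≥0∞) (j : ℕ) (c : Site d) (s : Multiset (Site d)) :
    visitSum p G j c s ≤ (histAvg (returnLaw p))^[j] (histWeight G) c s := by
  have hmem : ∀ x : List (Site d), x ≠ [] → ((0 : Site d) :: x).getLastD 0 0 = 0 →
      ∃ z ∈ x, z 0 = 0 := by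
    intro x hx h
    refine ⟨x.getLast hx, List.getLast_mem hx, ?_⟩
    rwa [List.getLastD_eq_getLast?, List.getLast?_cons_of_ne_nil hx,
      List.getLast?_eq_some_getLast hx] at h
  induction j generalizing c s with
  | zero =>
    rw [visitSum, tsum_eq_single []]
    · simp [stepWeight]
    · intro x hx
      refine if_neg fun h => ?_
      obtain ⟨z, hz, hz0⟩ := hmem x hx h.1
      have := List.countP_eq_zero.1 h.2 z hz
      simp [hz0] at this
  | succ j ih =>
    classical
    rw [Function.iterate_succ_apply', histAvg]
    calc visitSum p G (j + 1) c s
        ≤ ∑' q : Site d × List (Site d) × List (Site d),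
          (if q.1 0 = 0 ∧ ∀ w ∈ q.2.1, w 0 ≠ 0 then stepWeight p 0 (q.2.1 ++ [q.1]) else 0) *
          if ((0 : Site d) :: q.2.2).getLastD 0 0 = 0 ∧ q.2.2.countP (· 0 = 0) = j then
            stepWeight p 0 q.2.2 * histWeight G (c + q.1) ((c + q.1) ::ₘ s +
              ((q.2.2.filter (· 0 = 0)).map (c + q.1 + ·) : Multiset (Site d))) else 0 := by
          refine tsum_le_tsum_of_exists
            (fun q => q.2.1 ++ ((0 : Site d) :: q.2.2).map (q.1 + ·)) _ _ fun x hx => ?_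
          split_ifs at hx with h
          · obtain ⟨hlast, hcount⟩ := h
            have hxne : x ≠ [] := by
              rintro rfl
              simp at hcount
            obtain ⟨l, z, x', rfl, hl, hz⟩ := exists_split_first_return (hmem x hxne hlast)
            have hfl : l.filter (fun w => decide (w 0 = 0)) = [] := by
              rw [List.filter_eq_nil_iff]
              simpa using hl
            have hfilter : (l ++ ((0 : Site d) :: x').map (z + ·)).filter
                (fun w => decide (w 0 = 0)) = z :: (x'.filter fun w => decide (w 0 = 0)).map (z + ·)
                := by
              rw [List.filter_append, hfl, List.nil_append, List.map_cons, add_zero,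
                List.filter_cons_of_pos (by simpa using hz), List.filter_map]
              exact congrArg _ (congrArg _ (List.filter_congr fun w _ => by simp [hz]))
            have hcount' : x'.countP (fun w => decide (w 0 = 0)) = j := by
              rw [List.countP_eq_length_filter, hfilter] at hcount
              rw [List.countP_eq_length_filter]
              simpa using hcount
            have hlast' : ((0 : Site d) :: x').getLastD 0 0 = 0 := by
              rw [getLastD_split] at hlast
              simpa [hz] using hlast
            refine ⟨⟨z, l, x'⟩, rfl, le_of_eq ?_⟩
            simp only
            rw [if_pos ⟨hlast, hcount⟩, if_pos ⟨hz, hl⟩, if_pos ⟨hlast', hcount'⟩,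
              stepWeight_split, hfilter, mul_assoc]
            have hs : (s + ((z :: (x'.filter fun w => decide (w 0 = 0)).map (z + ·)).map (c + ·) :
                Multiset (Site d))) = (c + z) ::ₘ s +
                ((x'.filter fun w => decide (w 0 = 0)).map (c + z + ·) : Multiset (Site d)) := by
              rw [List.map_cons, List.map_map, ← Multiset.cons_coe, Multiset.add_cons,
                Multiset.cons_add]
              simp only [Function.comp_def, add_assoc]
            rw [hs]
            rfl
          · exact absurd rfl hx
      _ = ∑' z, ∑' l : List (Site d),
          (if z 0 = 0 ∧ ∀ w ∈ l, w 0 ≠ 0 then stepWeight p 0 (l ++ [z]) else 0) *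
            visitSum p G j (c + z) ((c + z) ::ₘ s) := by
          rw [ENNReal.tsum_prod']
          refine tsum_congr fun z => ?_
          rw [ENNReal.tsum_prod']
          refine tsum_congr fun l => ?_
          simp only [ENNReal.tsum_mul_left, visitSum]
      _ = ∑' z, returnLaw p z * visitSum p G j (c + z) ((c + z) ::ₘ s) :=
          tsum_congr fun z => ENNReal.tsum_mul_right
      _ ≤ _ := ENNReal.tsum_le_tsum fun z => mul_le_mul_right (ih _ _) _

/-- The starting point counts as a visit, whence the initial record `{0}`. -/
theorem boundWeight_level_eq_histWeight (G : ℕ → ℝ≥0∞) (x : List (Site d)) :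
    boundWeight G (fun z => z 0 = 0) (0 :: x) =
      histWeight G 0 ({0} + ((x.filter (· 0 = 0)).map (0 + ·) : Multiset (Site d))) := by
  classical
  have h : ({0} + ((x.filter (· 0 = 0)).map (0 + ·) : Multiset (Site d)) : Multiset (Site d)) =
      (((0 : Site d) :: x).filter (· 0 = 0) : List (Site d)) := by
    simp
  rw [boundWeight, histWeight, h]
  refine Finset.prod_congr ?_ fun z hz => ?_
  · ext a
    by_cases ha : a = 0
    · subst ha
      simp
    · simp [ha, and_comm]
  rw [@Multiset.mem_toFinset _ (Classical.decEq _), Multiset.mem_coe, List.mem_filter] at hz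
  have hz' := List.count_filter (l := (0 : Site d) :: x) (p := fun w => decide (w 0 = 0)) (a := z)
    hz.2
  refine congrArg G (hz'.symm.trans ?_)
  convert (Multiset.coe_count z (((0 : Site d) :: x).filter fun w => decide (w 0 = 0))).symm

theorem levelVisits_le (G : ℕ → ℝ≥0∞) :
    levelVisits p G ≤ ∑' j, (histAvg (returnLaw p))^[j] (histWeight G) 0 {0} := by
  classical
  calc levelVisits p G = ∑' j, visitSum p G j 0 {0} := by
        simp only [visitSum]
        rw [ENNReal.tsum_comm, levelVisits]
        refine tsum_congr fun x => ?_
        rw [tsum_eq_single (x.countP (· 0 = 0))]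
        · rw [boundWeight_level_eq_histWeight]
          simp
        · intro j hj
          exact if_neg fun h => hj h.2.symm
    _ ≤ _ := ENNReal.tsum_le_tsum fun j => visitSum_le G j 0 {0}

/-- A path of positive probability that ends on the level is a chain of excursions of positive
probability; the induction removes the first one. Applied to a loop, it gives a loop of the walk of
returns. -/
theorem exists_iterate_avg_returnLaw_ne_zero {x : List (Site d)} (hx : x ≠ [])
    (hlast : ((0 : Site d) :: x).getLastD 0 0 = 0) (hw : stepWeight p 0 x ≠ 0) :
    ∃ j, 1 ≤ j ∧ (open Classical in (avg (returnLaw p))^[j]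
      (Pi.single (((0 : Site d) :: x).getLastD 0) 1) 0 ≠ 0) := by
  classical
  induction hn : x.length using Nat.strong_induction_on generalizing x with
  | _ n ih =>
    have hmem : ∃ z ∈ x, z 0 = 0 := by
      refine ⟨x.getLast hx, List.getLast_mem hx, ?_⟩
      rwa [List.getLastD_eq_getLast?, List.getLast?_cons_of_ne_nil hx,
        List.getLast?_eq_some_getLast hx] at hlast
    obtain ⟨l, z, x', rfl, hl, hz⟩ := exists_split_first_return hmem
    rw [stepWeight_split] at hw
    rw [getLastD_split] at hlast ⊢
    have hz' : returnLaw p z ≠ 0 := by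
      refine ne_of_gt (lt_of_lt_of_le (pos_iff_ne_zero.2 (left_ne_zero_of_mul hw)) ?_)
      refine le_trans ?_ (ENNReal.le_tsum l)
      rw [if_pos ⟨hz, hl⟩]
    have hstep : ∀ (f : Site d → ℝ≥0∞) (j : ℕ), (avg (returnLaw p))^[j] f z ≠ 0 →
        (avg (returnLaw p))^[j + 1] f 0 ≠ 0 := by
      intro f j h
      rw [Function.iterate_succ_apply']
      refine ne_of_gt (lt_of_lt_of_le (pos_iff_ne_zero.2 (mul_ne_zero hz' h)) ?_)
      have := ENNReal.le_tsum (f := fun s => returnLaw p s * (avg (returnLaw p))^[j] f (0 + s)) z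
      rwa [zero_add] at this
    rcases eq_or_ne x' [] with rfl | hx'
    · refine ⟨1, le_rfl, hstep _ 0 ?_⟩
      simp
    · obtain ⟨j, hj, hne⟩ := ih x'.length (by simp at hn; omega) hx'
        (by simpa [hz] using hlast) (right_ne_zero_of_mul hw) rfl
      refine ⟨j + 1, by omega, hstep _ j ?_⟩
      have h := iterate_avg_translate (returnLaw p)
        (Pi.single (z + ((0 : Site d) :: x').getLastD 0) 1) z j 0
      rw [add_zero] at h
      rw [← h]
      have e : (fun x => (Pi.single (z + ((0 : Site d) :: x').getLastD 0) 1 : Site d → ℝ≥0∞)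
          (z + x)) = Pi.single (((0 : Site d) :: x').getLastD 0) 1 := by
        ext w
        simp [Pi.single_apply]
      rw [e]
      exact hne

end Excursions

/-! ### Transient and degenerate return laws. -/

section Degenerate

variable {V : Type*} [AddCommGroup V] {ν : V → ℝ≥0∞} {G : ℕ → ℝ≥0∞}

/-- Tails are at most one, so each further return costs at least the missing mass and a geometric
series dominates. -/
theorem tsum_histAvg_ne_top_of_transient (hG : IsTail G) (hν : ∑' s, ν s < 1) (c : V)
    (s : Multiset V) : ∑' j, (histAvg ν)^[j] (histWeight G) c s ≠ ⊤ := by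
  classical
  have h : ∀ j c s, (histAvg ν)^[j] (histWeight G) c s ≤ (∑' s, ν s) ^ j := by
    intro j
    induction j with
    | zero =>
      intro c s
      rw [pow_zero]
      exact Finset.prod_le_one' fun x _ => hG.le_one _
    | succ j ih =>
      intro c s
      rw [Function.iterate_succ_apply', histAvg, pow_succ', ← ENNReal.tsum_mul_right]
      exact ENNReal.tsum_le_tsum fun x => mul_le_mul_right (ih _ _) _
  refine ne_top_of_le_ne_top ?_ (ENNReal.tsum_le_tsum fun j => h j c s)
  rw [ENNReal.tsum_geometric]
  exact ENNReal.inv_ne_top.2 (tsub_pos_of_lt hν).ne'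

theorem iterate_histAvg_of_constant (hν0 : ν 0 = 1) (hν : ∀ z ≠ 0, ν z = 0) (j i : ℕ) :
    (histAvg ν)^[j] (histWeight G) 0 (Multiset.replicate (i + 1) 0) = G (i + 1 + j) := by
  classical
  induction j generalizing i with
  | zero => rw [Function.iterate_zero, id, histWeight, Multiset.toFinset_replicate,
      if_neg (Nat.succ_ne_zero i), Finset.prod_singleton, Multiset.count_replicate_self, add_zero]
  | succ j ih =>
    rw [Function.iterate_succ_apply', histAvg, tsum_eq_single 0 fun z hz => by rw [hν z hz, zero_mul],
      hν0, one_mul, add_zero, ← Multiset.replicate_succ, ih]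
    congr 1
    ring

/-- If `ν` were carried by a single `w ≠ 0`, the walk would be at `r w ≠ 0` after `r` steps and
could not return. -/
theorem exists_ne_of_return [IsAddTorsionFree V] (hν : ∑' s, ν s = 1) (hν0 : ν 0 ≠ 1)
    (hret : ∃ r, 1 ≤ r ∧ (open Classical in (avg ν)^[r] (Pi.single 0 1) 0 ≠ 0)) :
    ∃ v w, v ≠ w ∧ ν v ≠ 0 ∧ ν w ≠ 0 := by
  classical
  obtain ⟨w, hw0, hw⟩ : ∃ w, w ≠ 0 ∧ ν w ≠ 0 := by
    by_contra! h
    rw [tsum_eq_single 0 h] at hν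
    exact hν0 hν
  by_cases hv : ∃ v, v ≠ w ∧ ν v ≠ 0
  · obtain ⟨v, hvw, hv⟩ := hv
    exact ⟨v, w, hvw, hv, hw⟩
  · exfalso
    push Not at hv
    obtain ⟨r, hr, hne⟩ := hret
    have h : ∀ (r : ℕ) (f : V → ℝ≥0∞) (c : V), (avg ν)^[r] f c = ν w ^ r * f (c + r • w) := by
      intro r
      induction r with
      | zero => simp
      | succ r ih =>
        intro f c
        rw [Function.iterate_succ_apply', avg, tsum_eq_single w fun z hz => by rw [hv z hz, zero_mul],
          ih, pow_succ', mul_assoc, succ_nsmul', add_assoc]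
    rw [h, zero_add, Pi.single_apply] at hne
    split_ifs at hne with h0
    · rcases smul_eq_zero.1 h0 with h1 | h1
      · omega
      · exact hw0 h1
    · simp at hne

end Degenerate

/-! ### Finiteness of the mean number of visits to a level. -/

namespace Model

variable {d : ℕ} [NeZero d] {Ω : Type*} [MeasurableSpace Ω] {M : Model d Ω} {μ : Measure Ω}

omit [NeZero d] [MeasurableSpace Ω] in
theorem freePath_prefix_eq (M : Model d Ω) (x : List (Site d)) :
    {ω | pathTo (M.freePath ω) x.length = 0 :: x} =
      ⋂ j ∈ Finset.range x.length,
        M.inc j ⁻¹' {ofList (0 :: x) (j + 1) - ofList (0 :: x) j} := by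
  ext ω
  simp only [Set.mem_ofPred_eq, pathTo_eq_iff (y := 0 :: x) (N := x.length) (by simp), freePath,
    walk_eq_iff, Set.mem_iInter, Finset.mem_range, Set.mem_preimage, Set.mem_singleton_iff]
  exact and_iff_right (by simp [ofList])

theorem Regular.measure_freePath_prefix (hM : M.Regular μ) (x : List (Site d)) :
    μ {ω | pathTo (M.freePath ω) x.length = 0 :: x} = stepWeight (M.stepLaw μ) 0 x := by
  rw [freePath_prefix_eq, hM.stepWeight_inc (fun j => ofList (0 :: x) (j + 1) - ofList (0 :: x) j),
    stepWeight_eq_prod]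

theorem Regular.measurableSet_freePath_prefix (hM : M.Regular μ) (x : List (Site d)) :
    MeasurableSet {ω | pathTo (M.freePath ω) x.length = 0 :: x} := by
  rw [freePath_prefix_eq]
  exact Finset.measurableSet_biInter _ fun j _ =>
    hM.skipFree.measurable_inc j (MeasurableSet.singleton _)

theorem returnTimeLevel_eq_iff {Y : ℕ → Site d} {t : ℕ} :
    returnTimeLevel Y = t ↔ (0 < t ∧ Y t 0 = 0) ∧ ∀ s < t, ¬ (0 < s ∧ Y s 0 = 0) :=
  firstTime_eq_coe_iff

theorem returnTimeLevel_eq_of_prefix {Y : ℕ → Site d} {l : List (Site d)} {z : Site d}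
    (hz : z 0 = 0) (hl : ∀ w ∈ l, w 0 ≠ 0)
    (h : pathTo Y (l ++ [z]).length = 0 :: (l ++ [z])) :
    returnTimeLevel Y = ((l.length + 1 : ℕ) : ℕ∞) ∧ Y (l.length + 1) = z := by
  rw [pathTo_eq_iff (by simp)] at h
  have hend : Y (l.length + 1) = z := by
    rw [h _ (by simp)]
    simp [ofList]
  refine ⟨returnTimeLevel_eq_iff.2 ⟨⟨by omega, hend ▸ hz⟩, fun s hs hs0 => ?_⟩, hend⟩
  obtain ⟨i, rfl⟩ : ∃ i, s = i + 1 := ⟨s - 1, by omega⟩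
  have hi : i < l.length := by omega
  refine hl l[i] (List.getElem_mem hi) ?_
  have hYi : Y (i + 1) = l[i] := by
    rw [h _ (by simp; omega), ofList, List.getD_cons_succ, List.getD_append _ _ _ _ hi,
      List.getD_eq_getElem _ _ hi]
  rw [← hYi]
  exact hs0.2

open Classical in
-- The first excursion determines the prefix of the walk up to its first return, so the prefix
-- events are disjoint. It is needed for the total mass of `returnLaw` and for its mass at the
-- origin.
theorem Regular.tsum_returnLaw (hM : M.Regular μ) (Q : Site d → Prop) :
    (∑' z, if Q z then returnLaw (M.stepLaw μ) z else 0) =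
      μ {ω | ∃ t : ℕ, returnTimeLevel (M.freePath ω) = t ∧ Q (M.freePath ω t)} := by
  have hset : {ω | ∃ t : ℕ, returnTimeLevel (M.freePath ω) = t ∧ Q (M.freePath ω t)} =
      ⋃ q : Site d × List (Site d), if Q q.1 ∧ q.1 0 = 0 ∧ ∀ w ∈ q.2, w 0 ≠ 0 then
        {ω | pathTo (M.freePath ω) (q.2 ++ [q.1]).length = 0 :: (q.2 ++ [q.1])} else ∅ := by
    ext ω
    simp only [Set.mem_ofPred_eq, Set.mem_iUnion, Prod.exists]
    constructor
    · rintro ⟨t, ht, hQ⟩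
      obtain ⟨⟨h0, hY⟩, hs⟩ := returnTimeLevel_eq_iff.1 ht
      obtain ⟨N, rfl⟩ : ∃ N, t = N + 1 := ⟨t - 1, by omega⟩
      refine ⟨M.freePath ω (N + 1), (List.range N).map fun j => M.freePath ω (j + 1), ?_⟩
      rw [if_pos]
      · simp only [Set.mem_ofPred_eq, List.length_append, List.length_map, List.length_range,
          List.length_singleton, pathTo]
        rw [List.range_succ_eq_map, List.map_cons, List.range_succ]
        simp [freePath, walk, Function.comp_def]
      · refine ⟨hQ, hY, fun w hw => ?_⟩
        obtain ⟨j, hj, rfl⟩ := List.mem_map.1 hw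
        rw [List.mem_range] at hj
        exact fun h => hs (j + 1) (by omega) ⟨by omega, h⟩
    · rintro ⟨z, l, h⟩
      split_ifs at h with hc
      · obtain ⟨h1, h2⟩ := returnTimeLevel_eq_of_prefix hc.2.1 hc.2.2 h
        exact ⟨_, h1, h2.symm ▸ hc.1⟩
      · exact h.elim
  rw [hset, measure_iUnion, ENNReal.tsum_prod']
  · refine tsum_congr fun z => ?_
    by_cases hQ : Q z
    · rw [if_pos hQ, returnLaw]
      refine tsum_congr fun l => ?_
      simp only [hQ, true_and]
      split_ifs
      · rw [hM.measure_freePath_prefix]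
      · rw [measure_empty]
    · simp [hQ]
  · rintro ⟨z, l⟩ ⟨z', l'⟩ hne
    simp only [Function.onFun]
    split_ifs with h h'
    · refine Set.disjoint_left.2 fun ω hω hω' => hne ?_
      obtain ⟨h1, h2⟩ := returnTimeLevel_eq_of_prefix h.2.1 h.2.2 hω
      obtain ⟨h1', h2'⟩ := returnTimeLevel_eq_of_prefix h'.2.1 h'.2.2 hω'
      have hlen : l.length + 1 = l'.length + 1 := by exact_mod_cast h1.symm.trans h1'
      simp only [Set.mem_ofPred_eq, List.length_append, List.length_singleton] at hω hω'
      rw [hlen, hω'] at hω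
      obtain ⟨h3, h4⟩ := List.append_inj' (List.cons.inj hω).2 rfl
      rw [h3, (List.cons.inj h4).1]
    all_goals simp
  · rintro ⟨z, l⟩
    split_ifs
    · exact hM.measurableSet_freePath_prefix _
    · exact MeasurableSet.empty

theorem Regular.exists_return (hM : M.Regular μ)
    (h : 0 < μ {ω | returnTimeOrigin (M.freePath ω) < ⊤}) :
    ∃ r, 1 ≤ r ∧ (open Classical in
      (avg (returnLaw (M.stepLaw μ)))^[r] (Pi.single 0 1) 0 ≠ 0) := by
  have hset : {ω | returnTimeOrigin (M.freePath ω) < ⊤} ⊆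
      ⋃ q : {x : List (Site d) // x ≠ [] ∧ ((0 : Site d) :: x).getLastD 0 = 0},
        {ω | pathTo (M.freePath ω) q.1.length = 0 :: q.1} := by
    intro ω hω
    obtain ⟨t, ht, h0⟩ := firstTime_lt_top_iff.1 hω
    have h1 : pathTo (M.freePath ω) t = 0 :: (pathTo (M.freePath ω) t).tail := by
      rw [pathTo, List.range_succ_eq_map, List.map_cons, List.tail_cons]
      simp [freePath, walk]
    refine Set.mem_iUnion.2 ⟨⟨(pathTo (M.freePath ω) t).tail, ?_, ?_⟩, ?_⟩
    · intro h2
      have := congrArg List.length h2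
      simp at this
      omega
    · rw [← h1, getLastD_pathTo, h0]
    · simp only [Set.mem_ofPred_eq, List.length_tail, length_pathTo, Nat.add_sub_cancel]
      exact h1
  obtain ⟨⟨x, hx, hlast⟩, hpos⟩ : ∃ q : {x : List (Site d) // x ≠ [] ∧
      ((0 : Site d) :: x).getLastD 0 = 0}, μ {ω | pathTo (M.freePath ω) q.1.length = 0 :: q.1} ≠ 0 := by
    by_contra! hall
    exact h.ne' (measure_mono_null hset (measure_iUnion_null hall))
  rw [hM.measure_freePath_prefix] at hpos
  have := exists_iterate_avg_returnLaw_ne_zero hx (by rw [hlast]; rfl) hpos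
  rwa [hlast] at this

theorem toENNReal_eq_tsum (h : ℕ∞) :
    (h : ℝ≥0∞) = ∑' j : ℕ, (open Classical in if ((j + 1 : ℕ) : ℕ∞) ≤ h then 1 else 0) := by
  classical
  rcases eq_or_ne h ⊤ with rfl | hne
  · simp
  · lift h to ℕ using hne
    rw [tsum_eq_sum (s := Finset.range h)]
    · rw [Finset.sum_congr rfl fun j hj => if_pos (by
        have := Finset.mem_range.1 hj
        exact_mod_cast this)]
      simp
    · intro j hj
      refine if_neg fun hle => hj (Finset.mem_range.2 ?_)
      exact_mod_cast hle

theorem Regular.lintegral_env (hM : M.Regular μ) :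
    ∫⁻ ω, (M.env 0 ω : ℝ≥0∞) ∂μ = ∑' j : ℕ, M.boundTail μ (j + 1) := by
  classical
  have hmeas : ∀ j : ℕ, MeasurableSet {ω | ((j + 1 : ℕ) : ℕ∞) ≤ M.env 0 ω} := fun j =>
    hM.measurable_env 0 (MeasurableSet.of_discrete (s := Set.Ici ((j + 1 : ℕ) : ℕ∞)))
  simp_rw [toENNReal_eq_tsum]
  have h1 : ∀ j : ℕ, (fun ω => if ((j + 1 : ℕ) : ℕ∞) ≤ M.env 0 ω then (1 : ℝ≥0∞) else 0) =
      Set.indicator {ω | ((j + 1 : ℕ) : ℕ∞) ≤ M.env 0 ω} 1 := by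
    intro j
    ext ω
    simp [Set.indicator_apply]
  rw [lintegral_tsum]
  · refine tsum_congr fun j => ?_
    rw [h1, lintegral_indicator_one (hmeas j), boundTail]
  · intro j
    rw [h1]
    exact (measurable_one.indicator (hmeas j)).aemeasurable

/-- The mean number of visits to level `0` is finite. -/
theorem Regular.levelVisits_ne_top [IsProbabilityMeasure μ] (hM : M.Regular μ)
    (hR : M.Returns μ) : levelVisits (M.stepLaw μ) (M.boundTail μ) ≠ ⊤ := by
  classical
  refine ne_top_of_le_ne_top ?_ (levelVisits_le _)
  have hG := hM.isTail
  set ν := returnLaw (M.stepLaw μ) with hν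
  have hsum : ∑' z, ν z = μ {ω | returnTimeLevel (M.freePath ω) < ⊤} := by
    have h := hM.tsum_returnLaw fun _ => True
    simp only [if_true, and_true] at h
    rw [h]
    congr 1
    ext ω
    constructor
    · rintro ⟨t, ht⟩
      simp [ht]
    · exact fun h => ⟨_, (ENat.natCast_toNat (show returnTimeLevel (M.freePath ω) < ⊤ from h).ne).symm⟩
  have hzero : ν 0 = μ {ω | returnTimeLevel (M.freePath ω) = returnTimeOrigin (M.freePath ω) ∧
      returnTimeOrigin (M.freePath ω) < ⊤} := by
    have h := hM.tsum_returnLaw fun z => z = 0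
    have h' : ν 0 = _ := ((tsum_eq_single 0 fun z hz => if_neg hz).trans (if_pos rfl)).symm.trans h
    rw [h']
    congr 1
    ext ω
    simp only [Set.mem_ofPred_eq]
    constructor
    · rintro ⟨t, ht, h0⟩
      obtain ⟨h1, h2⟩ := returnTimeLevel_eq_iff.1 ht
      have h3 : returnTimeOrigin (M.freePath ω) = t := firstTime_eq_of ⟨h1.1, h0⟩
        fun s hs hs0 => h2 s hs ⟨hs0.1, by rw [hs0.2]; rfl⟩
      rw [ht, h3]
      simp
    · rintro ⟨h1, h2⟩
      refine ⟨(returnTimeOrigin (M.freePath ω)).toNat, ?_, ?_⟩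
      · rw [h1, ENat.natCast_toNat h2.ne]
      · exact (firstTime_eq_coe_iff.1 (ENat.natCast_toNat h2.ne).symm).1.2
  -- Without a certain return to level `0` the sum is geometric; the assumptions on returns are
  -- needed only in the other case.
  by_cases h1 : ∑' z, ν z = 1
  · have hlev := hsum.symm.trans h1
    -- If every return to the level is a return to the origin, a single bound is tested and the sum
    -- is its mean. Otherwise the walk of returns is non-degenerate.
    by_cases h0 : ν 0 = 1
    · have hne : ∀ z ≠ 0, ν z = 0 := by
        intro z hz
        by_contra hpos
        have h2 : ν 0 + ν z ≤ 1 := by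
          rw [← h1, ← Finset.sum_pair hz.symm]
          exact ENNReal.sum_le_tsum _
        rw [h0] at h2
        have h3 : (1 : ℝ≥0∞) < 1 + ν z := ENNReal.lt_add_right ENNReal.one_ne_top hpos
        exact absurd h2 (not_le.2 h3)
      have h2 : ∀ j, (histAvg ν)^[j] (histWeight (M.boundTail μ)) 0 {0} =
          M.boundTail μ (j + 1) := by
        intro j
        have := iterate_histAvg_of_constant (G := M.boundTail μ) h0 hne j 0
        rwa [zero_add, Multiset.replicate_one, add_comm] at this
      simp_rw [h2]
      rw [← hM.lintegral_env]
      exact (hR.mean_lt_top (hzero.symm.trans h0)).ne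
    · have hret : ∃ r, 1 ≤ r ∧ (avg ν)^[r]
          (@Pi.single _ _ _ (fun a b => Classical.propDecidable (a = b)) 0 1) 0 ≠ 0 := by
        convert hM.exists_return (hR.origin_pos hlev)
      obtain ⟨v, w, hvw, hv, hw⟩ := exists_ne_of_return h1 h0 hret
      -- If all tails were equal to one, `H(0)` would be infinite almost surely.
      obtain ⟨K, hK⟩ : ∃ K, M.boundTail μ K < 1 := by
        by_contra! hall
        have hfin := hR.bound_finite_pos hlev
        refine hfin.ne' (measure_mono_null (t := ⋃ k : ℕ, {ω | (k : ℕ∞) ≤ M.env 0 ω}ᶜ)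
          (fun ω hω => ?_) (measure_iUnion_null fun k => ?_))
        · refine Set.mem_iUnion.2 ⟨(M.env 0 ω).toNat + 1, fun hle => ?_⟩
          have hω' : M.env 0 ω < ⊤ := hω
          simp only [Set.mem_ofPred_eq] at hle
          rw [← ENat.natCast_toNat hω'.ne] at hle
          simp only [ENat.toNat_natCast, Nat.cast_le] at hle
          omega
        · rw [prob_compl_eq_zero_iff]
          · exact le_antisymm prob_le_one (hall k)
          · exact hM.measurable_env 0 (MeasurableSet.of_discrete (s := Set.Ici (k : ℕ∞)))
      exact tsum_histAvg_ne_top hG h1 hK hvw hv hw hret 0 {0}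
  · refine tsum_histAvg_ne_top_of_transient hG (lt_of_le_of_ne ?_ h1) 0 {0}
    rw [hsum]
    exact prob_le_one

end Model

/-! ### Real renewal sequences and the exponential rate. -/

section Renewal

open Finset Filter Topology

/-- For a probability law `g` this is the decomposition at the last renewal up to `N`. It holds for
every `g` with `g 0 = 0`, by comparing `N` with `N + 1`. -/
theorem sum_renewal {V a g : ℕ → ℝ} (hg : g 0 = 0)
    (hV : ∀ n, V n = a n + ∑ k ∈ range n, V k * g (n - k)) (N : ℕ) :
    ∑ k ∈ range (N + 1), V k * (1 - ∑ j ∈ range (N - k + 1), g j) =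
      ∑ n ∈ range (N + 1), a n := by
  induction N with
  | zero => simpa [hg] using hV 0
  | succ N ih =>
    rw [sum_range_succ _ (N + 1), sum_range_succ a, ← ih]
    have h : ∀ k ∈ range (N + 1), V k * (1 - ∑ j ∈ range (N + 1 - k + 1), g j) =
        V k * (1 - ∑ j ∈ range (N - k + 1), g j) - V k * g (N + 1 - k) := by
      intro k hk
      rw [mem_range] at hk
      rw [show N + 1 - k + 1 = (N - k + 1) + 1 by omega, sum_range_succ _ (N - k + 1),
        show N - k + 1 = N + 1 - k by omega]
      ring
    rw [sum_congr rfl h, sum_sub_distrib]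
    have := hV (N + 1)
    simp only [Nat.sub_self, zero_add, sum_range_one, hg, sub_zero, mul_one]
    linarith

theorem sum_mul_eq_sum_sum_sub (g : ℕ → ℝ) (N : ℕ) :
    ∑ j ∈ range (N + 1), j * g j =
      ∑ k ∈ range N, (∑ j ∈ range (N + 1), g j - ∑ j ∈ range (k + 1), g j) := by
  induction N with
  | zero => simp
  | succ N ih =>
    rw [sum_range_succ _ (N + 1), ih]
    have : ∀ k, (∑ j ∈ range (N + 1 + 1), g j - ∑ j ∈ range (k + 1), g j) =
        (∑ j ∈ range (N + 1), g j - ∑ j ∈ range (k + 1), g j) + g (N + 1) := by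
      intro k
      rw [sum_range_succ _ (N + 1)]
      ring
    simp only [this, sum_add_distrib, sum_const, card_range, nsmul_eq_mul]
    rw [sum_range_succ
      (fun k => ∑ j ∈ range (N + 1), g j - ∑ j ∈ range (k + 1), g j) N, sub_self, add_zero]

variable {C : ℝ} {w g : ℕ → ℝ}

/-- If a partial sum of `g` were `1 + δ`, all but `K` terms of `sum_renewal` would be at most `-δ /
C`, and the others at most `1`. With enough terms the total could not be `1`. -/
theorem sum_le_one_of_renewal (hC : 0 < C) (hg0 : g 0 = 0) (hg : ∀ n, 0 ≤ g n)
    (hw : ∀ n, w n = (if n = 0 then 1 else 0) + ∑ k ∈ range n, w k * g (n - k))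
    (hw1 : ∀ n, w n ≤ 1) (hwC : ∀ n, 1 ≤ C * w n) (K : ℕ) :
    ∑ j ∈ range (K + 1), g j ≤ 1 := by
  by_contra! h
  set δ := ∑ j ∈ range (K + 1), g j - 1 with hδ
  have hδ0 : 0 < δ := by linarith
  have hw0 : ∀ n, 0 ≤ w n := fun n => by
    have := hwC n
    by_contra! h'
    nlinarith
  obtain ⟨M, hM⟩ := exists_nat_gt (C * (K / δ))
  have h1 := sum_renewal hg0 hw (M + K)
  have h2 : ∑ n ∈ range (M + K + 1), (if n = 0 then (1 : ℝ) else 0) = 1 := by simp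
  rw [h2, show M + K + 1 = (M + 1) + K by omega, sum_range_add] at h1
  have h3 : ∀ k ∈ range (M + 1),
      w k * (1 - ∑ j ∈ range (M + K - k + 1), g j) ≤ - (δ / C) := by
    intro k hk
    rw [mem_range] at hk
    have : ∑ j ∈ range (K + 1), g j ≤ ∑ j ∈ range (M + K - k + 1), g j :=
      sum_le_sum_of_subset_of_nonneg (range_subset_range.2 (by omega)) fun j _ _ => hg j
    have h4 : 1 / C ≤ w k := by
      rw [div_le_iff₀ hC]
      linarith [hwC k]
    have h5 : w k * (1 - ∑ j ∈ range (M + K - k + 1), g j) ≤ w k * (-δ) :=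
      mul_le_mul_of_nonneg_left (by linarith) (hw0 k)
    have h6 : 1 / C * δ ≤ w k * δ := mul_le_mul_of_nonneg_right h4 hδ0.le
    have h7 : δ / C = 1 / C * δ := by ring
    linarith
  have h4 : ∀ k ∈ range K,
      w (M + 1 + k) * (1 - ∑ j ∈ range (M + K - (M + 1 + k) + 1), g j) ≤ 1 := by
    intro k _
    have h5 : 0 ≤ ∑ j ∈ range (M + K - (M + 1 + k) + 1), g j := sum_nonneg fun j _ => hg j
    nlinarith [hw0 (M + 1 + k), hw1 (M + 1 + k)]
  have h5 := sum_le_sum h3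
  have h6 := sum_le_sum h4
  simp only [sum_const, card_range, nsmul_eq_mul] at h5 h6
  push_cast at h5
  have h7 : (K : ℝ) < M * (δ / C) := by
    have : C * (K / δ) * (δ / C) < M * (δ / C) := mul_lt_mul_of_pos_right hM (by positivity)
    have h8 : C * (K / δ) * (δ / C) = K := by field_simp
    linarith
  have h8 : 0 < δ / C := by positivity
  nlinarith

/-- The total in `sum_renewal` is `1` and every `w k` is at least `1 / C`. This bound on the sum of
the tails gives both mass one, since summable tails tend to zero, and a finite mean. -/
theorem sum_one_sub_le_of_renewal (hC : 0 < C) (hg0 : g 0 = 0) (hg : ∀ n, 0 ≤ g n)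
    (hw : ∀ n, w n = (if n = 0 then 1 else 0) + ∑ k ∈ range n, w k * g (n - k))
    (hw1 : ∀ n, w n ≤ 1) (hwC : ∀ n, 1 ≤ C * w n) (N : ℕ) :
    ∑ k ∈ range (N + 1), (1 - ∑ j ∈ range (k + 1), g j) ≤ C := by
  have h1 := sum_renewal hg0 hw N
  have h2 : ∑ n ∈ range (N + 1), (if n = 0 then (1 : ℝ) else 0) = 1 := by simp
  rw [h2] at h1
  rw [← sum_range_reflect, ← mul_one C, ← h1, mul_sum]
  refine sum_le_sum fun k hk => ?_
  rw [mem_range] at hk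
  have h3 := sum_le_one_of_renewal hC hg0 hg hw hw1 hwC (N - k)
  rw [show N + 1 - 1 - k + 1 = N - k + 1 by omega]
  nlinarith [hwC k]

theorem hasSum_one_of_renewal (hC : 0 < C) (hg0 : g 0 = 0) (hg : ∀ n, 0 ≤ g n)
    (hw : ∀ n, w n = (if n = 0 then 1 else 0) + ∑ k ∈ range n, w k * g (n - k))
    (hw1 : ∀ n, w n ≤ 1) (hwC : ∀ n, 1 ≤ C * w n) : HasSum g 1 := by
  have hs : Summable fun k => 1 - ∑ j ∈ range (k + 1), g j := by
    refine summable_of_sum_range_le (c := C)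
      (fun k => sub_nonneg.2 (sum_le_one_of_renewal hC hg0 hg hw hw1 hwC k)) fun n => ?_
    refine le_trans ?_ (sum_one_sub_le_of_renewal hC hg0 hg hw hw1 hwC n)
    exact sum_le_sum_of_subset_of_nonneg (range_subset_range.2 (by omega)) fun k _ _ =>
      sub_nonneg.2 (sum_le_one_of_renewal hC hg0 hg hw hw1 hwC k)
  have h := hs.tendsto_atTop_zero
  rw [hasSum_iff_tendsto_nat_of_nonneg hg, ← tendsto_add_atTop_iff_nat 1]
  simpa using h.const_sub 1

theorem summable_mean_of_renewal (hC : 0 < C) (hg0 : g 0 = 0) (hg : ∀ n, 0 ≤ g n)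
    (hw : ∀ n, w n = (if n = 0 then 1 else 0) + ∑ k ∈ range n, w k * g (n - k))
    (hw1 : ∀ n, w n ≤ 1) (hwC : ∀ n, 1 ≤ C * w n) : Summable fun k : ℕ => k * g k := by
  refine summable_of_sum_range_le (c := C) (fun k => mul_nonneg k.cast_nonneg (hg k)) fun n => ?_
  calc ∑ k ∈ range n, (k : ℝ) * g k ≤ ∑ k ∈ range (n + 1), (k : ℝ) * g k :=
        sum_le_sum_of_subset_of_nonneg (range_subset_range.2 (by omega)) fun k _ _ =>
          mul_nonneg k.cast_nonneg (hg k)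
    _ = _ := sum_mul_eq_sum_sum_sub g n
    _ ≤ ∑ k ∈ range n, (1 - ∑ j ∈ range (k + 1), g j) := sum_le_sum fun k _ =>
          sub_le_sub_right (sum_le_one_of_renewal hC hg0 hg hw hw1 hwC n) _
    _ ≤ ∑ k ∈ range (n + 1), (1 - ∑ j ∈ range (k + 1), g j) :=
        sum_le_sum_of_subset_of_nonneg (range_subset_range.2 (by omega)) fun k _ _ =>
          sub_nonneg.2 (sum_le_one_of_renewal hC hg0 hg hw hw1 hwC k)
    _ ≤ C := sum_one_sub_le_of_renewal hC hg0 hg hw hw1 hwC n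

/-- The same identity for the delayed equation bounds the partial sums of `a` by `C` times the sum
of the tails. -/
theorem summable_delay_of_renewal (hC : 0 < C) (hg0 : g 0 = 0) (hg : ∀ n, 0 ≤ g n)
    (hw : ∀ n, w n = (if n = 0 then 1 else 0) + ∑ k ∈ range n, w k * g (n - k))
    (hw1 : ∀ n, w n ≤ 1) (hwC : ∀ n, 1 ≤ C * w n) {V a : ℕ → ℝ} (ha : ∀ n, 0 ≤ a n)
    (hV : ∀ n, V n = a n + ∑ k ∈ range n, V k * g (n - k)) (hVC : ∀ n, V n ≤ C) :
    Summable a := by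
  refine summable_of_sum_range_le (c := C * C) ha fun n => ?_
  calc ∑ k ∈ range n, a k ≤ ∑ k ∈ range (n + 1), a k :=
        sum_le_sum_of_subset_of_nonneg (range_subset_range.2 (by omega)) fun k _ _ => ha k
    _ = _ := (sum_renewal hg0 hV n).symm
    _ ≤ ∑ k ∈ range (n + 1), C * (1 - ∑ j ∈ range (n - k + 1), g j) := sum_le_sum fun k _ =>
          mul_le_mul_of_nonneg_right (hVC k)
            (sub_nonneg.2 (sum_le_one_of_renewal hC hg0 hg hw hw1 hwC _))
    _ = C * ∑ k ∈ range (n + 1), (1 - ∑ j ∈ range (k + 1), g j) := by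
        rw [← mul_sum, ← sum_range_reflect (fun k => 1 - ∑ j ∈ range (k + 1), g j)]
        rfl
    _ ≤ C * C := mul_le_mul_of_nonneg_left
        (sum_one_sub_le_of_renewal hC hg0 hg hw hw1 hwC n) hC.le

variable {u f v e : ℕ → ℝ}

theorem renewal_pos (hf : ∀ n, 0 ≤ f n) (hf1 : 0 < f 1)
    (hu : ∀ n, u n = (if n = 0 then 1 else 0) + ∑ k ∈ range n, u k * f (n - k)) (n : ℕ) :
    0 < u n := by
  induction n using Nat.strong_induction_on with
  | _ n ih =>
    rw [hu]
    rcases n with _ | n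
    · simp
    · have h0 : ∀ k ∈ range (n + 1), 0 ≤ u k * f (n + 1 - k) := fun k hk =>
        mul_nonneg (ih k (mem_range.1 hk)).le (hf _)
      have h := single_le_sum h0 (self_mem_range_succ n)
      have h1 : 0 < u n * f (n + 1 - n) := by
        rw [show n + 1 - n = 1 by omega]
        exact mul_pos (ih n (by omega)) hf1
      simp only [Nat.add_eq_zero_iff, one_ne_zero, and_false, if_false, zero_add]
      linarith

/-- In the renewal sum for `n + m` only the terms with index at least `n` are kept, and the
induction hypothesis is applied to each of them. -/
theorem renewal_mul_le (hf : ∀ n, 0 ≤ f n) (hf1 : 0 < f 1)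
    (hu : ∀ n, u n = (if n = 0 then 1 else 0) + ∑ k ∈ range n, u k * f (n - k)) (n m : ℕ) :
    u n * u m ≤ u (n + m) := by
  have hpos := renewal_pos hf hf1 hu
  induction m using Nat.strong_induction_on with
  | _ m ih =>
    rcases Nat.eq_zero_or_pos m with rfl | hm
    · have h0 : u 0 = 1 := by rw [hu]; simp
      simp [h0]
    · rw [hu m, hu (n + m), if_neg (by omega), if_neg (by omega), zero_add, zero_add,
        sum_range_add, mul_sum]
      refine le_trans (sum_le_sum fun k hk => ?_)
        (le_add_of_nonneg_left (sum_nonneg fun k _ => mul_nonneg (hpos k).le (hf _)))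
      rw [mem_range] at hk
      rw [show n + m - (n + k) = m - k by omega, ← mul_assoc]
      exact mul_le_mul_of_nonneg_right (ih k hk) (hf _)

/-- Fekete's lemma applies to `-log u` and to `log C + log u`. Their normalized limits are opposite
because `log C / n` tends to `0`, and each limit is an infimum, which gives one of the two bounds.
-/
theorem exists_rate (h00 : u 0 = 1) (hpos : ∀ n, 0 < u n) (hu1 : ∀ n, u n ≤ 1)
    (hsup : ∀ n m, u n * u m ≤ u (n + m)) (hsub : ∀ n m, u (n + m) ≤ C * (u n * u m)) :
    ∃ q : ℝ, 0 < q ∧ q ≤ 1 ∧ ∀ n, u n ≤ q ^ n ∧ q ^ n ≤ C * u n := by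
  have hC : 0 < C := by
    have := hsub 0 0
    have h1 := hpos (0 + 0)
    have h2 := mul_pos (hpos 0) (hpos 0)
    by_contra! h
    nlinarith
  have hC1 : 1 ≤ C := by
    have := hsub 0 0
    simpa [h00] using this
  have hφ : Subadditive fun n => - Real.log (u n) := by
    intro m n
    have := Real.log_le_log (mul_pos (hpos m) (hpos n)) (hsup m n)
    rw [Real.log_mul (hpos m).ne' (hpos n).ne'] at this
    dsimp only
    linarith
  have hψ : Subadditive fun n => Real.log C + Real.log (u n) := by
    intro m n
    have := Real.log_le_log (hpos _) (hsub m n)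
    rw [Real.log_mul hC.ne' (mul_pos (hpos m) (hpos n)).ne',
      Real.log_mul (hpos m).ne' (hpos n).ne'] at this
    dsimp only
    linarith
  have hφ0 : ∀ n, 0 ≤ - Real.log (u n) := fun n =>
    neg_nonneg.2 (Real.log_nonpos (hpos n).le (hu1 n))
  have hbφ : BddBelow (Set.range fun n : ℕ => - Real.log (u n) / n) :=
    ⟨0, by rintro _ ⟨n, rfl⟩; exact div_nonneg (hφ0 n) n.cast_nonneg⟩
  -- Supermultiplicativity gives `u n ≥ u 1 ^ n`; this supplies the lower bound that Fekete's lemma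
  -- requires of the second sequence.
  have hlow : ∀ n : ℕ, n * Real.log (u 1) ≤ Real.log (u n) := by
    intro n
    induction n with
    | zero => simp [h00]
    | succ n ih =>
      have := hφ n 1
      dsimp only at this
      push_cast
      linarith
  have hbψ : BddBelow (Set.range fun n : ℕ => (Real.log C + Real.log (u n)) / n) := by
    refine ⟨Real.log (u 1), ?_⟩
    rintro _ ⟨n, rfl⟩
    rcases Nat.eq_zero_or_pos n with rfl | hn
    · simpa using neg_nonneg.1 (hφ0 1)
    · have hn' : (0 : ℝ) < n := by exact_mod_cast hn
      dsimp only
      rw [le_div_iff₀ hn']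
      linarith [hlow n, Real.log_nonneg hC1]
  have hlim : hψ.lim = - hφ.lim := by
    refine tendsto_nhds_unique (hψ.tendsto_lim hbψ) ?_
    have h1 := (hφ.tendsto_lim hbφ).neg
    have h2 := tendsto_const_div_atTop_nhds_zero_nat (Real.log C)
    have h3 := h2.add h1
    rw [zero_add] at h3
    refine h3.congr fun n => ?_
    ring
  have hexp : ∀ n : ℕ, Real.exp (-hφ.lim) ^ n = Real.exp (-(hφ.lim * n)) := fun n => by
    rw [← Real.exp_nat_mul]
    congr 1
    ring
  refine ⟨Real.exp (-hφ.lim), Real.exp_pos _, ?_, fun n => ?_⟩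
  · rw [Real.exp_le_one_iff, neg_nonpos]
    exact ge_of_tendsto' (hφ.tendsto_lim hbφ) fun n => div_nonneg (hφ0 n) n.cast_nonneg
  · rw [hexp]
    rcases Nat.eq_zero_or_pos n with rfl | hn
    · simpa [h00] using hC1
    · have hn' : (0 : ℝ) < n := by exact_mod_cast hn
      have h1 := hφ.lim_le_div hbφ hn.ne'
      have h2 := hψ.lim_le_div hbψ hn.ne'
      rw [le_div_iff₀ hn'] at h1 h2
      rw [hlim] at h2
      constructor
      · rw [← Real.log_le_iff_le_exp (hpos n)]
        linarith
      · rw [← Real.le_log_iff_exp_le (mul_pos hC (hpos n)), Real.log_mul hC.ne' (hpos n).ne']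
        linarith

/-- Division by `q ^ n` preserves renewal equations and places the renewal sequence between `1 / C`
and `1`. -/
theorem exists_rate_of_renewal (hf0 : f 0 = 0) (hf : ∀ n, 0 ≤ f n) (hf1 : 0 < f 1)
    (hu : ∀ n, u n = (if n = 0 then 1 else 0) + ∑ k ∈ range n, u k * f (n - k))
    (hu1 : ∀ n, u n ≤ 1) (hsub : ∀ n m, u (n + m) ≤ C * (u n * u m))
    (he : ∀ n, 0 ≤ e n) (he0 : 0 < e 0)
    (hv : ∀ n, v n = e n + ∑ k ∈ range n, v k * f (n - k)) (hvC : ∀ n, v n ≤ C * u n) :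
    ∃ q : ℝ, 0 < q ∧ q ≤ 1 ∧ HasSum (fun k => f (k + 1) / q ^ (k + 1)) 1 ∧
      Summable (fun k : ℕ => ((k + 1 : ℕ) : ℝ) * (f (k + 1) / q ^ (k + 1))) ∧
      1 ≤ ∑' k : ℕ, ((k + 1 : ℕ) : ℝ) * (f (k + 1) / q ^ (k + 1)) ∧
      Summable (fun m => e m / q ^ m) ∧ 0 < ∑' m, e m / q ^ m := by
  have hpos := renewal_pos hf hf1 hu
  obtain ⟨q, hq, hq1, hqu⟩ := exists_rate (by rw [hu]; simp) hpos hu1 (renewal_mul_le hf hf1 hu) hsub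
  have hC : 0 < C := by
    have := (pow_pos hq 0).trans_le (hqu 0).2
    exact pos_of_mul_pos_left this (hpos 0).le
  have hscale : ∀ (V : ℕ → ℝ) (n : ℕ), (∑ k ∈ range n, V k * f (n - k)) / q ^ n =
      ∑ k ∈ range n, V k / q ^ k * (f (n - k) / q ^ (n - k)) := by
    intro V n
    rw [sum_div]
    refine sum_congr rfl fun k hk => ?_
    rw [mem_range] at hk
    rw [div_mul_div_comm, ← pow_add, show k + (n - k) = n by omega]
  have hg0 : f 0 / q ^ 0 = 0 := by simp [hf0]
  have hg : ∀ n, 0 ≤ f n / q ^ n := fun n => div_nonneg (hf n) (pow_pos hq n).le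
  have hw : ∀ n, u n / q ^ n = (if n = 0 then 1 else 0) +
      ∑ k ∈ range n, u k / q ^ k * (f (n - k) / q ^ (n - k)) := by
    intro n
    rw [← hscale]
    conv_lhs => rw [hu n]
    rw [add_div]
    congr 1
    split_ifs with h <;> simp [h]
  have hw1 : ∀ n, u n / q ^ n ≤ 1 := fun n => (div_le_one (pow_pos hq n)).2 (hqu n).1
  have hwC : ∀ n, 1 ≤ C * (u n / q ^ n) := fun n => by
    rw [← mul_div_assoc]
    exact (one_le_div (pow_pos hq n)).2 (hqu n).2
  have hV : ∀ n, v n / q ^ n = e n / q ^ n +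
      ∑ k ∈ range n, v k / q ^ k * (f (n - k) / q ^ (n - k)) := by
    intro n
    rw [← hscale]
    conv_lhs => rw [hv n]
    rw [add_div]
  have hVC : ∀ n, v n / q ^ n ≤ C := fun n => by
    rw [div_le_iff₀ (pow_pos hq n)]
    exact (hvC n).trans (mul_le_mul_of_nonneg_left (hqu n).1 hC.le)
  have ha : ∀ n, 0 ≤ e n / q ^ n := fun n => div_nonneg (he n) (pow_pos hq n).le
  have hone := hasSum_one_of_renewal hC hg0 hg hw hw1 hwC
  have hmean := summable_mean_of_renewal hC hg0 hg hw hw1 hwC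
  have hdelay := summable_delay_of_renewal hC hg0 hg hw hw1 hwC ha hV hVC
  have hone' : HasSum (fun k => f (k + 1) / q ^ (k + 1)) 1 := by
    rw [hasSum_nat_add_iff (f := fun k => f k / q ^ k) 1]
    simpa [hf0] using hone
  have hmean' := (summable_nat_add_iff 1).2 hmean
  refine ⟨q, hq, hq1, hone', hmean', ?_, hdelay, ?_⟩
  · rw [← hone'.tsum_eq]
    refine hone'.summable.tsum_le_tsum (fun k => ?_) hmean'
    refine le_mul_of_one_le_left (hg _) ?_
    exact_mod_cast Nat.succ_pos k
  · exact hdelay.tsum_pos ha 0 (by simpa using he0)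

end Renewal

/-- Both `k` and `n` are separating. Hence the proviso `1 ≤ etaStar` in `kappaStar` costs nothing on
skip-free paths. -/
theorem one_le_eta_of_kappa_eq {n N k : ℕ} {y : ℕ → Site d} [NeZero d] (hy : SkipFreeTo N y)
    (h : hitTime n y = N) (hk : kappa n y = (k : WithBot ℕ)) : 1 ≤ eta n y := by
  classical
  obtain ⟨hkn, hs, -⟩ := kappa_eq_coe_iff.1 hk
  have : 1 < ((Finset.range (n + 1)).filter (IsSeparating n y)).card := by
    refine Finset.one_lt_card.2 ⟨k, ?_, n, ?_, hkn.ne⟩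
    · exact Finset.mem_filter.2 ⟨Finset.mem_range.2 (by omega), hs⟩
    · exact Finset.mem_filter.2 ⟨Finset.mem_range.2 (by omega), hy.isSeparating_self h⟩
  rw [eta]
  have h' : (1 : ℤ) < ((Finset.range (n + 1)).filter (IsSeparating n y)).card := by
    exact_mod_cast this
  convert (show (1 : ℤ) ≤ ((Finset.range (n + 1)).filter (IsSeparating n y)).card - 1 by omega)

/-! ### Laws of the pieces between separating levels, and existence of `q`. -/

namespace Model

variable {d : ℕ} [NeZero d] {Ω : Type*} [MeasurableSpace Ω] {M : Model d Ω} {μ : Measure Ω}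
  [IsProbabilityMeasure μ]

omit [IsProbabilityMeasure μ] in
theorem regular_of (h1 : M.SkipFree μ) (h2 : M.Environment μ) (h3 : M.Virgin μ) :
    M.Regular μ where
  skipFree := h1
  measurable_start := h2.measurable_start
  measurable_env := h2.measurable_env
  indep := h2.indep
  start_le := h2.start_le
  virgin := h3

open Classical in
omit [IsProbabilityMeasure μ] in
theorem Regular.measure_etaStar_stopped (hM : M.Regular μ) (n m : ℕ)
    (A : Set (List (Site d))) :
    μ {ω | hitTime n (M.path ω) < M.death ω ∧ etaStar n (M.bound ω) (M.path ω) = (m : ℤ) ∧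
        StoppedPathMem n (M.path ω) A} =
      ∑' y, if FirstPassage n y ∧ eta n (ofList y) = (m : ℤ) ∧ y ∈ A then
        M.weight μ y else 0 := by
  refine Eq.trans ?_ ((hM.measure_stopped n fun y => eta n (ofList y) = (m : ℤ) ∧ y ∈ A).trans
    (tsum_congr fun y => by congr))
  congr 1
  ext ω
  simp only [Set.mem_ofPred_eq, etaStar_eq_coe_iff]
  refine and_congr_right fun h => ?_
  obtain ⟨N, hN⟩ := exists_hitTime_eq_of_lt_top h
  rw [stoppedPathMem_iff hN]
  exact and_congr_left fun _ => ⟨fun h' => h'.2, fun h' => ⟨h, h'⟩⟩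

omit [IsProbabilityMeasure μ] in
theorem Regular.measure_etaStar (hM : M.Regular μ) (n : ℕ) :
    μ {ω | etaStar n (M.bound ω) (M.path ω) = 0} = M.firstReach μ n := by
  classical
  rw [firstReach]
  refine Eq.trans ?_ ((hM.measure_stopped n fun y => eta n (ofList y) = 0).trans
    (tsum_congr fun y => by congr))
  congr 1
  ext ω
  exact etaStar_eq_coe_iff (m := 0)

open Classical in
omit [IsProbabilityMeasure μ] in
theorem Regular.measure_start_block (hM : M.Regular μ) (k K : ℕ) (y : List (Site d)) :
    μ ({ω | etaStar k (M.bound ω) (M.path ω) = 0} ∩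
        {ω | hitTime k (M.path ω) = (K : ℕ∞) ∧ (K : ℕ∞) < M.death ω ∧
          pathTo (M.path ω) K = y}) =
      if y.length = K + 1 ∧ FirstPassage k y ∧ eta k (ofList y) = 0 then M.weight μ y else 0 := by
  have h := hM.measure_stopped k fun z => (eta k (ofList z) = 0 ∧ z = y) ∧ y.length = K + 1
  rw [tsum_eq_single y] at h
  · refine Eq.trans ?_ (h.trans ?_)
    · congr 1
      ext ω
      have h0 := etaStar_eq_coe_iff (n := k) (h := M.bound ω) (Y := M.path ω) (m := 0)
      rw [Nat.cast_zero] at h0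
      simp only [Set.mem_inter_iff, Set.mem_ofPred_eq, h0]
      constructor
      · rintro ⟨⟨h1, h2⟩, h3, -, h4⟩
        rw [stopped_eq h3] at h2 ⊢
        exact ⟨h1, ⟨h2, h4⟩, by rw [← h4, length_pathTo]⟩
      · rintro ⟨h1, ⟨h2, h3⟩, h4⟩
        obtain ⟨N, hN⟩ := exists_hitTime_eq_of_lt_top h1
        rw [stopped_eq hN] at h3
        obtain rfl : N = K := by
          rw [← h3, length_pathTo] at h4
          omega
        exact ⟨⟨h1, h2⟩, hN, hN ▸ h1, h3⟩
    · simp only [and_true]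
      exact if_congr (by tauto) rfl rfl
  · intro z hz
    exact if_neg fun h => hz h.2.1.2

omit [MeasurableSpace Ω] in
theorem zeroModel_path_zero (ω : Ω) : M.zeroModel.path ω 0 = 0 := by
  simp [path, walk, zeroModel]

omit [MeasurableSpace Ω] in
theorem zeroModel_pathTo_eq_iff (ω : Ω) (L : ℕ) (x : List (Site d)) :
    pathTo (M.zeroModel.path ω) L = 0 :: x ↔ shiftedPathTo (M.zeroModel.path ω) L = x := by
  have h := cons_shiftedPathTo (M.zeroModel.path ω) L
  simp only [zeroModel_path_zero, sub_zero] at h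
  rw [← h, List.cons_inj_right]

open Classical in
omit [IsProbabilityMeasure μ] in
theorem Regular.ite_kappa_eq_blockWeight (hM : M.Regular μ) (l : ℕ) (x : List (Site d)) :
    (if FirstPassage l (0 :: x) ∧ 1 ≤ eta l (ofList (0 :: x)) ∧
        kappa l (ofList (0 :: x)) = ((0 : ℕ) : WithBot ℕ) then M.zeroModel.weight μ (0 :: x) else 0) =
      M.blockWeight μ l x := by
  rw [blockWeight]
  by_cases hw : M.zeroModel.weight μ (0 :: x) = 0
  · simp only [hw, ite_self]
  · refine if_congr (and_congr_right fun h => ⟨fun h' => h'.2, fun h' => ⟨?_, h'⟩⟩) rfl rfl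
    have hs := hM.zeroModel_regular.skipFreeList hw
    have hN : (0 :: x : List (Site d)).length = x.length + 1 := rfl
    rw [SkipFreeList, hN, Nat.add_sub_cancel] at hs
    exact one_le_eta_of_kappa_eq hs (h.hitTime_eq hN) h'

theorem Regular.measure_kappaStar (hM : M.Regular μ) (l : ℕ) :
    μ {ω | kappaStar l (M.zeroModel.bound ω) (M.zeroModel.path ω) = ((0 : ℕ) : WithBot ℕ)} =
      M.gap μ l := by
  classical
  have h := hM.zeroModel_regular.measure_stopped l fun y =>
    1 ≤ eta l (ofList y) ∧ kappa l (ofList y) = ((0 : ℕ) : WithBot ℕ)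
  refine Eq.trans ?_ (h.trans ?_)
  · congr 1
    ext ω
    exact kappaStar_eq_coe_iff
  · rw [gap, ← (List.cons_injective (a := (0 : Site d))).tsum_eq]
    · exact tsum_congr fun x => by
        convert hM.ite_kappa_eq_blockWeight l x
    · intro y hy
      rw [Function.mem_support] at hy
      split_ifs at hy with h'
      · obtain ⟨x, rfl, -⟩ := exists_cons_of_weight_zeroModel_ne_zero hy
        exact ⟨x, rfl⟩
      · exact absurd rfl hy

open Classical in
omit [IsProbabilityMeasure μ] in
theorem Regular.measure_block (hM : M.Regular μ) (l L : ℕ) (x : List (Site d)) :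
    μ ({ω | kappaStar l (M.zeroModel.bound ω) (M.zeroModel.path ω) = ((0 : ℕ) : WithBot ℕ)} ∩
        {ω | hitTime l (M.zeroModel.path ω) = (L : ℕ∞) ∧ (L : ℕ∞) < M.zeroModel.death ω ∧
          shiftedPathTo (M.zeroModel.path ω) L = x}) =
      if x.length = L then M.blockWeight μ l x else 0 := by
  have h := hM.zeroModel_regular.measure_stopped l fun z =>
    ((1 ≤ eta l (ofList z) ∧ kappa l (ofList z) = ((0 : ℕ) : WithBot ℕ)) ∧ z = 0 :: x) ∧
      x.length = L
  rw [tsum_eq_single (0 :: x)] at h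
  · refine Eq.trans ?_ (h.trans ?_)
    · congr 1
      ext ω
      simp only [Set.mem_inter_iff, Set.mem_ofPred_eq, kappaStar_eq_coe_iff]
      constructor
      · rintro ⟨⟨h1, h2⟩, h3, -, h4⟩
        rw [stopped_eq h3] at h2 ⊢
        exact ⟨h1, ⟨h2, (zeroModel_pathTo_eq_iff ω L x).2 h4⟩, by rw [← h4, length_shiftedPathTo]⟩
      · rintro ⟨h1, ⟨h2, h3⟩, h4⟩
        obtain ⟨N, hN⟩ := exists_hitTime_eq_of_lt_top h1
        rw [stopped_eq hN] at h3
        obtain rfl : N = L := by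
          have := congrArg List.length h3
          rw [length_pathTo, List.length_cons] at this
          omega
        exact ⟨⟨h1, h2⟩, hN, hN ▸ h1, (zeroModel_pathTo_eq_iff ω N x).1 h3⟩
    · rw [← hM.ite_kappa_eq_blockWeight]
      split_ifs <;> first | rfl | tauto
  · intro z hz
    exact if_neg fun h => hz h.2.1.2

theorem Regular.gap_le_one (hM : M.Regular μ) (l : ℕ) : M.gap μ l ≤ 1 :=
  hM.measure_kappaStar l ▸ prob_le_one

theorem Regular.firstReach_le_one (hM : M.Regular μ) (l : ℕ) : M.firstReach μ l ≤ 1 :=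
  hM.measure_etaStar l ▸ prob_le_one

theorem Regular.probKappa_eq (hM : M.Regular μ) (l : ℕ) :
    M.probKappa μ l = (M.gap μ l).toReal := by
  rw [probKappa, measureReal_def, hM.measure_kappaStar]

omit [IsProbabilityMeasure μ] in
theorem Regular.probEta_eq (hM : M.Regular μ) (l : ℕ) :
    M.probEta μ l = (M.firstReach μ l).toReal := by
  rw [probEta, measureReal_def, hM.measure_etaStar]

omit [IsProbabilityMeasure μ] in
theorem gap_zero : M.gap μ 0 = 0 := by
  refine ENNReal.tsum_eq_zero.2 fun x => if_neg fun h => ?_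
  exact absurd (kappa_eq_coe_iff.1 h.2).1 (lt_irrefl 0)

/-- One step up from the origin reaches height `1` and visits each of its two sites once, which is
free. Positivity here makes the whole renewal sequence positive. -/
theorem Regular.gap_one_ne_zero (hM : M.Regular μ) : M.gap μ 1 ≠ 0 := by
  classical
  have h1 : M.zeroModel.reach μ 1 = M.gap μ 1 := by
    rw [hM.reach_zeroModel_eq le_rfl]
    simp [hM.reach_zeroModel_zero]
  obtain ⟨s, hs0, hs⟩ : ∃ s : Site d, s 0 = 1 ∧ M.stepLaw μ s ≠ 0 := by
    by_contra! h
    refine hM.skipFree.up_pos.ne' ?_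
    have hset : {ω | M.inc 0 ω 0 = 1} = ⋃ (s : Site d) (_ : s 0 = 1), {ω | M.inc 0 ω = s} := by
      ext ω
      simp
    rw [hset]
    exact measure_iUnion_null fun s => measure_iUnion_null fun hs => h s hs
  rw [← h1, reach]
  refine fun h0 => ?_
  have h2 := ENNReal.tsum_eq_zero.1 h0 [0, s]
  rw [if_pos, weight_zeroModel_cons (by simp [hs0]), freeWeight, mul_eq_zero] at h2
  · have hne : (0 : Site d) ≠ s := by
      rintro rfl
      simp at hs0
    rcases h2 with h2 | h2
    · simp [stepWeight, hs] at h2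
    · rw [boundWeight, Finset.prod_eq_zero_iff] at h2
      obtain ⟨z, hz, hz'⟩ := h2
      have : ([0, s] : List (Site d)).count z = 1 := by
        simp only [Finset.mem_filter, List.mem_toFinset] at hz
        exact List.count_eq_one_of_mem (by simp [hne]) hz.1
      have h3 := hM.isTail.one
      rw [this, h3] at hz'
      exact one_ne_zero hz'
  · refine ⟨1, rfl, hitTime_eq_coe_iff.2 ⟨by simp [ofList, hs0], fun t ht => ?_⟩⟩
    obtain rfl : t = 0 := by omega
    simp [ofList]

/-- There is no level below `0`, so this is the probability to reach height `0` alive. -/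
theorem Regular.firstReach_zero_ne_zero (hM : M.Regular μ) (h2 : M.Environment μ) :
    M.firstReach μ 0 ≠ 0 := by
  classical
  have h := hM.reach_eq 0
  rw [Finset.sum_range_zero, add_zero] at h
  rw [← h, reach]
  have h3 := hM.measure_stopped 0 fun _ => True
  simp only [and_true] at h3
  refine fun h0 => h2.hit_zero_pos.ne' (h3.trans ?_)
  convert h0

theorem Regular.zeroModel_reach_add_le (hM : M.Regular μ) (k m : ℕ) :
    M.zeroModel.reach μ (k + m) ≤ levelVisits (M.stepLaw μ) (M.boundTail μ) *
      (M.zeroModel.reach μ k * M.zeroModel.reach μ m) := by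
  have h := hM.zeroModel_regular.reach_add_le k m
  rw [stepLaw_zeroModel, boundTail_zeroModel] at h
  refine h.trans ?_
  rw [mul_left_comm]
  exact mul_le_mul' le_rfl (hM.freeReach_le m)

theorem Regular.reach_le (hM : M.Regular μ) (m : ℕ) :
    M.reach μ m ≤ levelVisits (M.stepLaw μ) (M.boundTail μ) * M.zeroModel.reach μ m := by
  have h := hM.reach_add_le 0 m
  rw [zero_add] at h
  refine h.trans ?_
  rw [← one_mul (levelVisits _ _ * _)]
  exact mul_le_mul' (hM.reach_le_one 0) (hM.freeReach_le m)

theorem Regular.exists_isRate (hM : M.Regular μ) (h2 : M.Environment μ) (h4 : M.Returns μ) :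
    ∃ q, M.IsRate μ q := by
  have hC := hM.levelVisits_ne_top h4
  have hu1 := fun n => ne_top_of_le_ne_top ENNReal.one_ne_top (hM.zeroModel_regular.reach_le_one n)
  have hv1 := fun n => ne_top_of_le_ne_top ENNReal.one_ne_top (hM.reach_le_one n)
  have hf1 := fun n => ne_top_of_le_ne_top ENNReal.one_ne_top (hM.gap_le_one n)
  have he1 := fun n => ne_top_of_le_ne_top ENNReal.one_ne_top (hM.firstReach_le_one n)
  have hsum : ∀ (r : ℕ → ℝ≥0∞), (∀ n, r n ≠ ⊤) → ∀ n,
      (∑ k ∈ Finset.range n, r k * M.gap μ (n - k)).toReal =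
        ∑ k ∈ Finset.range n, (r k).toReal * (M.gap μ (n - k)).toReal := by
    intro r hr n
    rw [ENNReal.toReal_sum fun k _ => ENNReal.mul_ne_top (hr k) (hf1 _)]
    exact Finset.sum_congr rfl fun k _ => ENNReal.toReal_mul
  obtain ⟨q, hq, hq1, h5, h6, h7, h8, h9⟩ := exists_rate_of_renewal
    (C := (levelVisits (M.stepLaw μ) (M.boundTail μ)).toReal)
    (u := fun n => (M.zeroModel.reach μ n).toReal) (f := fun n => (M.gap μ n).toReal)
    (v := fun n => (M.reach μ n).toReal) (e := fun n => (M.firstReach μ n).toReal)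
    (by simp [gap_zero]) (fun _ => ENNReal.toReal_nonneg)
    (ENNReal.toReal_pos hM.gap_one_ne_zero (hf1 1))
    (fun n => by
      rcases Nat.eq_zero_or_pos n with rfl | hn
      · simp [hM.reach_zeroModel_zero]
      · rw [if_neg hn.ne', zero_add, ← hsum _ hu1, ← hM.reach_zeroModel_eq hn])
    (fun n => ENNReal.toReal_le_of_le_ofReal zero_le_one
      (by simpa using hM.zeroModel_regular.reach_le_one n))
    (fun n m => by
      rw [← ENNReal.toReal_mul, ← ENNReal.toReal_mul]
      exact ENNReal.toReal_mono (ENNReal.mul_ne_top hC (ENNReal.mul_ne_top (hu1 n) (hu1 m)))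
        (hM.zeroModel_reach_add_le n m))
    (fun _ => ENNReal.toReal_nonneg)
    (ENNReal.toReal_pos (hM.firstReach_zero_ne_zero h2) (he1 0))
    (fun n => by
      rw [← hsum _ hv1, ← ENNReal.toReal_add (he1 n)
        (ENNReal.sum_ne_top.2 fun k _ => ENNReal.mul_ne_top (hv1 k) (hf1 _)), ← hM.reach_eq])
    (fun n => by
      rw [← ENNReal.toReal_mul]
      exact ENNReal.toReal_mono (ENNReal.mul_ne_top hC (hu1 n)) (hM.reach_le n))
  simp only [← hM.probKappa_eq, ← hM.probEta_eq] at h5 h6 h7 h8 h9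
  exact ⟨q, hq, hq1, h5, h6, h7, h8, h9⟩

end Model

/-! ### The core path and its prefixes. -/

section CorePath

variable {d : ℕ} {b b' : ℕ → Block d}

instance : Countable (Block d) :=
  Function.Injective.countable (f := fun v : Block d => (v.height, v.duration, v.points))
    fun v w h => by
      cases v
      cases w
      simpa using h

theorem corePrefix_succ (m : ℕ) :
    corePrefix b (m + 1) = cat (corePrefix b m) (b (m + 1)).points := rfl

theorem coreLevel_succ (m : ℕ) : coreLevel b (m + 1) = coreLevel b m + (b (m + 1)).height :=
  Finset.sum_range_succ _ _

theorem coreLevel_zero : coreLevel b 0 = (b 0).height := by simp [coreLevel]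

theorem corePrefix_congr {m : ℕ} (h : ∀ i ≤ m, b i = b' i) : corePrefix b m = corePrefix b' m := by
  induction m with
  | zero => simp only [corePrefix, h 0 le_rfl]
  | succ m ih =>
    rw [corePrefix_succ, corePrefix_succ, ih fun i hi => h i (by omega), h _ le_rfl]

theorem coreLevel_congr {m : ℕ} (h : ∀ i ≤ m, b i = b' i) : coreLevel b m = coreLevel b' m :=
  Finset.sum_congr rfl fun i hi => by rw [h i (by simpa [Nat.lt_succ_iff] using hi)]

/-- Non-empty blocks guarantee that the prefix number `j` has an entry number `j`; the default value
in `corePath` is then never used. -/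
theorem lt_length_corePrefix (hb : ∀ i, (b i).points ≠ []) (m : ℕ) :
    m < (corePrefix b m).length := by
  induction m with
  | zero => exact List.length_pos_iff.2 (hb 0)
  | succ m ih =>
    have := List.length_pos_iff.2 (hb (m + 1))
    rw [corePrefix_succ, length_cat]
    omega

theorem ofList_corePrefix {m m' t : ℕ} (hm : m ≤ m') (ht : t < (corePrefix b m).length) :
    ofList (corePrefix b m') t = ofList (corePrefix b m) t ∧ t < (corePrefix b m').length := by
  induction m', hm using Nat.le_induction with
  | base => exact ⟨rfl, ht⟩
  | succ m' _ ih =>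
    rw [corePrefix_succ, ofList_cat_left ih.2, length_cat]
    exact ⟨ih.1, by omega⟩

theorem corePath_eq (hb : ∀ i, (b i).points ≠ []) {m t : ℕ}
    (ht : t < (corePrefix b m).length) : corePath b t = ofList (corePrefix b m) t :=
  (ofList_corePrefix (le_max_right m t) (lt_length_corePrefix hb t)).1.symm.trans
    (ofList_corePrefix (le_max_left m t) ht).1

theorem stoppedPathMem_corePath_iff [NeZero d] (hb : ∀ i, (b i).points ≠ []) {n m : ℕ}
    (h : FirstPassage n (corePrefix b m)) (A : Set (List (Site d))) :
    StoppedPathMem n (corePath b) A ↔ corePrefix b m ∈ A := by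
  obtain ⟨N, hN, -⟩ := id h
  have hp : pathTo (corePath b) N = corePrefix b m :=
    (pathTo_eq_iff hN).2 fun t ht => corePath_eq hb (by omega)
  have hh : hitTime n (corePath b) = N := firstPassage_pathTo_iff.1 (hp ▸ h)
  constructor
  · rintro ⟨N', hN', hA⟩
    obtain rfl : N = N' := by exact_mod_cast hh.symm.trans hN'
    rwa [← hp]
  · exact fun hA => ⟨N, hh, hp ▸ hA⟩

end CorePath

/-! ### Passing between conditional and joint probabilities. -/

section Transfer

variable {Ω Ω' : Type*} [MeasurableSpace Ω] [MeasurableSpace Ω'] {μ : Measure Ω} {P : Measure Ω'}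
  [IsProbabilityMeasure μ] [IsProbabilityMeasure P] {E F : Set Ω} {E' F' : Set Ω'} {c : ℝ}

/-- Null conditions need no separate treatment: the hypothesis on `E'` makes both sides vanish
together. -/
theorem measure_inter_of_cond (hc : 0 < c) (hE : MeasurableSet E) (hE' : MeasurableSet E')
    (h1 : P.real E' = μ.real E / c) (h2 : P[|E'] F' = μ[|E] F) :
    P (E' ∩ F') = μ (E ∩ F) / ENNReal.ofReal c := by
  have h3 : P E' = μ E / ENNReal.ofReal c := by
    rw [← ENNReal.ofReal_toReal (measure_ne_top P E'), ← measureReal_def, h1,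
      ENNReal.ofReal_div_of_pos hc, measureReal_def, ENNReal.ofReal_toReal (measure_ne_top μ E)]
  rw [← cond_mul_eq_inter hE', ← cond_mul_eq_inter hE, h2, h3, mul_div_assoc]

omit [IsProbabilityMeasure μ] [IsProbabilityMeasure P] in
theorem cond_eq_of_measure_inter (hc : 0 < c) (hE : MeasurableSet E) (hE' : MeasurableSet E')
    (h1 : P E' = μ E / ENNReal.ofReal c) (h2 : P (E' ∩ F') = μ (E ∩ F) / ENNReal.ofReal c) :
    P[|E'] F' = μ[|E] F := by
  have hc0 : ENNReal.ofReal c ≠ 0 := (ENNReal.ofReal_pos.2 hc).ne'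
  have hct : ENNReal.ofReal c ≠ ⊤ := ENNReal.ofReal_ne_top
  rw [cond_apply hE', cond_apply hE, h1, h2, ENNReal.inv_div (Or.inl hct) (Or.inl hc0),
    div_eq_mul_inv, div_eq_mul_inv, mul_comm (ENNReal.ofReal c), mul_assoc,
    mul_comm (μ (E ∩ F)), ← mul_assoc (ENNReal.ofReal c), ENNReal.mul_inv_cancel hc0 hct, one_mul]

end Transfer

namespace Model

variable {d : ℕ} [NeZero d] {Ω : Type*} [MeasurableSpace Ω] {M : Model d Ω} {μ : Measure Ω}
  [IsProbabilityMeasure μ]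

omit [IsProbabilityMeasure μ] in
theorem Regular.measurableSet_etaStar (hM : M.Regular μ) (n : ℕ) :
    MeasurableSet {ω | etaStar n (M.bound ω) (M.path ω) = 0} := by
  have h := hM.measurableSet_stopped n fun y => eta n (ofList y) = 0
  convert h using 1
  ext ω
  exact etaStar_eq_coe_iff (m := 0)

omit [IsProbabilityMeasure μ] in
theorem Regular.measurableSet_kappaStar (hM : M.Regular μ) (l : ℕ) :
    MeasurableSet {ω | kappaStar l (M.zeroModel.bound ω) (M.zeroModel.path ω) =
      ((0 : ℕ) : WithBot ℕ)} := by
  have h := hM.zeroModel_regular.measurableSet_stopped l fun y =>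
    1 ≤ eta l (ofList y) ∧ kappa l (ofList y) = ((0 : ℕ) : WithBot ℕ)
  convert h using 1
  ext ω
  exact kappaStar_eq_coe_iff

variable {q : ℝ}

omit [IsProbabilityMeasure μ] in
theorem IsRate.psi_mul_pow_pos (hq : M.IsRate μ q) (k : ℕ) : 0 < M.psi μ q * q ^ k :=
  mul_pos hq.psi_pos (pow_pos hq.pos k)

end Model

/-! ### The law of the concatenated core blocks. -/

section CoreLaw

variable {d : ℕ} [NeZero d] {Ω Ω' : Type*} [MeasurableSpace Ω] [MeasurableSpace Ω']
  {M : Model d Ω} {μ : Measure Ω} [IsProbabilityMeasure μ] {P : Measure Ω'}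
  [IsProbabilityMeasure P] {q : ℝ} {b : ℕ → Ω' → Block d}

omit [IsProbabilityMeasure μ] [IsProbabilityMeasure P] in
theorem IsCore.measurableSet_height (hb : IsCore M μ q b P) (i k : ℕ) :
    MeasurableSet {w | (b i w).height = k} :=
  hb.measurable_block i (MeasurableSpace.measurableSet_top (s := {v : Block d | v.height = k}))

open Classical in
theorem IsCore.measure_zero (hb : IsCore M μ q b P) (hM : M.Regular μ) (hq : M.IsRate μ q)
    (k : ℕ) (y : List (Site d)) :
    P {w | (b 0 w).points = y ∧ (b 0 w).height = k} =
      (if FirstPassage k y ∧ eta k (ofList y) = 0 then M.weight μ y else 0) /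
        ENNReal.ofReal (M.psi μ q * q ^ k) := by
  have hset : {w | (b 0 w).points = y ∧ (b 0 w).height = k} =
      ⋃ K : ℕ, {w | (b 0 w).height = k} ∩ {w | (b 0 w).duration = K ∧ (b 0 w).points = y} := by
    ext w
    simp [and_comm]
  rw [hset, measure_iUnion]
  · have h : ∀ K : ℕ, P ({w | (b 0 w).height = k} ∩
        {w | (b 0 w).duration = K ∧ (b 0 w).points = y}) =
        (if y.length = K + 1 ∧ FirstPassage k y ∧ eta k (ofList y) = 0 then
          M.weight μ y else 0) / ENNReal.ofReal (M.psi μ q * q ^ k) := fun K => by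
      rw [measure_inter_of_cond (hq.psi_mul_pow_pos k) (hM.measurableSet_etaStar k)
        (hb.measurableSet_height 0 k) (hb.height_zero k) (hb.path_zero k K y),
        hM.measure_start_block]
    simp only [h]
    by_cases hy : FirstPassage k y ∧ eta k (ofList y) = 0
    · obtain ⟨N, hN, -⟩ := id hy.1
      rw [tsum_eq_single N, if_pos hy, if_pos ⟨hN, hy⟩]
      intro K hK
      rw [if_neg fun h' => hK (by omega), ENNReal.zero_div]
    · simp [hy]
  · intro K K' hne
    refine Set.disjoint_left.2 fun w hw hw' => hne ?_
    exact hw.2.1.symm.trans hw'.2.1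
  · intro K
    exact hb.measurable_block 0 (MeasurableSpace.measurableSet_top
      (s := {v : Block d | v.height = k ∧ v.duration = K ∧ v.points = y}))

theorem IsCore.measure_succ (hb : IsCore M μ q b P) (hM : M.Regular μ) (hq : M.IsRate μ q)
    (i : ℕ) {l : ℕ} (hl : 1 ≤ l) (x : List (Site d)) :
    P {w | (b (i + 1) w).points = x ∧ (b (i + 1) w).height = l} =
      M.blockWeight μ l x / ENNReal.ofReal (q ^ l) := by
  classical
  have hset : {w | (b (i + 1) w).points = x ∧ (b (i + 1) w).height = l} =
      ⋃ K : ℕ, {w | (b (i + 1) w).height = l} ∩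
        {w | (b (i + 1) w).duration = K ∧ (b (i + 1) w).points = x} := by
    ext w
    simp [and_comm]
  rw [hset, measure_iUnion]
  · have h : ∀ K : ℕ, P ({w | (b (i + 1) w).height = l} ∩
        {w | (b (i + 1) w).duration = K ∧ (b (i + 1) w).points = x}) =
        (if x.length = K then M.blockWeight μ l x else 0) / ENNReal.ofReal (q ^ l) := fun K => by
      rw [measure_inter_of_cond (pow_pos hq.pos l) (hM.measurableSet_kappaStar l)
        (hb.measurableSet_height (i + 1) l) (hb.height_succ (i + 1) l (by omega) hl)
        (hb.path_succ (i + 1) l K x (by omega) hl), hM.measure_block]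
    simp only [h]
    rw [tsum_eq_single x.length, if_pos rfl]
    intro K hK
    rw [if_neg (Ne.symm hK), ENNReal.zero_div]
  · intro K K' hne
    refine Set.disjoint_left.2 fun w hw hw' => hne ?_
    exact hw.2.1.symm.trans hw'.2.1
  · intro K
    exact hb.measurable_block (i + 1) (MeasurableSpace.measurableSet_top
      (s := {v : Block d | v.height = l ∧ v.duration = K ∧ v.points = x}))

omit [IsProbabilityMeasure μ] in
-- The heights `l ≥ 1` already carry the full mass by the choice of `q`, so nothing is left for
-- height `0`, which `IsCore` does not mention.
theorem IsCore.measure_height_eq_zero (hb : IsCore M μ q b P) (hq : M.IsRate μ q) (i : ℕ) :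
    P {w | (b (i + 1) w).height = 0} = 0 := by
  have h1 : ∑' l, P {w | (b (i + 1) w).height = l} = 1 := by
    rw [← measure_iUnion]
    · rw [← measure_univ (μ := P)]
      congr 1
      ext w
      simp
    · intro l l' hne
      exact Set.disjoint_left.2 fun w hw hw' => hne (hw.symm.trans hw')
    · exact hb.measurableSet_height (i + 1)
  have h2 : ∑' l, P {w | (b (i + 1) w).height = l + 1} = 1 := by
    have : ∀ l, P {w | (b (i + 1) w).height = l + 1} =
        ENNReal.ofReal (M.probKappa μ (l + 1) / q ^ (l + 1)) := fun l => by
      rw [← hb.height_succ (i + 1) (l + 1) (by omega) (by omega), measureReal_def,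
        ENNReal.ofReal_toReal (measure_ne_top _ _)]
    simp only [this]
    rw [← ENNReal.ofReal_tsum_of_nonneg _ hq.hasSum_one.summable, hq.hasSum_one.tsum_eq,
      ENNReal.ofReal_one]
    exact fun l => div_nonneg measureReal_nonneg (pow_pos hq.pos _).le
  rw [tsum_eq_zero_add' ENNReal.summable, h2] at h1
  exact (ENNReal.add_left_inj ENNReal.one_ne_top).1 (h1.trans (zero_add 1).symm)

omit [IsProbabilityMeasure μ] [IsProbabilityMeasure P] in
theorem IsCore.measure_past_inter (hb : IsCore M μ q b P) (m k l : ℕ) (y x : List (Site d)) :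
    P ({w | corePrefix (fun i => b i w) m = y ∧ coreLevel (fun i => b i w) m = k} ∩
        {w | (b (m + 1) w).points = x ∧ (b (m + 1) w).height = l}) =
      P {w | corePrefix (fun i => b i w) m = y ∧ coreLevel (fun i => b i w) m = k} *
        P {w | (b (m + 1) w).points = x ∧ (b (m + 1) w).height = l} := by
  classical
  have hind := hb.indep.indepFun_finset (Finset.range (m + 1)) {m + 1} (by simp)
    hb.measurable_block
  -- The past is expressed through the blocks `0, …, m` alone, to which independence applies; the
  -- default block is never read.
  let ext : (Finset.range (m + 1) → Block d) → ℕ → Block d := fun r i =>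
    if hi : i ∈ Finset.range (m + 1) then r ⟨i, hi⟩ else ⟨0, 0, []⟩
  have hext : ∀ w, ∀ i ≤ m, ext (fun j => b j w) i = b i w := fun w i hi => by
    simp only [ext]
    rw [dif_pos (Finset.mem_range.2 (by omega))]
  have h := hind.measure_inter_preimage_eq_mul
    {r | corePrefix (ext r) m = y ∧ coreLevel (ext r) m = k}
    {r | (r ⟨m + 1, by simp⟩).points = x ∧ (r ⟨m + 1, by simp⟩).height = l}
    (Set.to_countable _).measurableSet (Set.to_countable _).measurableSet
  have h1 : (fun w (j : Finset.range (m + 1)) => b j w) ⁻¹'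
      {r | corePrefix (ext r) m = y ∧ coreLevel (ext r) m = k} =
      {w | corePrefix (fun i => b i w) m = y ∧ coreLevel (fun i => b i w) m = k} := by
    ext w
    simp only [Set.mem_preimage, Set.mem_ofPred_eq]
    rw [corePrefix_congr (hext w), coreLevel_congr (hext w)]
  rw [h1] at h
  exact h

end CoreLaw

section CoreLaw

variable {d : ℕ} [NeZero d] {Ω Ω' : Type*} [MeasurableSpace Ω] [MeasurableSpace Ω']
  {M : Model d Ω} {μ : Measure Ω} [IsProbabilityMeasure μ] {P : Measure Ω'}
  [IsProbabilityMeasure P] {q : ℝ} {b : ℕ → Ω' → Block d}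

omit [IsProbabilityMeasure μ] [IsProbabilityMeasure P] in
theorem IsCore.measurable_seq (hb : IsCore M μ q b P) : Measurable fun w i => b i w :=
  measurable_pi_iff.2 hb.measurable_block

omit [NeZero d] in
theorem measurableSet_corePrefix_coreLevel (m n : ℕ) (z : List (Site d)) :
    MeasurableSet {c : ℕ → Block d | corePrefix c m = z ∧ coreLevel c m = n} := by
  let ext : (Finset.range (m + 1) → Block d) → ℕ → Block d := fun r i =>
    if hi : i ∈ Finset.range (m + 1) then r ⟨i, hi⟩ else ⟨0, 0, []⟩
  have hext : ∀ c : ℕ → Block d, ∀ i ≤ m, ext (fun j => c j) i = c i := fun c i hi => by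
    simp only [ext]
    rw [dif_pos (Finset.mem_range.2 (by omega))]
  have h1 : {c : ℕ → Block d | corePrefix c m = z ∧ coreLevel c m = n} =
      (fun c (j : Finset.range (m + 1)) => c j) ⁻¹'
        {r | corePrefix (ext r) m = z ∧ coreLevel (ext r) m = n} := by
    ext c
    simp only [Set.mem_preimage, Set.mem_ofPred_eq]
    rw [corePrefix_congr (hext c), coreLevel_congr (hext c)]
  rw [h1]
  exact (measurable_pi_iff.2 fun j => measurable_pi_apply _) (Set.to_countable _).measurableSet

omit [IsProbabilityMeasure μ] [IsProbabilityMeasure P] in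
theorem IsCore.measurableSet_past (hb : IsCore M μ q b P) (m n : ℕ) (z : List (Site d)) :
    MeasurableSet {w | corePrefix (fun i => b i w) m = z ∧ coreLevel (fun i => b i w) m = n} :=
  hb.measurable_seq (measurableSet_corePrefix_coreLevel m n z)

omit [IsProbabilityMeasure μ] [IsProbabilityMeasure P] in
theorem IsCore.measurableSet_block (hb : IsCore M μ q b P) (i l : ℕ) (x : List (Site d)) :
    MeasurableSet {w | (b i w).points = x ∧ (b i w).height = l} :=
  hb.measurable_block i (MeasurableSpace.measurableSet_top
    (s := {v : Block d | v.points = x ∧ v.height = l}))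

open Classical in
omit [IsProbabilityMeasure μ] in
-- After the null event of a last block of height `0` is removed, the previous level ranges over `k
-- < n`, as in the renewal equation.
theorem IsCore.measure_past_succ (hb : IsCore M μ q b P) (hq : M.IsRate μ q) (m n : ℕ)
    (z : List (Site d)) :
    P {w | corePrefix (fun i => b i w) (m + 1) = z ∧ coreLevel (fun i => b i w) (m + 1) = n} =
      ∑ k ∈ Finset.range n, ∑' r : List (Site d) × List (Site d), if cat r.1 r.2 = z then
        P {w | corePrefix (fun i => b i w) m = r.1 ∧ coreLevel (fun i => b i w) m = k} *
          P {w | (b (m + 1) w).points = r.2 ∧ (b (m + 1) w).height = n - k} else 0 := by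
  have hset : {w | corePrefix (fun i => b i w) (m + 1) = z ∧
      coreLevel (fun i => b i w) (m + 1) = n} \ {w | (b (m + 1) w).height = 0} =
      ⋃ k ∈ Finset.range n, ⋃ r : List (Site d) × List (Site d), if cat r.1 r.2 = z then
        {w | corePrefix (fun i => b i w) m = r.1 ∧ coreLevel (fun i => b i w) m = k} ∩
          {w | (b (m + 1) w).points = r.2 ∧ (b (m + 1) w).height = n - k} else ∅ := by
    ext w
    simp only [Set.mem_sdiff, Set.mem_ofPred_eq, Set.mem_iUnion, Finset.mem_range,
      corePrefix_succ, coreLevel_succ]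
    constructor
    · rintro ⟨⟨h1, h2⟩, h3⟩
      refine ⟨coreLevel (fun i => b i w) m, by omega,
        (corePrefix (fun i => b i w) m, (b (m + 1) w).points), ?_⟩
      rw [if_pos h1]
      exact ⟨⟨rfl, rfl⟩, rfl, by omega⟩
    · rintro ⟨k, hk, r, hr⟩
      split_ifs at hr with h
      · obtain ⟨⟨h1, h2⟩, h3, h4⟩ := hr
        rw [h1, h3]
        exact ⟨⟨h, by omega⟩, by omega⟩
      · exact hr.elim
  have hmeas : ∀ (k : ℕ) (r : List (Site d) × List (Site d)), MeasurableSet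
      (if cat r.1 r.2 = z then
        {w | corePrefix (fun i => b i w) m = r.1 ∧ coreLevel (fun i => b i w) m = k} ∩
          {w | (b (m + 1) w).points = r.2 ∧ (b (m + 1) w).height = n - k} else ∅) := by
    intro k r
    split_ifs
    · exact (hb.measurableSet_past m k r.1).inter (hb.measurableSet_block _ _ _)
    · exact MeasurableSet.empty
  rw [← measure_sdiff_null (hb.measure_height_eq_zero hq m), hset, measure_biUnion_finset]
  · refine Finset.sum_congr rfl fun k _ => ?_
    rw [measure_iUnion]
    · refine tsum_congr fun r => ?_
      split_ifs
      · exact hb.measure_past_inter m k (n - k) r.1 r.2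
      · exact measure_empty
    · intro r r' hne
      simp only [Function.onFun]
      split_ifs
      · exact Set.disjoint_left.2 fun w hw hw' => hne
          (Prod.ext (hw.1.1.symm.trans hw'.1.1) (hw.2.1.symm.trans hw'.2.1))
      all_goals simp
    · exact hmeas k
  · intro k _ k' _ hne
    refine Set.disjoint_left.2 fun w hw hw' => hne ?_
    simp only [Set.mem_iUnion] at hw hw'
    obtain ⟨r, hr⟩ := hw
    obtain ⟨r', hr'⟩ := hw'
    split_ifs at hr hr'
    · exact hr.1.2.symm.trans hr'.1.2
    all_goals first | exact hr.elim | exact hr'.elim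
  · exact fun k _ => MeasurableSet.iUnion fun r => hmeas k r

open Classical in
-- Adding a block multiplies by `blockWeight` and by `q ^ (-(n - k))`. The weights recombine through
-- `tsum_kappa_eq`, the powers of `q` through `q ^ k * q ^ (n - k) = q ^ n`, and the sum over `k`
-- through `eta_eq_succ_iff`.
theorem IsCore.measure_past (hb : IsCore M μ q b P) (hM : M.Regular μ) (hq : M.IsRate μ q)
    (m n : ℕ) (z : List (Site d)) :
    P {w | corePrefix (fun i => b i w) m = z ∧ coreLevel (fun i => b i w) m = n} =
      (if FirstPassage n z ∧ eta n (ofList z) = (m : ℤ) then M.weight μ z else 0) /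
        ENNReal.ofReal (M.psi μ q * q ^ n) := by
  induction m generalizing n z with
  | zero =>
    have h := hb.measure_zero hM hq n z
    simp only [corePrefix, coreLevel_zero]
    rw [h]
    simp only [Nat.cast_zero]
  | succ m ih =>
    rw [hb.measure_past_succ hq]
    have hterm : ∀ k ∈ Finset.range n, (∑' r : List (Site d) × List (Site d),
        if cat r.1 r.2 = z then
          P {w | corePrefix (fun i => b i w) m = r.1 ∧ coreLevel (fun i => b i w) m = k} *
            P {w | (b (m + 1) w).points = r.2 ∧ (b (m + 1) w).height = n - k} else 0) =
        (if FirstPassage n z ∧ kappa n (ofList z) = (k : WithBot ℕ) ∧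
          eta k (ofList z) = (m : ℤ) then M.weight μ z else 0) /
            ENNReal.ofReal (M.psi μ q * q ^ n) := by
      intro k hk
      rw [Finset.mem_range] at hk
      -- Prescribing the path `z` in the predicate collapses the sum on the left to a single term.
      have h := hM.tsum_kappa_eq hk fun y => eta k (ofList y) = (m : ℤ) ∧ y = z
      rw [tsum_eq_single z] at h
      swap
      · exact fun y hy => if_neg fun h' => hy h'.2.2.2
      have h' : (if FirstPassage n z ∧ kappa n (ofList z) = (k : WithBot ℕ) ∧
          eta k (ofList z) = (m : ℤ) then M.weight μ z else 0) =
          ∑' r : List (Site d) × List (Site d), if FirstPassage k r.1 ∧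
            (eta k (ofList (cat r.1 r.2)) = (m : ℤ) ∧ cat r.1 r.2 = z) then
              M.weight μ r.1 * M.blockWeight μ (n - k) r.2 else 0 := by
        refine Eq.trans ?_ (h.trans (tsum_congr fun r => by congr))
        simp only [and_true]
      rw [h', div_eq_mul_inv, ← ENNReal.tsum_mul_right]
      refine tsum_congr fun r => ?_
      by_cases hr : cat r.1 r.2 = z
      · rw [if_pos hr, ih, hb.measure_succ hM hq m (by omega)]
        by_cases hf : FirstPassage k r.1
        · obtain ⟨K, hK, -⟩ := id hf
          rw [eta_cat_left hK hf rfl]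
          by_cases he : eta k (ofList r.1) = (m : ℤ)
          · rw [if_pos ⟨hf, he⟩, if_pos ⟨hf, he, hr⟩]
            have hpow : ENNReal.ofReal (M.psi μ q * q ^ n) =
                ENNReal.ofReal (M.psi μ q * q ^ k) * ENNReal.ofReal (q ^ (n - k)) := by
              rw [← ENNReal.ofReal_mul (hq.psi_mul_pow_pos k).le, mul_assoc, ← pow_add,
                Nat.add_sub_cancel' hk.le]
            rw [hpow, ENNReal.mul_inv (Or.inr ENNReal.ofReal_ne_top)
              (Or.inl ENNReal.ofReal_ne_top), div_eq_mul_inv, div_eq_mul_inv]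
            ring
          · simp [he]
        · simp [hf]
      · simp [hr]
    rw [Finset.sum_congr rfl hterm]
    simp only [div_eq_mul_inv]
    rw [← Finset.sum_mul]
    congr 1
    by_cases hw : M.weight μ z = 0
    · simp [hw]
    by_cases hf : FirstPassage n z
    · obtain ⟨N, hN, hh⟩ := id hf
      have hs := hM.skipFreeList hw
      rw [SkipFreeList, hN, Nat.add_sub_cancel] at hs
      have hiff := eta_eq_succ_iff (m := m) hs hh
      by_cases he : eta n (ofList z) = ((m + 1 : ℕ) : ℤ)
      · obtain ⟨k, hk, hκ, hηk⟩ := hiff.1 he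
        rw [if_pos ⟨hf, he⟩, Finset.sum_eq_single k, if_pos ⟨hf, hκ, hηk⟩]
        · intro j _ hj
          refine if_neg fun h => hj ?_
          exact WithBot.coe_injective (h.2.1.symm.trans hκ)
        · exact fun h => absurd (Finset.mem_range.2 hk) h
      · rw [if_neg fun h => he h.2]
        refine Finset.sum_eq_zero fun k hk => if_neg fun h => he (hiff.2 ?_)
        exact ⟨k, Finset.mem_range.1 hk, h.2⟩
    · simp [hf]

theorem IsCore.ae_points_ne_nil (hb : IsCore M μ q b P) (hM : M.Regular μ) (hq : M.IsRate μ q) :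
    ∀ᵐ w ∂P, ∀ i, (b i w).points ≠ [] := by
  classical
  refine ae_all_iff.2 fun i => ?_
  have hnil : ∀ l, P {w | (b i w).points = [] ∧ (b i w).height = l} = 0 := by
    intro l
    rcases i with _ | i
    · rw [hb.measure_zero hM hq, if_neg, ENNReal.zero_div]
      rintro ⟨⟨N, hN, -⟩, -⟩
      simp at hN
    · rcases Nat.eq_zero_or_pos l with rfl | hl
      · exact measure_mono_null (fun w hw => hw.2) (hb.measure_height_eq_zero hq i)
      · rw [hb.measure_succ hM hq i hl, Model.blockWeight, if_neg, ENNReal.zero_div]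
        rintro ⟨h, -⟩
        have := (hitTime_eq_coe_iff.1 (h.hitTime_eq (N := 0) rfl)).1
        simp [ofList] at this
        omega
  refine measure_mono_null (fun w hw => ?_) (measure_iUnion_null hnil)
  simp only [Set.mem_compl_iff, Set.mem_ofPred_eq, not_not] at hw
  simp [hw]

theorem IsCore.ae_firstPassage (hb : IsCore M μ q b P) (hM : M.Regular μ) (hq : M.IsRate μ q)
    (m : ℕ) :
    ∀ᵐ w ∂P, FirstPassage (coreLevel (fun i => b i w) m) (corePrefix (fun i => b i w) m) := by
  classical
  have h : ∀ r : ℕ × List (Site d), ¬ FirstPassage r.1 r.2 → P {w |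
      corePrefix (fun i => b i w) m = r.2 ∧ coreLevel (fun i => b i w) m = r.1} = 0 := by
    intro r hr
    rw [hb.measure_past hM hq, if_neg fun h => hr h.1, ENNReal.zero_div]
  refine measure_mono_null (fun w hw => ?_)
    (measure_iUnion_null fun r => measure_iUnion_null (h r))
  simp only [Set.mem_compl_iff, Set.mem_ofPred_eq] at hw
  simp only [Set.mem_iUnion]
  exact ⟨(_, _), hw, rfl, rfl⟩

/-- Almost surely the prefix of `m + 1` blocks ends at the first passage of its own level, so it is
the stopped core path; `IsCore.measure_past` is then summed over `A`. -/
theorem IsCore.measure_stopped (hb : IsCore M μ q b P) (hM : M.Regular μ) (hq : M.IsRate μ q)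
    (A : Set (List (Site d))) (n m : ℕ) :
    P {w | coreLevel (fun i => b i w) m = n ∧ StoppedPathMem n (corePath fun i => b i w) A} =
      μ {ω | hitTime n (M.path ω) < M.death ω ∧ etaStar n (M.bound ω) (M.path ω) = (m : ℤ) ∧
        StoppedPathMem n (M.path ω) A} / ENNReal.ofReal (M.psi μ q * q ^ n) := by
  classical
  have h1 : P {w | coreLevel (fun i => b i w) m = n ∧
      StoppedPathMem n (corePath fun i => b i w) A} =
      P (⋃ z : List (Site d), if z ∈ A then
        {w | corePrefix (fun i => b i w) m = z ∧ coreLevel (fun i => b i w) m = n} else ∅) := by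
    refine measure_congr ?_
    filter_upwards [hb.ae_points_ne_nil hM hq, hb.ae_firstPassage hM hq m] with w h2 h3
    refine propext ?_
    change (coreLevel (fun i => b i w) m = n ∧ StoppedPathMem n (corePath fun i => b i w) A) ↔
      w ∈ ⋃ z : List (Site d), if z ∈ A then
        {w | corePrefix (fun i => b i w) m = z ∧ coreLevel (fun i => b i w) m = n} else ∅
    rw [Set.mem_iUnion]
    constructor
    · rintro ⟨rfl, h4⟩
      refine ⟨corePrefix (fun i => b i w) m, ?_⟩
      rw [if_pos ((stoppedPathMem_corePath_iff h2 h3 A).1 h4)]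
      exact ⟨rfl, rfl⟩
    · rintro ⟨z, hz⟩
      split_ifs at hz with hzA
      · obtain ⟨rfl, rfl⟩ := hz
        exact ⟨rfl, (stoppedPathMem_corePath_iff h2 h3 A).2 hzA⟩
      · exact hz.elim
  rw [h1, measure_iUnion, hM.measure_etaStar_stopped, div_eq_mul_inv, ← ENNReal.tsum_mul_right]
  · refine tsum_congr fun z => ?_
    by_cases hz : z ∈ A
    · rw [if_pos hz, hb.measure_past hM hq, div_eq_mul_inv]
      congr 1
      exact if_congr (by simp [hz]) rfl rfl
    · simp [hz]
  · intro z z' hne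
    simp only [Function.onFun]
    split_ifs
    · exact Set.disjoint_left.2 fun w hw hw' => hne (hw.1.symm.trans hw'.1)
    all_goals simp
  · intro z
    split_ifs
    · exact hb.measurableSet_past m n z
    · exact MeasurableSet.empty

theorem IsCore.measureReal_stopped (hb : IsCore M μ q b P) (hM : M.Regular μ)
    (hq : M.IsRate μ q) (A : Set (List (Site d))) (n m : ℕ) :
    μ.real {ω | hitTime n (M.path ω) < M.death ω ∧
        etaStar n (M.bound ω) (M.path ω) = (m : ℤ) ∧ StoppedPathMem n (M.path ω) A} =
      M.psi μ q * q ^ n * P.real {w | coreLevel (fun i => b i w) m = n ∧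
        StoppedPathMem n (corePath fun i => b i w) A} := by
  have h := hq.psi_mul_pow_pos n
  rw [measureReal_def P, hb.measure_stopped hM hq, ENNReal.toReal_div,
    ENNReal.toReal_ofReal h.le, mul_div_cancel₀ _ h.ne', measureReal_def]

end CoreLaw

/-! ### Construction of the core blocks. -/

section Existence

variable {d : ℕ}

/-- The law on blocks which gives the mass `c k y` to the block of height `k` with the points
`y`, whose duration is `len y`. -/
noncomputable def blockLaw (c : ℕ → List (Site d) → ℝ≥0∞) (len : List (Site d) → ℕ) :
    Measure (Block d) :=
  Measure.sum fun r : ℕ × List (Site d) => c r.1 r.2 • Measure.dirac ⟨r.1, len r.2, r.2⟩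

variable {c : ℕ → List (Site d) → ℝ≥0∞} {len : List (Site d) → ℕ}

theorem blockLaw_apply (s : Set (Block d)) : blockLaw c len s =
    ∑' k, ∑' y, c k y * s.indicator 1 (⟨k, len y, y⟩ : Block d) := by
  rw [blockLaw, Measure.sum_apply _ MeasurableSpace.measurableSet_top, ENNReal.tsum_prod']
  refine tsum_congr fun k => tsum_congr fun y => ?_
  rw [Measure.smul_apply, Measure.dirac_apply' _ MeasurableSpace.measurableSet_top, smul_eq_mul]

theorem blockLaw_height (k : ℕ) : blockLaw c len {v | v.height = k} = ∑' y, c k y := by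
  classical
  rw [blockLaw_apply, tsum_eq_single k]
  · simp
  · intro k' hk'
    simp [hk']

theorem blockLaw_height_inter [DecidableEq (List (Site d))] (k K : ℕ) (y : List (Site d)) :
    blockLaw c len ({v | v.height = k} ∩ {v | v.duration = K ∧ v.points = y}) =
      if len y = K then c k y else 0 := by
  rw [blockLaw_apply, tsum_eq_single k, tsum_eq_single y]
  · by_cases h : len y = K <;> simp [h]
  · intro y' hy'
    simp [hy']
  · intro k' hk'
    simp [hk']

variable [NeZero d] {Ω : Type*} [MeasurableSpace Ω] {M : Model d Ω} {μ : Measure Ω}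
  [IsProbabilityMeasure μ] {q : ℝ}

/-- The law of the initial block. -/
noncomputable def startBlockLaw (M : Model d Ω) (μ : Measure Ω) (q : ℝ) : Measure (Block d) :=
  open Classical in
  blockLaw (fun k y => (if FirstPassage k y ∧ eta k (ofList y) = 0 then M.weight μ y else 0) /
    ENNReal.ofReal (M.psi μ q * q ^ k)) fun y => y.length - 1

/-- The law of the other blocks. -/
noncomputable def nextBlockLaw (M : Model d Ω) (μ : Measure Ω) (q : ℝ) : Measure (Block d) :=
  blockLaw (fun l x => M.blockWeight μ l x / ENNReal.ofReal (q ^ l)) List.length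

omit [IsProbabilityMeasure μ] in
theorem startBlockLaw_height (k : ℕ) : startBlockLaw M μ q {v | v.height = k} =
    M.firstReach μ k / ENNReal.ofReal (M.psi μ q * q ^ k) := by
  rw [startBlockLaw, blockLaw_height, Model.firstReach]
  simp only [div_eq_mul_inv]
  rw [ENNReal.tsum_mul_right]

omit [IsProbabilityMeasure μ] in
theorem nextBlockLaw_height (l : ℕ) : nextBlockLaw M μ q {v | v.height = l} =
    M.gap μ l / ENNReal.ofReal (q ^ l) := by
  rw [nextBlockLaw, blockLaw_height, Model.gap]
  simp only [div_eq_mul_inv]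
  rw [ENNReal.tsum_mul_right]

omit [NeZero d] in
theorem measure_block_univ (ν : Measure (Block d)) :
    ν Set.univ = ∑' k, ν {v | v.height = k} := by
  rw [← measure_iUnion]
  · congr 1
    ext v
    simp
  · intro k k' hne
    exact Set.disjoint_left.2 fun v hv hv' => hne (hv.symm.trans hv')
  · exact fun k => MeasurableSpace.measurableSet_top

theorem isProbabilityMeasure_startBlockLaw (hM : M.Regular μ) (hq : M.IsRate μ q) :
    IsProbabilityMeasure (startBlockLaw M μ q) := by
  refine ⟨?_⟩
  have h : ∀ k, startBlockLaw M μ q {v | v.height = k} =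
      ENNReal.ofReal (M.probEta μ k / q ^ k / M.psi μ q) := by
    intro k
    rw [startBlockLaw_height, ← hM.measure_etaStar, div_div, mul_comm (q ^ k),
      ENNReal.ofReal_div_of_pos (hq.psi_mul_pow_pos k), Model.probEta, measureReal_def,
      ENNReal.ofReal_toReal (measure_ne_top _ _)]
  rw [measure_block_univ]
  simp only [h]
  rw [← ENNReal.ofReal_tsum_of_nonneg _ (hq.summable_psi.div_const _), tsum_div_const,
    ← Model.psi, div_self hq.psi_pos.ne', ENNReal.ofReal_one]
  exact fun k => div_nonneg (div_nonneg measureReal_nonneg (pow_pos hq.pos k).le) hq.psi_pos.le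

theorem isProbabilityMeasure_nextBlockLaw (hM : M.Regular μ) (hq : M.IsRate μ q) :
    IsProbabilityMeasure (nextBlockLaw M μ q) := by
  refine ⟨?_⟩
  have h : ∀ k, nextBlockLaw M μ q {v | v.height = k + 1} =
      ENNReal.ofReal (M.probKappa μ (k + 1) / q ^ (k + 1)) := by
    intro k
    rw [nextBlockLaw_height, ← hM.measure_kappaStar, ENNReal.ofReal_div_of_pos (pow_pos hq.pos _),
      Model.probKappa, measureReal_def, ENNReal.ofReal_toReal (measure_ne_top _ _)]
  rw [measure_block_univ, tsum_eq_zero_add' ENNReal.summable, nextBlockLaw_height,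
    Model.gap_zero, ENNReal.zero_div, zero_add]
  simp only [h]
  rw [← ENNReal.ofReal_tsum_of_nonneg _ hq.hasSum_one.summable, hq.hasSum_one.tsum_eq,
    ENNReal.ofReal_one]
  exact fun k => div_nonneg measureReal_nonneg (pow_pos hq.pos _).le

/-- Independent blocks with the prescribed joint laws of height and points, whose masses sum to one
by the choice of `q`. The duration is a function of the points: the initial block lists `S_0`, so it
lasts one unit less than its length, while the others omit their starting point. -/
theorem exists_isCore (hM : M.Regular μ) (hq : M.IsRate μ q) :
    ∃ (Ω' : Type) (_ : MeasurableSpace Ω') (P : Measure Ω') (b : ℕ → Ω' → Block d),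
      IsProbabilityMeasure P ∧ IsCore M μ q b P := by
  classical
  have := isProbabilityMeasure_startBlockLaw hM hq
  have := isProbabilityMeasure_nextBlockLaw hM hq
  let ν : ℕ → Measure (Block d) := fun i =>
    if i = 0 then startBlockLaw M μ q else nextBlockLaw M μ q
  have hν : ∀ i, IsProbabilityMeasure (ν i) := fun i => by
    simp only [ν]
    split_ifs <;> assumption
  obtain ⟨Ω', _, P, b, hb, hlaw, hind, hP⟩ := exists_hasLaw_indepFun (fun _ : ℕ => Block d) ν
  have hmap : ∀ i (s : Set (Block d)), P (b i ⁻¹' s) = ν i s := fun i s => by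
    rw [← (hlaw i).map_eq, Measure.map_apply (hb i) MeasurableSpace.measurableSet_top]
  have hsucc : ∀ i, 1 ≤ i → ν i = nextBlockLaw M μ q := fun i hi => if_neg (by omega)
  have hh0 : ∀ k, P {w | (b 0 w).height = k} =
      M.firstReach μ k / ENNReal.ofReal (M.psi μ q * q ^ k) := fun k =>
    (hmap 0 {v | v.height = k}).trans (startBlockLaw_height k)
  have hhs : ∀ i l, 1 ≤ i → P {w | (b i w).height = l} =
      M.gap μ l / ENNReal.ofReal (q ^ l) := fun i l hi =>
    (hmap i {v | v.height = l}).trans (hsucc i hi ▸ nextBlockLaw_height l)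
  have hmeas : ∀ i k, MeasurableSet {w | (b i w).height = k} := fun i k =>
    hb i (MeasurableSpace.measurableSet_top (s := {v : Block d | v.height = k}))
  refine ⟨Ω', _, P, b, hP, hb, hind, fun k => ?_, fun i l hi hl => ?_, fun k K y => ?_,
    fun i l L x hi hl => ?_⟩
  · rw [measureReal_def, hh0, ENNReal.toReal_div, hM.probEta_eq,
      ENNReal.toReal_ofReal (hq.psi_mul_pow_pos k).le]
  · rw [measureReal_def, hhs i l hi, ENNReal.toReal_div, hM.probKappa_eq,
      ENNReal.toReal_ofReal (pow_pos hq.pos l).le]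
  · refine cond_eq_of_measure_inter (hq.psi_mul_pow_pos k) (hM.measurableSet_etaStar k)
      (hmeas 0 k) (by rw [hh0, hM.measure_etaStar]) ?_
    refine (hmap 0 ({v | v.height = k} ∩ {v | v.duration = K ∧ v.points = y})).trans ?_
    rw [hM.measure_start_block]
    change startBlockLaw M μ q _ = _
    rw [startBlockLaw, blockLaw_height_inter]
    by_cases hf : FirstPassage k y
    · obtain ⟨N, hN, -⟩ := id hf
      by_cases hK : N = K
      · simp [hN, hK, hf]
      · simp [hN, hK]
    · simp [hf]
  · refine cond_eq_of_measure_inter (pow_pos hq.pos l) (hM.measurableSet_kappaStar l)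
      (hmeas i l) (by rw [hhs i l hi, hM.measure_kappaStar]) ?_
    refine (hmap i ({v | v.height = l} ∩ {v | v.duration = L ∧ v.points = x})).trans ?_
    rw [hM.measure_block, hsucc i hi, nextBlockLaw, blockLaw_height_inter]
    split_ifs
    · rfl
    · simp

end Existence

end BoundedWalk

theorem theorem2 {d : ℕ} [NeZero d] {Ω : Type*} [MeasurableSpace Ω] (μ : Measure Ω)
    [IsProbabilityMeasure μ] (M : BoundedWalk.Model d Ω)
    (hA1 : M.SkipFree μ) (hA2 : M.Environment μ) (hA3 : M.Virgin μ) (hA4 : M.Returns μ) :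
    ∃ q : ℝ, M.IsRate μ q ∧
      (∃ (Ω' : Type) (_ : MeasurableSpace Ω') (P : Measure Ω')
        (b : ℕ → Ω' → BoundedWalk.Block d),
        IsProbabilityMeasure P ∧ BoundedWalk.IsCore M μ q b P) ∧
      ∀ (Ω' : Type*) [MeasurableSpace Ω'] (P : Measure Ω') [IsProbabilityMeasure P]
        (b : ℕ → Ω' → BoundedWalk.Block d), BoundedWalk.IsCore M μ q b P →
        ∀ (A : Set (List (BoundedWalk.Site d))) (n m : ℕ), m ≤ n →
          μ.real {ω | BoundedWalk.hitTime n (M.path ω) < M.death ω ∧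
              BoundedWalk.etaStar n (M.bound ω) (M.path ω) = (m : ℤ) ∧
              BoundedWalk.StoppedPathMem n (M.path ω) A} =
            M.psi μ q * q ^ n *
              P.real {w | BoundedWalk.coreLevel (fun i => b i w) m = n ∧
                BoundedWalk.StoppedPathMem n (BoundedWalk.corePath fun i => b i w) A} := by
  have hM := BoundedWalk.Model.regular_of hA1 hA2 hA3
  obtain ⟨q, hq⟩ := hM.exists_isRate hA2 hA4
  exact ⟨q, hq, BoundedWalk.exists_isCore hM hq,
    fun Ω' _ P _ b hb A n m _ => hb.measureReal_stopped hM hq A n m⟩
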